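/- Let $p$ be an odd prime, let $\mathbb F_q$ be a finite field with $q=p^f$ elements, and let $K=\mathbb F_q(t)$. For an integer $d\ge 1$ let $E_d/K$ be the elliptic curve $y^2=x(x^2+t^{2d}x-4t^{2d})$. For a place $v$ of $K$ with residue field $\mathbb F_v$, let $q_v=|\mathbb F_v|$ and $\deg v=[\mathbb F_v:\mathbb F_q]$, let $(\widetilde{E_d})_v$ be the plane cubic over $\mathbb F_v$ obtained by reducing a minimal $v$-integral Weierstrass model of $E_d$ modulo $v$, and let $a_v=q_v+1-|(\widetilde{E_d})_v(\mathbb F_v)|$. Put $$L(E_d/K,T)=\prod_{v\text{ good}}\bigl(1-a_vT^{\deg v}+q_vT^{2\deg v}\bigr)^{-1}\prod_{v\text{ bad}}\bigl(1-a_vT^{\deg v}\bigr)^{-1}\in\mathbb Z[[T]],$$ where $v$ runs over the places of good, respectively bad, reduction of $E_d$. Let $\bar{\mathbb Q}$ be an algebraic closure of $\mathbb Q$, $\bar{\mathbb Z}$ its ring of algebraic integers and $\mathfrak P$ a maximal ideal of $\bar{\mathbb Z}$ above $p$. Reduction modulo $\mathfrak P$ is an isomorphism from the group of roots of unity of order prime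 to $p$ in $\bar{\mathbb Z}$ to $(\bar{\mathbb Z}/\mathfrak P)^\times$; let $\mathbf t$ be its inverse. For $m\ge1$, regard $\mathbb F_{q^m}$ as the subfield with $q^m$ elements of $\bar{\mathbb Z}/\mathfrak P$. Let $d\ge 2$ be coprime to $q$, and let $Z_{2d}\subset\mathbb Z/2d\mathbb Z$ be the complement of $\{0,d/2,d,3d/2\}$ if $d$ is even, and of $\{0,d\}$ if $d$ is odd. Let $\mathcal O_q(Z_{2d})$ be the set of orbits of multiplication by $q$ on $Z_{2d}$, and write $|\mathbf n|$ for the number of elements of an orbit $\mathbf n$. For $n\in\mathbf n\in\mathcal O_q(Z_{2d})$ put $Q=q^{|\mathbf n|}$, let $\mathbf t_n$ be the character $x\mapsto\mathbf t(x)^{(Q-1)n/2d}$ of $\mathbb F_Q^\times$, and let $\lambda$ be the character of order $2$ of $\mathbb F_Q^\times$. Put $$\beta(\mathbf n)=\beta(n)=\mathbf t_n^2(4)\cdot j(\mathbf t_n,\mathbf t_n)\cdot j(\lambda\mathbf t_n^2,\mathbf t_n^{-1}),\qquad j(\chi,\psi)=-\sum_{x\in\mathbb F_Q}\chi(x)\psi(1-x),$$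 where the characters, all nontrivial, are extended by $0$ at $0$; this does not depend on the choice of $n\in\mathbf n$. Then the product defining $L(E_d/K,T)$ converges coefficientwise, $L(E_d/K,T)$ is a polynomial with integer coefficients, and its order of vanishing at $T=q^{-1}$ is $$\operatorname{ord}_{T=q^{-1}}L(E_d/K,T)=1+\bigl|\{\mathbf n\in\mathcal O_q(Z_{2d}):\beta(\mathbf n)=q^{|\mathbf n|}\}\bigr|.$$ -/

import Mathlib

noncomputable section

open Polynomial

namespace GriffonRank

/-! ### Places of `K = F(t)` -/

section Places

variable (F : Type*) [Field F]

/-- The places of `F(t)`: the finite ones, given by the monic irreducible polynomials of `F[t]`,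
and the place at infinity. -/
inductive Place : Type _ where
  | finite (P : F[X]) (hm : P.Monic) (hi : Irreducible P) : Place
  | infinite : Place

variable {F}

namespace Place

/-- The prime ideal of `F[t]` generated by an irreducible polynomial. -/
def primeOf (P : F[X]) (hi : Irreducible P) : IsDedekindDomain.HeightOneSpectrum F[X] where
  asIdeal := Ideal.span {P}
  isPrime := (Ideal.span_singleton_prime hi.ne_zero).mpr hi.prime
  ne_bot := by simpa using hi.ne_zero

open Classical in
/-- The normalized (multiplicative) valuation of `F(t)` at a place. -/
def valuation : Place F → Valuation (RatFunc F) (WithZero (Multiplicative ℤ))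
  | finite P _ hi => (primeOf P hi).valuation (RatFunc F)
  | infinite => RatFunc.inftyValuation F

/-- The degree of a place, i.e. the degree over `F` of its residue field. -/
def degree : Place F → ℕ
  | finite P _ _ => P.natDegree
  | infinite => 1

/-- The valuation ring of a place. -/
abbrev ring (v : Place F) : ValuationSubring (RatFunc F) := v.valuation.valuationSubring

instance valuation_isNontrivial (v : Place F) : v.valuation.IsNontrivial := by
  classical
  cases v with
  | finite P hm hi =>
    obtain ⟨π, hπ⟩ := (primeOf P hi).valuation_exists_uniformizer (RatFunc F)
    refine ⟨π, ?_, ?_⟩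
    · change (primeOf P hi).valuation (RatFunc F) π ≠ 0
      rw [hπ]; simp
    · change (primeOf P hi).valuation (RatFunc F) π ≠ 1
      rw [hπ, ← WithZero.exp_zero]
      simp
  | infinite =>
    change (RatFunc.inftyValuation F).IsNontrivial
    infer_instance

instance ring_isDiscreteValuationRing (v : Place F) : IsDiscreteValuationRing v.ring :=
  v.valuation.valuationSubring_isDiscreteValuationRing

end Place

end Places

/-! ### The `L`-function of a Weierstrass curve over `F(t)` -/

section LFunction

open PowerSeries

variable {F : Type*} [Field F]

/-- The reduction at `v` of a minimal `v`-integral model of `W`. -/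
def reductionAt (W : WeierstrassCurve (RatFunc F)) (v : Place F) :
    WeierstrassCurve (IsLocalRing.ResidueField v.ring) :=
  (W.minimal v.ring).reduction v.ring

/-- The cardinality `q_v` of the residue field at `v`. -/
def residueCard (v : Place F) : ℕ := Nat.card (IsLocalRing.ResidueField v.ring)

/-- The number of rational points of the projective plane cubic defined by a Weierstrass equation:
all the affine solutions (a singular point included) and the point at infinity. -/
def cubicPointCount {k : Type*} [Field k] (W : WeierstrassCurve k) : ℕ :=
  Nat.card {P : k × k // W.toAffine.Equation P.1 P.2} + 1

/-- `a_v = q_v + 1 - |(reduced cubic)(F_v)|`. -/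
def traceAt (W : WeierstrassCurve (RatFunc F)) (v : Place F) : ℤ :=
  (residueCard v : ℤ) + 1 - cubicPointCount (reductionAt W v)

open Classical in
/-- The denominator of the Euler factor at `v`: `1 - a_v T ^ deg v + q_v T ^ (2 deg v)` if `v` is a
place of good reduction, and `1 - a_v T ^ deg v` if `v` is a place of bad reduction. -/
def eulerPolynomial (W : WeierstrassCurve (RatFunc F)) (v : Place F) : ℤ[X] :=
  if (W.minimal v.ring).HasGoodReduction v.ring then
    1 - Polynomial.C (traceAt W v) * Polynomial.X ^ v.degree
      + Polynomial.C (residueCard v : ℤ) * Polynomial.X ^ (2 * v.degree)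
  else 1 - Polynomial.C (traceAt W v) * Polynomial.X ^ v.degree

/-- The Euler factor at `v`, the inverse power series of `eulerPolynomial W v` (whose constant
term is `1`). -/
def eulerFactor (W : WeierstrassCurve (RatFunc F)) (v : Place F) : PowerSeries ℤ :=
  PowerSeries.invOfUnit (eulerPolynomial W v : PowerSeries ℤ) 1

open scoped PowerSeries.WithPiTopology in
/-- The Euler product converges coefficientwise. -/
def EulerProductConverges (W : WeierstrassCurve (RatFunc F)) : Prop :=
  Multipliable (eulerFactor W)

open scoped PowerSeries.WithPiTopology in
/-- The `L`-function `L(W/F(t), T)`: the product of the Euler factors over all places. -/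
def lFunction (W : WeierstrassCurve (RatFunc F)) : PowerSeries ℤ :=
  ∏' v : Place F, eulerFactor W v

end LFunction

/-- The curve `E_d : y ^ 2 = x (x ^ 2 + t ^ (2 d) x - 4 t ^ (2 d))` over `F(t)`. -/
def curve (F : Type*) [Field F] (d : ℕ) : WeierstrassCurve (RatFunc F) where
  a₁ := 0
  a₂ := RatFunc.X ^ (2 * d)
  a₃ := 0
  a₄ := -4 * RatFunc.X ^ (2 * d)
  a₆ := 0

/-! ### The action of `q` on `ℤ / 2d` -/

section Orbits

/-- The orbit `{n, q n, q ^ 2 n, …}` of `n` in `ℤ / D`. -/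
def qOrbit (q : ℕ) {D : ℕ} (n : ZMod D) : Set (ZMod D) :=
  Set.range fun j : ℕ => (q : ZMod D) ^ j * n

/-- The set `O_q(Z)` of orbits of a stable subset `Z`. -/
def orbits (q : ℕ) {D : ℕ} (Z : Set (ZMod D)) : Set (Set (ZMod D)) := qOrbit q '' Z

/-- The set `Z_{2d}`. -/
def indexSet (d : ℕ) : Set (ZMod (2 * d)) :=
  if Even d then {0, ((d / 2 : ℕ) : ZMod (2 * d)), (d : ZMod (2 * d)),
    ((3 * (d / 2) : ℕ) : ZMod (2 * d))}ᶜ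
  else {0, (d : ZMod (2 * d))}ᶜ

theorem qOrbit_ncard_ne_zero (q : ℕ) {D : ℕ} [NeZero D] (n : ZMod D) : (qOrbit q n).ncard ≠ 0 := by
  exact ((Set.ncard_pos (Set.toFinite _)).mpr (Set.range_nonempty _)).ne'

end Orbits

/-! ### The Teichmüller character -/

section Teichmuller

theorem exists_pow_eq_one (p : ℕ) [Fact p.Prime] {k : Type*} [Field k] [CharP k p] (x : k)
    (hx : IsIntegral ℤ x) (hx0 : x ≠ 0) : ∃ m : ℕ, m.Coprime p ∧ 0 < m ∧ x ^ m = 1 := by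
  let _ : Algebra (ZMod p) k := ZMod.algebra _ p
  have hint : IsIntegral (ZMod p) x := hx.tower_top
  let A := IntermediateField.adjoin (ZMod p) {x}
  have : FiniteDimensional (ZMod p) A := IntermediateField.adjoin.finiteDimensional hint
  have : Finite A := Module.finite_of_finite (ZMod p)
  let _ : Fintype A := Fintype.ofFinite A
  have : CharP A p := charP_of_injective_algebraMap (algebraMap (ZMod p) A).injective p
  let a : A := ⟨x, IntermediateField.mem_adjoin_simple_self _ _⟩
  have ha : a ≠ 0 := fun h => hx0 (congrArg Subtype.val h)
  obtain ⟨n, _, hn⟩ := FiniteField.card A p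
  refine ⟨Fintype.card A - 1, ?_, ?_, ?_⟩
  · have hp := (Fact.out : p.Prime)
    rw [Nat.coprime_comm, hp.coprime_iff_not_dvd]
    intro hd
    have h1 : 0 < Fintype.card A := Fintype.card_pos
    have h2 : p ∣ Fintype.card A := hn ▸ dvd_pow_self p n.ne_zero
    have h3 : p ∣ 1 := by
      have := Nat.dvd_sub h2 hd
      rwa [Nat.sub_sub_self h1] at this
    exact hp.one_lt.ne' (Nat.dvd_one.mp h3)
  · have := Fintype.one_lt_card (α := A)
    omega
  · exact congrArg Subtype.val (FiniteField.pow_card_sub_one_eq_one a ha)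

variable (p : ℕ) {L : Type*} [Field L] (𝔓 : Ideal (integralClosure ℤ L))

/-- The group of roots of unity of order prime to `p` in the ring of algebraic integers of `L`. -/
def primeToRoots (L : Type*) [Field L] : Subgroup (integralClosure ℤ L)ˣ where
  carrier := {ζ | ∃ m : ℕ, m.Coprime p ∧ 0 < m ∧ ζ ^ m = 1}
  one_mem' := ⟨1, by simp⟩
  mul_mem' := by
    rintro a b ⟨m, hm, hm0, ha⟩ ⟨n, hn, hn0, hb⟩
    refine ⟨m * n, Nat.Coprime.mul_left hm hn, Nat.mul_pos hm0 hn0, ?_⟩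
    rw [mul_pow, pow_mul, ha, one_pow, mul_comm m n, pow_mul, hb, one_pow, one_mul]
  inv_mem' := by
    rintro a ⟨m, hm, hm0, ha⟩
    exact ⟨m, hm, hm0, by rw [inv_pow, ha, inv_one]⟩

/-- Reduction modulo `𝔓` on the roots of unity of order prime to `p`. -/
def rootReduction : primeToRoots p L →* (integralClosure ℤ L ⧸ 𝔓)ˣ :=
  (Units.map (Ideal.Quotient.mk 𝔓 : integralClosure ℤ L →* integralClosure ℤ L ⧸ 𝔓)).comp
    (primeToRoots p L).subtype

variable [Fact p.Prime] [CharP (integralClosure ℤ L ⧸ 𝔓) p]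

theorem rootReduction_injective : Function.Injective (rootReduction p 𝔓) := by
  rw [injective_iff_map_eq_one]
  rintro ⟨ζ, m, hm, hm0, hζ⟩ h
  have h1 : Ideal.Quotient.mk 𝔓 (ζ : integralClosure ℤ L) = 1 := congrArg Units.val h
  have hζ' : (ζ : integralClosure ℤ L) ^ m = 1 := by
    simpa using congrArg Units.val hζ
  by_contra hne
  have hne' : (ζ : integralClosure ℤ L) - 1 ≠ 0 := by
    intro h0
    apply hne
    ext
    simpa using congrArg Subtype.val (sub_eq_zero.mp h0)
  have hs : ∑ i ∈ Finset.range m, (ζ : integralClosure ℤ L) ^ i = 0 := by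
    have := geom_sum_mul (ζ : integralClosure ℤ L) m
    rw [hζ', sub_self] at this
    exact (mul_eq_zero.mp this).resolve_right hne'
  have h2 := congrArg (Ideal.Quotient.mk 𝔓) hs
  simp only [map_sum, map_pow, h1, one_pow, Finset.sum_const, Finset.card_range, nsmul_eq_mul,
    mul_one, map_zero] at h2
  rw [CharP.cast_eq_zero_iff _ p] at h2
  exact ((Fact.out : p.Prime).coprime_iff_not_dvd.mp hm.symm) h2

variable [𝔓.IsMaximal]

theorem rootReduction_surjective [IsAlgClosed L] [CharZero L] :
    Function.Surjective (rootReduction p 𝔓) := by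
  intro x
  obtain ⟨y, hy⟩ := Ideal.Quotient.mk_surjective (x : integralClosure ℤ L ⧸ 𝔓)
  let _ : Field (integralClosure ℤ L ⧸ 𝔓) := Ideal.Quotient.field 𝔓
  obtain ⟨m, hm, hm0, hx'⟩ := exists_pow_eq_one p (x : integralClosure ℤ L ⧸ 𝔓)
    (hy ▸ (integralClosure.isIntegral y).map (Ideal.Quotient.mk 𝔓).toIntAlgHom) x.ne_zero
  have : NeZero m := ⟨hm0.ne'⟩
  have : NeZero (m : L) := ⟨by exact_mod_cast hm0.ne'⟩
  obtain ⟨ω, hω⟩ := HasEnoughRootsOfUnity.exists_primitiveRoot L m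
  have hωi : IsIntegral ℤ ω := hω.isIntegral hm0
  let w : integralClosure ℤ L := ⟨ω, hωi⟩
  have hw : IsPrimitiveRoot w m :=
    IsPrimitiveRoot.of_map_of_injective (f := (integralClosure ℤ L).val) hω Subtype.val_injective
  have hprod := X_pow_sub_one_eq_prod hm0 hw
  have h1 := congrArg (fun P => Ideal.Quotient.mk 𝔓 (P.eval y)) hprod
  simp only [eval_sub, eval_pow, eval_X, eval_one, map_sub, map_pow, hy, map_one,
    eval_prod, eval_C, map_prod] at h1
  rw [hx', sub_self] at h1
  obtain ⟨ζ, hζ, h0⟩ := Finset.prod_eq_zero_iff.mp h1.symm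
  rw [mem_nthRootsFinset hm0] at hζ
  let u : (integralClosure ℤ L)ˣ := Units.ofPowEqOne ζ m hζ hm0.ne'
  refine ⟨⟨u, m, hm, hm0, ?_⟩, ?_⟩
  · exact Units.pow_ofPowEqOne _ _
  · ext
    exact (sub_eq_zero.mp h0).symm

/-- The Teichmüller character `𝐭` of the residue field of `𝔓`, with values in `Lˣ`: the inverse of the reduction isomorphism
from the roots of unity of order prime to `p` to the units of the residue field. -/
def teichmuller [IsAlgClosed L] [CharZero L] : (integralClosure ℤ L ⧸ 𝔓)ˣ →* Lˣ :=
  ((Units.map ((integralClosure ℤ L).val : integralClosure ℤ L →* L)).comp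
    (primeToRoots p L).subtype).comp
    (MulEquiv.ofBijective (rootReduction p 𝔓)
      ⟨rootReduction_injective p 𝔓, rootReduction_surjective p 𝔓⟩).symm.toMonoidHom

end Teichmuller

/-! ### Jacobi sums and the numbers `β(n)` -/

section Beta

/-- The subfield with `p ^ e` elements, i.e. the set of `x` such that `x ^ (p ^ e) = x`, of an
algebraic closure `k` of `𝔽_p`. -/
def finiteSubfield (k : Type*) [Field k] (p : ℕ) [Fact p.Prime] [CharP k p] (e : ℕ) : Subfield k :=
  (iterateFrobenius k p e).eqLocusField (RingHom.id k)

instance finiteSubfield_finite (k : Type*) [Field k] (p : ℕ) [Fact p.Prime] [CharP k p] (e : ℕ)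
    [NeZero e] : Finite (finiteSubfield k p e) := by
  have hp := (Fact.out : p.Prime)
  have h1 : 1 < p ^ e := Nat.one_lt_pow (NeZero.ne e) hp.one_lt
  classical
  have h0 : (X ^ (p ^ e) - X : k[X]) ≠ 0 := FiniteField.X_pow_card_sub_X_ne_zero k h1
  refine Set.Finite.to_subtype (Set.Finite.subset (X ^ (p ^ e) - X : k[X]).roots.toFinset.finite_toSet
    fun x hx => ?_)
  have hx' : x ^ (p ^ e) = x := by
    have : iterateFrobenius k p e x = x := hx
    rwa [iterateFrobenius_def] at this
  simp [h0, hx']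

/-- The Jacobi sum `j_k(χ, ψ) = - ∑_{x + y = 1} χ(x) ψ(y)`. A `MulChar` vanishes at `0`, as the
extension by zero of a nontrivial character does; only nontrivial characters are used below. -/
def jac {k L : Type*} [Field k] [Fintype k] [Field L] (χ ψ : MulChar k L) : L := -jacobiSum χ ψ

open Classical in
/-- The character `λ` of order two of a finite field of odd characteristic, with values in `L`. -/
def quadChar (k L : Type*) [Field k] [Fintype k] [Field L] : MulChar k L :=
  (quadraticChar k).ringHomComp (Int.castRingHom L)

/-- `χ ^ 2 (4) · j(χ, χ) · j(λ χ ^ 2, χ⁻¹)`, for a character `χ` of a finite field. -/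
def jacobiProduct {k L : Type*} [Field k] [Fintype k] [Field L] (χ : MulChar k L) : L :=
  (χ ^ 2) 4 * jac χ χ * jac (quadChar k L * χ ^ 2) χ⁻¹

variable (p f d : ℕ) [Fact p.Prime] {L : Type*} [Field L] [IsAlgClosed L] [CharZero L]
  (𝔓 : Ideal (integralClosure ℤ L)) [𝔓.IsMaximal] [CharP (integralClosure ℤ L ⧸ 𝔓) p]

attribute [local instance] Ideal.Quotient.field

/-- The field `𝔽_{q ^ m}`, where `q = p ^ f`, as a subfield of the residue field of `𝔓`. -/
abbrev residueSubfield (m : ℕ) : Subfield (integralClosure ℤ L ⧸ 𝔓) :=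
  finiteSubfield (integralClosure ℤ L ⧸ 𝔓) p (f * m)

/-- The character `𝐭_n : x ↦ 𝐭(x) ^ ((q ^ |n| - 1) n / 2d)` of `𝔽_{q ^ |n|}`, where `q = p ^ f` and
`|n|` is the length of the orbit of `n` (so that the division is exact). -/
def teichmullerChar (n : ZMod (2 * d)) :
    MulChar (residueSubfield p f 𝔓 (qOrbit (p ^ f) n).ncard) L :=
  MulChar.ofUnitHom
    (((teichmuller p 𝔓).comp
      (Units.map ((residueSubfield p f 𝔓 (qOrbit (p ^ f) n).ncard).subtype :
        residueSubfield p f 𝔓 (qOrbit (p ^ f) n).ncard →* integralClosure ℤ L ⧸ 𝔓))) ^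
      (((p ^ f) ^ (qOrbit (p ^ f) n).ncard - 1) * n.val / (2 * d)))

/-- The number `β(n) = 𝐭_n ^ 2 (4) · j(𝐭_n, 𝐭_n) · j(λ 𝐭_n ^ 2, 𝐭_n⁻¹)`, the Jacobi sums being those
of `𝔽_{q ^ |n|}`, where `q = p ^ f`. -/
def beta [NeZero f] [NeZero d] (n : ZMod (2 * d)) : L :=
  haveI : NeZero (f * (qOrbit (p ^ f) n).ncard) :=
    ⟨mul_ne_zero (NeZero.ne f) (qOrbit_ncard_ne_zero (p ^ f) n)⟩
  letI : Fintype (residueSubfield p f 𝔓 (qOrbit (p ^ f) n).ncard) := Fintype.ofFinite _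
  jacobiProduct (teichmullerChar p f d 𝔓 n)

end Beta

end GriffonRank

end

/-!
Let `k ⊇ 𝔽_q` have `q ^ m` elements. The coefficient of `T ^ m` in `T L' / L` is the sum over
`τ ∈ k` of the traces of the fibres of `E_d` at `τ`, plus `1` from the place at infinity. For
`τ ≠ 0` the trace is a quadratic character sum over the cubic `x (x ^ 2 + s x - 4 s)` with
`s = τ ^ (2 d)`. Counting the `τ` above a given `s` by the characters of order dividing `2 d` and
evaluating the double sums by Jacobi sums, one gets `-q ^ m` from the trivial character and a Jacobi
product from each nontrivial one; those outside `Z_{2d}` cancel against the fibre at `τ = 0` and the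
place at infinity. By the Hasse–Davenport relation, the Jacobi product at an `n ∈ Z_{2d}` fixed by
`q ^ m` is `β(n) ^ (m / |𝐧|)`, where `𝐧` is the orbit of `n`. Hence
`L(E_d / K, T) = (1 - q T) ∏ (1 - β(𝐧) T ^ |𝐧|)`, the product being over the orbits `𝐧` in
`Z_{2d}`, and each factor has at most a simple zero at `T = q⁻¹`.
-/

noncomputable section

namespace GriffonRank

/-! ### Logarithmic derivatives and infinite products of power series -/

section LogDeriv

open PowerSeries

variable {R : Type*} [CommRing R]

/-- `p 0, p 1, …` are the coefficients of the logarithmic derivative `T G' / G`. Up to sign, `p n`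
is the sum of the `n`-th powers of the reciprocal roots of `G`. -/
def IsLogDeriv (G : R⟦X⟧) (p : ℕ → R) : Prop :=
  X * d⁄dX R G = G * mk p

theorem coeff_X_mul_derivative (G : R⟦X⟧) (n : ℕ) :
    coeff n (X * d⁄dX R G) = n * coeff n G := by
  cases n with
  | zero => simp
  | succ n =>
    rw [coeff_succ_X_mul, coeff_derivative, mul_comm, Nat.cast_succ]

theorem isLogDeriv_iff_coeff {G : R⟦X⟧} {p : ℕ → R} :
    IsLogDeriv G p ↔
      ∀ n : ℕ, n * coeff n G =
        ∑ ij ∈ Finset.HasAntidiagonal.antidiagonal n, coeff ij.1 G * p ij.2 := by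
  rw [IsLogDeriv, PowerSeries.ext_iff]
  refine forall_congr' fun n => ?_
  rw [coeff_X_mul_derivative, coeff_mul]
  simp only [coeff_mk]

theorem IsLogDeriv.congr {G : R⟦X⟧} {p r : ℕ → R} (h : IsLogDeriv G p) (hp : ∀ n, p n = r n) :
    IsLogDeriv G r := by
  rwa [← funext hp]

theorem isLogDeriv_one : IsLogDeriv (1 : R⟦X⟧) 0 := by
  rw [IsLogDeriv, derivative_one, mul_zero, one_mul]
  rfl

theorem IsLogDeriv.mul {G H : R⟦X⟧} {p r : ℕ → R} (hG : IsLogDeriv G p) (hH : IsLogDeriv H r) :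
    IsLogDeriv (G * H) (p + r) := by
  have hmk : mk (p + r) = mk p + mk r := rfl
  rw [IsLogDeriv] at *
  rw [Derivation.leibniz, hmk, smul_eq_mul, smul_eq_mul]
  linear_combination G * hH + H * hG

theorem IsLogDeriv.prod {ι : Type*} (s : Finset ι) {G : ι → R⟦X⟧} {p : ι → ℕ → R}
    (h : ∀ i ∈ s, IsLogDeriv (G i) (p i)) :
    IsLogDeriv (∏ i ∈ s, G i) (fun n => ∑ i ∈ s, p i n) := by
  classical
  induction s using Finset.induction_on with
  | empty => exact isLogDeriv_one
  | insert a s ha ih =>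
    rw [Finset.prod_insert ha]
    refine ((h a (s.mem_insert_self a)).mul
      (ih fun i hi => h i (Finset.mem_insert_of_mem hi))).congr fun n => ?_
    rw [Finset.sum_insert ha, Pi.add_apply]

theorem IsLogDeriv.of_mul_eq_one {G H : R⟦X⟧} {p : ℕ → R} (hG : IsLogDeriv G p)
    (h : G * H = 1) : IsLogDeriv H (-p) := by
  have hleibniz := congrArg (d⁄dX R) h
  rw [Derivation.leibniz, derivative_one, smul_eq_mul, smul_eq_mul] at hleibniz
  have hmk : mk (-p) = -mk p := rfl
  rw [IsLogDeriv] at *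
  rw [hmk]
  linear_combination (X * H) * hleibniz - H * H * hG - (X * d⁄dX R H + H * mk p) * h

theorem isLogDeriv_one_sub_C_mul_X_pow (β : R) {k : ℕ} (hk : k ≠ 0) :
    IsLogDeriv (1 - C β * X ^ k) (fun n => if k ∣ n ∧ n ≠ 0 then -(k * β ^ (n / k)) else 0) := by
  have hk0 : 0 < k := Nat.pos_of_ne_zero hk
  ext n
  rw [coeff_X_mul_derivative, map_sub, coeff_one, coeff_C_mul, coeff_X_pow, sub_mul, one_mul,
    mul_assoc, mul_comm (X ^ k), map_sub, coeff_C_mul, coeff_mul_X_pow', coeff_mk, coeff_mk]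
  by_cases hdvd : k ∣ n
  · obtain ⟨e, rfl⟩ := hdvd
    rcases e with - | - | e
    · simp [hk]
    · simp [hk, Nat.div_self hk0]
    · have hsub : k * (e + 1 + 1) - k = k * (e + 1) := by rw [mul_add_one k (e + 1)]; omega
      have hle : k ≤ k * (e + 1 + 1) := Nat.le_mul_of_pos_right k (Nat.succ_pos _)
      simp only [hsub, hle, hk, Nat.mul_div_cancel_left _ hk0, dvd_mul_right, ne_eq, mul_eq_zero,
        Nat.add_eq_zero_iff, one_ne_zero, and_false, or_self, not_false_eq_true, and_self,
        if_true, if_false, mul_eq_left₀, Nat.add_eq_right]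
      ring
  · have hsub (hle : k ≤ n) : ¬k ∣ n - k := fun h =>
      hdvd ((Nat.dvd_sub_iff_left hle dvd_rfl).mp h)
    have hn0 : n ≠ 0 := by rintro rfl; exact hdvd (dvd_zero k)
    have hnk : n ≠ k := by rintro rfl; exact hdvd dvd_rfl
    by_cases hle : k ≤ n <;> simp [hle, hdvd, hn0, hnk, hsub]

theorem IsLogDeriv.right_unique [IsDomain R] {G : R⟦X⟧} {p r : ℕ → R} (hG : G ≠ 0)
    (hp : IsLogDeriv G p) (hr : IsLogDeriv G r) : p = r := by
  have hmk : mk p = mk r := mul_left_cancel₀ hG (hp.symm.trans hr)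
  funext n
  simpa only [coeff_mk] using congrArg (coeff n) hmk

theorem IsLogDeriv.left_unique [IsDomain R] [CharZero R] {G H : R⟦X⟧} {p : ℕ → R}
    (h0 : constantCoeff G = constantCoeff H) (hp0 : p 0 = 0)
    (hG : IsLogDeriv G p) (hH : IsLogDeriv H p) : G = H := by
  rw [isLogDeriv_iff_coeff] at hG hH
  ext n
  induction n using Nat.strong_induction_on with
  | _ n ih =>
    rcases Nat.eq_zero_or_pos n with rfl | hn
    · rwa [coeff_zero_eq_constantCoeff_apply, coeff_zero_eq_constantCoeff_apply]
    refine mul_left_cancel₀ (Nat.cast_ne_zero.mpr hn.ne') ?_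
    rw [hG, hH]
    refine Finset.sum_congr rfl fun ij hij => ?_
    rw [Finset.HasAntidiagonal.mem_antidiagonal] at hij
    by_cases hj : ij.2 = 0
    · rw [hj, hp0, mul_zero, mul_zero]
    · rw [ih ij.1 (by omega)]

theorem IsLogDeriv.of_approx {G : R⟦X⟧} {p : ℕ → R}
    (h : ∀ N : ℕ, ∃ (H : R⟦X⟧) (r : ℕ → R), IsLogDeriv H r ∧
      ∀ i ≤ N, coeff i G = coeff i H ∧ p i = r i) : IsLogDeriv G p := by
  rw [isLogDeriv_iff_coeff]
  intro n
  obtain ⟨H, r, hH, hi⟩ := h n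
  rw [(hi n le_rfl).1, isLogDeriv_iff_coeff.mp hH n]
  refine Finset.sum_congr rfl fun ij hij => ?_
  rw [Finset.HasAntidiagonal.mem_antidiagonal] at hij
  rw [(hi ij.1 (by omega)).1, (hi ij.2 (by omega)).2]

theorem IsLogDeriv.map {S : Type*} [CommRing S] (φ : R →+* S) {G : R⟦X⟧} {p : ℕ → R}
    (h : IsLogDeriv G p) : IsLogDeriv (PowerSeries.map φ G) (fun n => φ (p n)) := by
  rw [isLogDeriv_iff_coeff] at *
  intro n
  simpa only [map_sum, map_mul, map_natCast, coeff_map] using congrArg φ (h n)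

end LogDeriv

section Products

open PowerSeries
open scoped PowerSeries.WithPiTopology

variable {R : Type*} [CommRing R] {ι : Type*} {f : ι → R⟦X⟧}

theorem X_pow_dvd_prod_sub_one (s : Finset ι) {N : ℕ} (h : ∀ i ∈ s, X ^ N ∣ f i - 1) :
    X ^ N ∣ ∏ i ∈ s, f i - 1 := by
  classical
  induction s using Finset.induction_on with
  | empty => simp
  | insert a s ha ih =>
    have hs := ih fun i hi => h i (Finset.mem_insert_of_mem hi)
    rw [Finset.prod_insert ha,
      show f a * ∏ i ∈ s, f i - 1 = f a * (∏ i ∈ s, f i - 1) + (f a - 1) by ring]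
    exact dvd_add (hs.mul_left _) (h a (s.mem_insert_self a))

variable {w : ι → ℕ} (hf : ∀ i, X ^ w i ∣ f i - 1)
include hf

theorem coeff_prod_eq_of_subset {s t : Finset ι} (hst : s ⊆ t) {n : ℕ}
    (hs : ∀ i, w i ≤ n → i ∈ s) : coeff n (∏ i ∈ t, f i) = coeff n (∏ i ∈ s, f i) := by
  classical
  have hdvd : X ^ (n + 1) ∣ ∏ i ∈ t \ s, f i - 1 := by
    refine X_pow_dvd_prod_sub_one _ fun i hi => (pow_dvd_pow _ ?_).trans (hf i)
    exact Nat.succ_le_of_lt (not_le.mp fun hle => (Finset.mem_sdiff.mp hi).2 (hs i hle))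
  have hcoeff := X_pow_dvd_iff.mp (hdvd.mul_right (∏ i ∈ s, f i)) n n.lt_succ_self
  rwa [sub_mul, one_mul, map_sub, sub_eq_zero, Finset.prod_sdiff hst] at hcoeff

variable [TopologicalSpace R]

theorem hasProd_of_X_pow_dvd_sub_one (hw : ∀ N, {i | w i ≤ N}.Finite) :
    HasProd f (mk fun n => coeff n (∏ i ∈ (hw n).toFinset, f i)) := by
  rw [HasProd, WithPiTopology.tendsto_iff_coeff_tendsto]
  intro n
  refine tendsto_const_nhds.congr' ?_
  filter_upwards [Filter.eventually_ge_atTop (hw n).toFinset] with t ht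
  rw [coeff_mk, coeff_prod_eq_of_subset hf ht fun i hi => (hw n).mem_toFinset.mpr hi]

theorem coeff_tprod_eq_coeff_prod [T2Space R] (hw : ∀ N, {i | w i ≤ N}.Finite) {n N : ℕ}
    (hn : n ≤ N) : coeff n (∏' i, f i) = coeff n (∏ i ∈ (hw N).toFinset, f i) := by
  rw [(hasProd_of_X_pow_dvd_sub_one hf hw).tprod_eq, coeff_mk]
  refine (coeff_prod_eq_of_subset hf ?_ fun i hi => (hw n).mem_toFinset.mpr hi).symm
  exact Set.Finite.toFinset_mono fun i (hi : w i ≤ n) => hi.trans hn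

end Products

open Polynomial

/-! ### Multiplicative functions on monic polynomials -/

section MonicSums

variable {k : Type*} [Field k]

section Multiplicative

variable {R : Type*} [CommRing R]

/-- A completely multiplicative function on the monic polynomials over a field; its values at the
other polynomials are irrelevant. -/
structure IsMonicMultiplicative (Φ : k[X] → R) : Prop where
  map_one : Φ 1 = 1
  map_mul : ∀ {g h : k[X]}, g.Monic → h.Monic → Φ (g * h) = Φ g * Φ h

theorem IsMonicMultiplicative.map_pow {Φ : k[X] → R} (hΦ : IsMonicMultiplicative Φ) {P : k[X]}
    (hP : P.Monic) (e : ℕ) : Φ (P ^ e) = Φ P ^ e := by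
  induction e with
  | zero => rw [pow_zero, pow_zero, hΦ.map_one]
  | succ e ih => rw [pow_succ, hΦ.map_mul (hP.pow e) hP, ih, pow_succ]

end Multiplicative

variable [Finite k]

theorem finite_setOf_natDegree_le (n : ℕ) : {h : k[X] | h.natDegree ≤ n}.Finite := by
  refine Set.Finite.of_injOn (f := fun h (i : Fin (n + 1)) => h.coeff i) (t := Set.univ)
    (fun _ _ => Set.mem_univ _) ?_ Set.finite_univ
  intro g (hg : g.natDegree ≤ n) h (hh : h.natDegree ≤ n) hgh
  ext i
  by_cases hi : i < n + 1
  · exact congrFun hgh ⟨i, hi⟩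
  · rw [coeff_eq_zero_of_natDegree_lt (by omega), coeff_eq_zero_of_natDegree_lt (by omega)]

variable (k) in
open Classical in
/-- The finite set of monic polynomials of degree `n`. -/
def monics (n : ℕ) : Finset k[X] :=
  (finite_setOf_natDegree_le n).toFinset.filter fun h => h.Monic ∧ h.natDegree = n

theorem mem_monics {n : ℕ} {h : k[X]} : h ∈ monics k n ↔ h.Monic ∧ h.natDegree = n := by
  simp only [monics, Finset.mem_filter, Set.Finite.mem_toFinset, Set.mem_ofPred_eq]
  exact ⟨fun hh => hh.2, fun hh => ⟨hh.2.le, hh⟩⟩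

variable (k) in
open Classical in
/-- The finite set of monic irreducible polynomials of degree at most `n`. -/
def irreds (n : ℕ) : Finset k[X] :=
  (finite_setOf_natDegree_le n).toFinset.filter fun h => h.Monic ∧ Irreducible h

theorem mem_irreds {n : ℕ} {h : k[X]} :
    h ∈ irreds k n ↔ h.Monic ∧ Irreducible h ∧ h.natDegree ≤ n := by
  simp only [irreds, Finset.mem_filter, Set.Finite.mem_toFinset, Set.mem_ofPred_eq]
  tauto

theorem card_filter_dvd_and_div_le {d c n : ℕ} (hd : 0 < d) (hn : d * c ≤ n) :
    {i ∈ Finset.Icc 1 n | d ∣ i ∧ i / d ≤ c}.card = c := by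
  have himage : {i ∈ Finset.Icc 1 n | d ∣ i ∧ i / d ≤ c} = (Finset.Icc 1 c).image (d * ·) := by
    ext i
    simp only [Finset.mem_filter, Finset.mem_Icc, Finset.mem_image]
    constructor
    · rintro ⟨⟨hi, -⟩, ⟨e, rfl⟩, he⟩
      rw [Nat.mul_div_cancel_left _ hd] at he
      exact ⟨e, ⟨Nat.pos_of_mul_pos_left hi, he⟩, rfl⟩
    · rintro ⟨e, ⟨he, hec⟩, rfl⟩
      rw [Nat.mul_div_cancel_left _ hd]
      exact ⟨⟨Nat.mul_pos hd he, (Nat.mul_le_mul_left d hec).trans hn⟩, dvd_mul_right d e, hec⟩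
  rw [himage, Finset.card_image_of_injective _ fun _ _ => Nat.eq_of_mul_eq_mul_left hd,
    Nat.card_Icc, Nat.add_sub_cancel]

section

open UniqueFactorizationMonoid
open scoped Classical in
theorem sum_natDegree_mul_count_normalizedFactors {h : k[X]} (hm : h.Monic) :
    ∑ P ∈ irreds k h.natDegree, (normalizedFactors h).count P * P.natDegree = h.natDegree := by
  have hmem {P : k[X]} : P ∈ normalizedFactors h ↔ Irreducible P ∧ P.Monic ∧ P ∣ h :=
    Polynomial.mem_normalizedFactors_iff hm.ne_zero
  have hsum : h.natDegree = ((normalizedFactors h).map natDegree).sum := by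
    rw [← natDegree_multiset_prod_of_monic _ fun P hP => (hmem.mp hP).2.1,
      prod_normalizedFactors_eq hm.ne_zero, hm.normalize_eq_self]
  have hsub : (normalizedFactors h).toFinset ⊆ irreds k h.natDegree := fun P hP => by
    obtain ⟨hi, hPm, hdvd⟩ := hmem.mp (Multiset.mem_toFinset.mp hP)
    exact mem_irreds.mpr ⟨hPm, hi, natDegree_le_of_dvd hdvd hm.ne_zero⟩
  rw [Finset.sum_multiset_map_count, Finset.sum_subset hsub fun P _ hP => by
    rw [Multiset.count_eq_zero_of_notMem (by rwa [Multiset.mem_toFinset] at hP), zero_smul]] at hsum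
  exact hsum.symm

open scoped Classical in
theorem natDegree_eq_sum_pow_dvd {h : k[X]} (hm : h.Monic) :
    h.natDegree = ∑ P ∈ irreds k h.natDegree, ∑ i ∈ Finset.Icc 1 h.natDegree,
      if P.natDegree ∣ i ∧ P ^ (i / P.natDegree) ∣ h then P.natDegree else 0 := by
  conv_lhs => rw [← sum_natDegree_mul_count_normalizedFactors hm]
  refine Finset.sum_congr rfl fun P hP => ?_
  obtain ⟨hPm, hPi, -⟩ := mem_irreds.mp hP
  have hdvd (e : ℕ) : P ^ e ∣ h ↔ e ≤ (normalizedFactors h).count P := by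
    rw [pow_dvd_iff_le_emultiplicity, emultiplicity_eq_count_normalizedFactors hPi hm.ne_zero,
      hPm.normalize_eq_self, Nat.cast_le]
  have hle : P.natDegree * (normalizedFactors h).count P ≤ h.natDegree := by
    have hpow := natDegree_le_of_dvd ((hdvd _).mpr le_rfl) hm.ne_zero
    rwa [natDegree_pow, mul_comm] at hpow
  simp only [hdvd]
  rw [← Finset.sum_filter, Finset.sum_const, card_filter_dvd_and_div_le hPi.natDegree_pos hle,
    smul_eq_mul]

end

variable {R : Type*} [CommRing R]

/-- The sum of `Φ` over the monic polynomials of degree `n`. -/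
def monicSum (Φ : k[X] → R) (n : ℕ) : R := ∑ h ∈ monics k n, Φ h

/-- The sum `∑ deg P · Φ(P) ^ (n / deg P)` over the monic irreducible polynomials `P` of degree
dividing `n`. -/
def primePowerSum (Φ : k[X] → R) (n : ℕ) : R :=
  ∑ P ∈ irreds k n with P.natDegree ∣ n, (P.natDegree : R) * Φ P ^ (n / P.natDegree)

theorem primePowerSum_zero (Φ : k[X] → R) : primePowerSum Φ 0 = 0 := by
  refine Finset.sum_eq_zero fun P hP => ?_
  obtain ⟨-, hirr, hdeg⟩ := mem_irreds.mp (Finset.mem_filter.mp hP).1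
  exact absurd hirr.natDegree_pos hdeg.not_gt

theorem primePowerSum_eq_sum_irreds (Φ : k[X] → R) {i n : ℕ} (hi : i ≠ 0) (hin : i ≤ n) :
    primePowerSum Φ i = ∑ P ∈ irreds k n,
      if P.natDegree ∣ i then (P.natDegree : R) * Φ P ^ (i / P.natDegree) else 0 := by
  rw [primePowerSum, ← Finset.sum_filter]
  refine Finset.sum_congr ?_ fun _ _ => rfl
  ext P
  simp only [Finset.mem_filter, mem_irreds]
  constructor
  · rintro ⟨⟨hm, hirr, hdeg⟩, hdvd⟩
    exact ⟨⟨hm, hirr, hdeg.trans hin⟩, hdvd⟩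
  · rintro ⟨⟨hm, hirr, -⟩, hdvd⟩
    exact ⟨⟨hm, hirr, Nat.le_of_dvd (Nat.pos_of_ne_zero hi) hdvd⟩, hdvd⟩

theorem sum_monics_filter_dvd {Φ : k[X] → R} (hΦ : IsMonicMultiplicative Φ) {Q : k[X]}
    (hQ : Q.Monic) {n : ℕ} [DecidablePred fun h : k[X] => Q ∣ h] (hn : Q.natDegree ≤ n) :
    ∑ h ∈ monics k n with Q ∣ h, Φ h = Φ Q * monicSum Φ (n - Q.natDegree) := by
  rw [monicSum, Finset.mul_sum]
  symm
  refine Finset.sum_bij (fun h _ => Q * h) ?_ ?_ ?_ ?_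
  · intro h hh
    obtain ⟨hm, hdeg⟩ := mem_monics.mp hh
    rw [Finset.mem_filter, mem_monics, hQ.natDegree_mul hm, hdeg]
    exact ⟨⟨hQ.mul hm, by omega⟩, dvd_mul_right _ _⟩
  · intro g _ h _ hgh
    exact mul_left_cancel₀ hQ.ne_zero hgh
  · rintro h hh
    rw [Finset.mem_filter, mem_monics] at hh
    obtain ⟨⟨hm, hdeg⟩, g, rfl⟩ := hh
    have hg : g.Monic := hQ.of_mul_monic_left hm
    rw [hQ.natDegree_mul hg] at hdeg
    exact ⟨g, mem_monics.mpr ⟨hg, by omega⟩, rfl⟩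
  · intro h hh
    exact (hΦ.map_mul hQ (mem_monics.mp hh).1).symm

theorem natCast_mul_monicSum {Φ : k[X] → R} (hΦ : IsMonicMultiplicative Φ) (n : ℕ) :
    (n : R) * monicSum Φ n = ∑ i ∈ Finset.Icc 1 n, monicSum Φ (n - i) * primePowerSum Φ i := by
  classical
  have hlog : ∀ h ∈ monics k n, (n : R) * Φ h = ∑ P ∈ irreds k n, ∑ i ∈ Finset.Icc 1 n,
      if P.natDegree ∣ i ∧ P ^ (i / P.natDegree) ∣ h then (P.natDegree : R) * Φ h else 0 := by
    intro h hh
    obtain ⟨hm, rfl⟩ := mem_monics.mp hh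
    conv_lhs => rw [natDegree_eq_sum_pow_dvd hm]
    push_cast
    simp only [Finset.sum_mul, ite_mul, zero_mul]
  have hmultiples : ∀ P ∈ irreds k n, ∀ i ∈ Finset.Icc 1 n,
      (∑ h ∈ monics k n, if P.natDegree ∣ i ∧ P ^ (i / P.natDegree) ∣ h
        then (P.natDegree : R) * Φ h else 0) =
      monicSum Φ (n - i) *
        if P.natDegree ∣ i then (P.natDegree : R) * Φ P ^ (i / P.natDegree) else 0 := by
    intro P hP i hi
    obtain ⟨hPm, -, -⟩ := mem_irreds.mp hP
    by_cases hd : P.natDegree ∣ i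
    · have hdeg : (P ^ (i / P.natDegree)).natDegree = i := by
        rw [natDegree_pow, Nat.div_mul_cancel hd]
      simp only [hd, true_and, if_true]
      rw [← Finset.sum_filter, ← Finset.mul_sum, sum_monics_filter_dvd hΦ (hPm.pow _)
        (hdeg.trans_le (Finset.mem_Icc.mp hi).2), hdeg, hΦ.map_pow hPm]
      ring
    · simp [hd]
  rw [monicSum, Finset.mul_sum, Finset.sum_congr rfl hlog, Finset.sum_comm,
    Finset.sum_congr rfl fun P _ => Finset.sum_comm,
    Finset.sum_congr rfl fun P hP => Finset.sum_congr rfl (hmultiples P hP), Finset.sum_comm]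
  refine Finset.sum_congr rfl fun i hi => ?_
  obtain ⟨hi0, hin⟩ := Finset.mem_Icc.mp hi
  rw [← Finset.mul_sum, primePowerSum_eq_sum_irreds Φ (by omega) hin]

theorem isLogDeriv_monicSum {Φ : k[X] → R} (hΦ : IsMonicMultiplicative Φ) :
    IsLogDeriv (PowerSeries.mk (monicSum Φ)) (primePowerSum Φ) := by
  rw [isLogDeriv_iff_coeff]
  intro n
  rw [PowerSeries.coeff_mk, natCast_mul_monicSum hΦ, Finset.Nat.antidiagonal_eq_map',
    Finset.sum_map]
  refine Finset.sum_subset_zero_on_sdiff (fun i hi => ?_) (fun i hi => ?_) fun i _ => ?_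
  · rw [Finset.mem_range]
    exact Nat.lt_succ_of_le (Finset.mem_Icc.mp hi).2
  · have hi0 : i = 0 := by
      simp only [Finset.mem_sdiff, Finset.mem_range, Finset.mem_Icc] at hi
      omega
    subst hi0
    exact mul_eq_zero_of_right _ (primePowerSum_zero Φ)
  · rw [PowerSeries.coeff_mk]
    rfl

theorem monicSum_zero {Φ : k[X] → R} (hΦ : IsMonicMultiplicative Φ) : monicSum Φ 0 = 1 := by
  have hmonics : monics k 0 = {1} := by
    ext h
    rw [mem_monics, Finset.mem_singleton]
    refine ⟨fun hh => hh.1.natDegree_eq_zero.mp hh.2, ?_⟩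
    rintro rfl
    exact ⟨monic_one, natDegree_one⟩
  rw [monicSum, hmonics, Finset.sum_singleton, hΦ.map_one]

theorem primePowerSum_eq_of_isLogDeriv [IsDomain R] {Φ : k[X] → R} (hΦ : IsMonicMultiplicative Φ)
    {p : ℕ → R} (h : IsLogDeriv (PowerSeries.mk (monicSum Φ)) p) : primePowerSum Φ = p := by
  refine (isLogDeriv_monicSum hΦ).right_unique (fun h0 => ?_) h
  simpa [monicSum_zero hΦ] using congrArg PowerSeries.constantCoeff h0

theorem add_mem_monics {n : ℕ} {g r : k[X]} (hr : r.degree < n) (hg : g ∈ monics k n) :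
    g + r ∈ monics k n := by
  obtain ⟨hm, hdeg⟩ := mem_monics.mp hg
  have hlt : r.degree < g.degree := by rwa [degree_eq_natDegree hm.ne_zero, hdeg]
  exact mem_monics.mpr ⟨hm.add_of_left hlt, by rw [natDegree_add_eq_left_of_degree_lt hlt, hdeg]⟩

theorem sum_monics_add {n : ℕ} {r : k[X]} (hr : r.degree < n) (Φ : k[X] → R) :
    ∑ h ∈ monics k n, Φ (h + r) = monicSum Φ n := by
  refine Finset.sum_bij' (fun h _ => h + r) (fun h _ => h - r) (fun _ => add_mem_monics hr)
    (fun h hh => ?_) (fun h _ => add_sub_cancel_right h r) (fun h _ => sub_add_cancel h r)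
    fun h _ => rfl
  rw [sub_eq_add_neg]
  exact add_mem_monics (by rwa [degree_neg]) hh

theorem add_C_mul_mem_monics {n : ℕ} {g r : k[X]} (hr : r.degree < n) (hg : g ∈ monics k n)
    (c : k) : g + C c * r ∈ monics k n := by
  refine add_mem_monics ?_ hg
  rw [← smul_eq_C_mul]
  exact (degree_smul_le _ _).trans_lt hr

theorem monicSum_eq_zero [Fintype k] [IsDomain R] [CharZero R] {n : ℕ} {r : k[X]}
    (hr : r.degree < n) {Φ : k[X] → R} (h : ∀ g ∈ monics k n, ∑ c : k, Φ (g + C c * r) = 0) :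
    monicSum Φ n = 0 := by
  have hshift (c : k) : ∑ g ∈ monics k n, Φ (g + C c * r) = monicSum Φ n :=
    sum_monics_add (by rw [← smul_eq_C_mul]; exact (degree_smul_le _ _).trans_lt hr) Φ
  have hsum : (Fintype.card k : R) * monicSum Φ n = 0 :=
    calc (Fintype.card k : R) * monicSum Φ n = ∑ c : k, ∑ g ∈ monics k n, Φ (g + C c * r) := by
          rw [Finset.sum_congr rfl fun c _ => hshift c, Finset.sum_const, nsmul_eq_mul,
            Finset.card_univ]
      _ = 0 := by rw [Finset.sum_comm, Finset.sum_eq_zero h]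
  exact (mul_eq_zero.mp hsum).resolve_left (Nat.cast_ne_zero.mpr Fintype.card_ne_zero)

theorem monicSum_one [Fintype k] (Φ : k[X] → R) : monicSum Φ 1 = ∑ c : k, Φ (X - C c) := by
  symm
  refine Finset.sum_bij (fun c _ => X - C c)
    (fun c _ => mem_monics.mpr ⟨monic_X_sub_C c, natDegree_X_sub_C c⟩)
    (fun a _ b _ hab => C_injective (sub_right_injective hab)) ?_ fun _ _ => rfl
  intro h hh
  obtain ⟨hm, hdeg⟩ := mem_monics.mp hh
  refine ⟨-h.coeff 0, Finset.mem_univ _, ?_⟩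
  rw [C_neg, sub_neg_eq_add]
  exact (hm.eq_X_add_C hdeg).symm

theorem monicSum_two [Fintype k] (Φ : k[X] → R) :
    monicSum Φ 2 = ∑ u : k, ∑ w : k, Φ (X ^ 2 + C u * X + C w) := by
  rw [← Finset.sum_product']
  symm
  refine Finset.sum_bij (fun c _ => X ^ 2 + C c.1 * X + C c.2) ?_ ?_ ?_ fun _ _ => rfl
  · exact fun c _ => mem_monics.mpr ⟨by monicity!, by compute_degree!⟩
  · intro a _ b _ hab
    have hcoeff (i : ℕ) := congrArg (fun f => f.coeff i) hab
    refine Prod.ext ?_ ?_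
    · simpa [coeff_X, coeff_C] using hcoeff 1
    · simpa [coeff_X, coeff_C] using hcoeff 0
  · intro h hh
    obtain ⟨hm, hdeg⟩ := mem_monics.mp hh
    refine ⟨(h.coeff 1, h.coeff 0), Finset.mem_univ _, ?_⟩
    conv_rhs => rw [hm.as_sum, hdeg, Finset.sum_range_succ, Finset.sum_range_one]
    rw [pow_zero, mul_one, pow_one]
    ring

end MonicSums

/-! ### Characteristic polynomials and norms -/

section Charpoly

theorem charpoly_blockDiagonal {R ι n : Type*} [CommRing R] [Fintype ι] [DecidableEq ι]
    [Fintype n] [DecidableEq n] (M : ι → Matrix n n R) :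
    (Matrix.blockDiagonal M).charpoly = ∏ i, (M i).charpoly := by
  have hcharmatrix : (Matrix.blockDiagonal M).charmatrix =
      Matrix.blockDiagonal fun i => (M i).charmatrix := by
    ext ⟨a, i⟩ ⟨b, j⟩
    simp only [Matrix.charmatrix_apply, Matrix.blockDiagonal_apply, Matrix.diagonal_apply,
      Prod.mk.injEq]
    by_cases hij : i = j <;> simp [hij]
  rw [Matrix.charpoly, hcharmatrix, Matrix.det_blockDiagonal]
  rfl

theorem det_aeval_eq_resultant_charpoly {k n : Type*} [Field k] [Fintype n] [DecidableEq n]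
    (M : Matrix n n k) (f : k[X]) :
    (aeval M f).det = resultant M.charpoly f (Fintype.card n) f.natDegree := by
  wlog hf : f.Splits generalizing k
  · let φ := algebraMap k f.SplittingField
    apply φ.injective
    rw [← resultant_map_map, ← Matrix.charpoly_map, ← natDegree_map φ,
      ← this (M.map φ) (f.map φ) (SplittingField.splits f), RingHom.map_det, aeval_def, aeval_def,
      hom_eval₂, eval₂_map]
    congr 2
    ext c : 1
    exact (Matrix.map_algebraMap c φ (map_zero φ) rfl)
  let D : k[X] →* k := Matrix.detMonoidHom.comp (aeval (R := k) M).toMonoidHom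
  have hlinear (s : k) : D (X - C s) = (-1) ^ Fintype.card n * M.charpoly.eval s := by
    change (aeval M (X - C s)).det = _
    rw [map_sub, aeval_X, aeval_C, Matrix.eval_charpoly, ← Matrix.det_neg, neg_sub,
      Matrix.scalar_apply, Matrix.algebraMap_eq_diagonal]
    rfl
  have hconst (c : k) : D (C c) = c ^ Fintype.card n := by
    change (aeval M (C c)).det = _
    simp [Matrix.algebraMap_eq_diagonal]
  change D f = _
  rw [resultant_comm, resultant_eq_prod_eval f M.charpoly _ (Matrix.charpoly_natDegree_eq_dim M).le
    hf]
  conv_lhs => rw [hf.eq_prod_roots]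
  rw [map_mul, hconst, map_multiset_prod, Multiset.map_map]
  simp only [Function.comp_def, hlinear, Multiset.prod_map_mul, Multiset.map_const',
    Multiset.prod_replicate, ← hf.natDegree_eq_card_roots]
  ring

theorem eval_charpoly_lmul {R S : Type*} [CommRing R] [CommRing S] [Algebra R S] [Module.Free R S]
    [Module.Finite R S] (x : S) (c : R) :
    (Algebra.lmul R S x).charpoly.eval c = Algebra.norm R (algebraMap R S c - x) := by
  rw [LinearMap.eval_charpoly, Algebra.norm_apply, map_sub (Algebra.lmul R S), AlgHom.commutes]

theorem norm_aeval_eq_resultant {k K : Type*} [Field k] [CommRing K] [Algebra k K]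
    [FiniteDimensional k K] (x : K) (f : k[X]) : Algebra.norm k (aeval x f) =
      resultant (Algebra.lmul k K x).charpoly f (Module.finrank k K) f.natDegree := by
  let b := Module.finBasis k K
  rw [Algebra.norm_eq_matrix_det b, ← aeval_algHom_apply, det_aeval_eq_resultant_charpoly,
    Fintype.card_fin, Algebra.leftMulMatrix_apply, LinearMap.charpoly_toMatrix]

variable {k K : Type*} [Field k] [Field K] [Algebra k K]

theorem charpoly_lmul_eq_minpoly_pow [FiniteDimensional k K] (x : K) :
    (Algebra.lmul k K x).charpoly =
      minpoly k x ^ (Module.finrank k K / (minpoly k x).natDegree) := by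
  classical
  have hx : IsIntegral k x := Algebra.IsIntegral.isIntegral x
  let b := IntermediateField.adjoin.powerBasis hx
  let c := Module.finBasis (IntermediateField.adjoin k {x}) K
  have hblock := Algebra.smulTower_leftMulMatrix_algebraMap b.basis c b.gen
  have hfinrank := Module.finrank_mul_finrank k (IntermediateField.adjoin k {x}) K
  rw [IntermediateField.adjoin.finrank hx] at hfinrank
  rw [← hfinrank, Nat.mul_div_cancel_left _ (minpoly.natDegree_pos hx),
    ← LinearMap.charpoly_toMatrix (Algebra.lmul k K x) (b.basis.smulTower c)]
  change (Algebra.leftMulMatrix (b.basis.smulTower c)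
    (algebraMap (IntermediateField.adjoin k {x}) K b.gen)).charpoly = _
  rw [hblock, charpoly_blockDiagonal, Finset.prod_const, Finset.card_univ, Fintype.card_fin,
    charpoly_leftMulMatrix, IntermediateField.adjoin.powerBasis_gen,
    IntermediateField.minpoly_gen]

theorem splits_map_of_natDegree_dvd_finrank [Finite K] {P : k[X]} (hP : Irreducible P)
    (hd : P.natDegree ∣ Module.finrank k K) : (P.map (algebraMap k K)).Splits := by
  have : Finite k := .of_injective _ (algebraMap k K).injective
  have hdvd := Polynomial.map_dvd (algebraMap k K)
    (hP.natDegree_dvd_iff_dvd_X_pow_card_pow_sub_X.mp hd)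
  rw [← Module.natCard_eq_pow_finrank (K := k) (V := K), Polynomial.map_sub, Polynomial.map_pow,
    map_X] at hdvd
  exact (splits_X_pow_nat_card_sub_X (K := K)).of_dvd
    (FiniteField.X_pow_card_sub_X_ne_zero K Finite.one_lt_card) hdvd

open scoped Classical in
theorem card_filter_minpoly_eq [Fintype K] {P : k[X]} (hPm : P.Monic) (hP : Irreducible P)
    (hd : P.natDegree ∣ Module.finrank k K) :
    {x : K | minpoly k x = P}.toFinset.card = P.natDegree := by
  have : Finite k := .of_injective _ (algebraMap k K).injective
  have hroots : {x : K | minpoly k x = P} = P.rootSet K := by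
    ext x
    rw [mem_rootSet]
    constructor
    · rintro rfl
      exact ⟨hP.ne_zero, minpoly.aeval _ _⟩
    · rintro ⟨-, hx⟩
      exact (minpoly.eq_of_irreducible_of_monic hP hx hPm).symm
  simp only [hroots, Set.toFinset_card]
  exact card_rootSet_eq_natDegree (PerfectField.separable_of_irreducible hP)
    (splits_map_of_natDegree_dvd_finrank hP hd)

variable [Finite k] {R : Type*} [CommRing R]

theorem sum_minpoly [Fintype K] (G : k[X] → R) :
    ∑ x : K, G (minpoly k x) = ∑ P ∈ irreds k (Module.finrank k K) with
      P.natDegree ∣ Module.finrank k K, (P.natDegree : R) * G P := by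
  classical
  have hmaps : ∀ x ∈ (Finset.univ : Finset K), minpoly k x ∈
      {P ∈ irreds k (Module.finrank k K) | P.natDegree ∣ Module.finrank k K} := by
    intro x _
    have hx : IsIntegral k x := Algebra.IsIntegral.isIntegral x
    rw [Finset.mem_filter, mem_irreds]
    exact ⟨⟨minpoly.monic hx, minpoly.irreducible hx,
      Nat.le_of_dvd Module.finrank_pos (minpoly.degree_dvd hx)⟩, minpoly.degree_dvd hx⟩
  rw [← Finset.sum_fiberwise_of_maps_to hmaps]
  refine Finset.sum_congr rfl fun P hP => ?_
  obtain ⟨hP, hd⟩ := Finset.mem_filter.mp hP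
  obtain ⟨hPm, hPi, -⟩ := mem_irreds.mp hP
  rw [Finset.sum_congr rfl fun x hx => by rw [(Finset.mem_filter.mp hx).2], Finset.sum_const,
    nsmul_eq_mul, ← card_filter_minpoly_eq (K := K) hPm hPi hd, Set.toFinset_ofPred]

theorem primePowerSum_finrank [Fintype K] {Φ : k[X] → R} (hΦ : IsMonicMultiplicative Φ) :
    primePowerSum Φ (Module.finrank k K) = ∑ x : K, Φ (Algebra.lmul k K x).charpoly := by
  rw [primePowerSum, ← sum_minpoly fun P => Φ P ^ (Module.finrank k K / P.natDegree)]
  refine Finset.sum_congr rfl fun x _ => ?_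
  rw [charpoly_lmul_eq_minpoly_pow, hΦ.map_pow (minpoly.monic (Algebra.IsIntegral.isIntegral x))]

end Charpoly

/-! ### The Hasse–Davenport relation for Jacobi sums -/

section HasseDavenport

variable {k : Type*} [Field k] {R : Type*} [CommRing R]

/-- The completely multiplicative function `∏ (X - r) ↦ ∏ χ(r) ψ(1 - r)` on monic polynomials. -/
def jacobiWeight (χ ψ : MulChar k R) (h : k[X]) : R :=
  χ ((-1) ^ h.natDegree * h.eval 0) * ψ (h.eval 1)

theorem isMonicMultiplicative_jacobiWeight (χ ψ : MulChar k R) :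
    IsMonicMultiplicative (jacobiWeight χ ψ) where
  map_one := by simp [jacobiWeight]
  map_mul hg hh := by
    simp only [jacobiWeight, hg.natDegree_mul hh, eval_mul, pow_add, map_mul]
    ring

theorem jacobiWeight_charpoly_lmul (χ ψ : MulChar k R) {K : Type*} [CommRing K] [Algebra k K]
    [FiniteDimensional k K] (x : K) : jacobiWeight χ ψ (Algebra.lmul k K x).charpoly =
      χ (Algebra.norm k x) * ψ (Algebra.norm k (1 - x)) := by
  have hneg : (-1) ^ Module.finrank k K * Algebra.norm k (-x) = Algebra.norm k x := by
    have hx : -x = algebraMap k K (-1) * x := by rw [map_neg, map_one, neg_one_mul]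
    rw [hx, map_mul, Algebra.norm_algebraMap, ← mul_assoc, ← mul_pow, neg_one_mul, neg_neg,
      one_pow, one_mul]
  rw [jacobiWeight, LinearMap.charpoly_natDegree, eval_charpoly_lmul, eval_charpoly_lmul, map_zero,
    map_one, zero_sub, hneg]

theorem monicSum_jacobiWeight_one [Fintype k] (χ ψ : MulChar k R) :
    monicSum (jacobiWeight χ ψ) 1 = jacobiSum χ ψ := by
  rw [monicSum_one, jacobiSum]
  refine Finset.sum_congr rfl fun c _ => ?_
  simp [jacobiWeight]

theorem sum_mulChar_affine [Fintype k] [IsDomain R] {χ : MulChar k R} (hχ : χ ≠ 1) (a : k) {b : k}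
    (hb : b ≠ 0) : ∑ c : k, χ (a + c * b) = 0 := by
  rw [← MulChar.sum_eq_zero_of_ne_one hχ]
  exact Fintype.sum_equiv ((Equiv.mulRight₀ b hb).trans (Equiv.addLeft a)) _ _ fun c => rfl

variable [IsDomain R] [CharZero R] {χ : MulChar k R} (hχ : χ ≠ 1) (ψ : MulChar k R)
include hχ

theorem monicSum_jacobiWeight_eq_zero [Finite k] {n : ℕ} (hn : 2 ≤ n) :
    monicSum (jacobiWeight χ ψ) n = 0 := by
  have := Fintype.ofFinite k
  have hdeg : (1 - X : k[X]).degree < n := by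
    refine (degree_sub_le _ _).trans_lt ?_
    rw [degree_one, degree_X, max_eq_right zero_le_one]
    exact_mod_cast hn
  refine monicSum_eq_zero hdeg fun g hg => ?_
  -- Adding `c (1 - X)` moves the value at `0` by `c` and fixes the value at `1`.
  have hterm (c : k) : jacobiWeight χ ψ (g + C c * (1 - X)) =
      χ ((-1) ^ n * g.eval 0 + c * (-1) ^ n) * ψ (g.eval 1) := by
    rw [jacobiWeight, (mem_monics.mp (add_C_mul_mem_monics hdeg hg c)).2]
    simp [mul_add, mul_comm c]
  rw [Finset.sum_congr rfl fun c _ => hterm c, ← Finset.sum_mul,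
    sum_mulChar_affine hχ _ (pow_ne_zero n (neg_ne_zero.mpr one_ne_zero)), zero_mul]

variable [Fintype k]

theorem mk_monicSum_jacobiWeight : PowerSeries.mk (monicSum (jacobiWeight χ ψ)) =
    1 - PowerSeries.C (-jacobiSum χ ψ) * PowerSeries.X ^ 1 := by
  ext i
  rw [PowerSeries.coeff_mk, map_sub, PowerSeries.coeff_one, PowerSeries.coeff_C_mul,
    PowerSeries.coeff_X_pow]
  rcases i with _ | _ | i
  · simp [monicSum_zero (isMonicMultiplicative_jacobiWeight χ ψ)]
  · simp [monicSum_jacobiWeight_one]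
  · simp [monicSum_jacobiWeight_eq_zero hχ ψ (Nat.le_add_left 2 i)]

theorem primePowerSum_jacobiWeight {n : ℕ} (hn : n ≠ 0) :
    primePowerSum (jacobiWeight χ ψ) n = -(-jacobiSum χ ψ) ^ n := by
  rw [primePowerSum_eq_of_isLogDeriv (isMonicMultiplicative_jacobiWeight χ ψ)
    (mk_monicSum_jacobiWeight hχ ψ ▸ isLogDeriv_one_sub_C_mul_X_pow _ one_ne_zero)]
  simp [hn]

theorem sum_norm_eq_neg_jacobiSum_pow {K : Type*} [Field K] [Fintype K] [Algebra k K] :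
    ∑ x : K, χ (Algebra.norm k x) * ψ (Algebra.norm k (1 - x)) =
      -(-jacobiSum χ ψ) ^ Module.finrank k K := by
  rw [← primePowerSum_jacobiWeight hχ ψ (Module.finrank_pos (R := k) (M := K)).ne',
    primePowerSum_finrank (K := K) (isMonicMultiplicative_jacobiWeight χ ψ)]
  exact Finset.sum_congr rfl fun x _ => (jacobiWeight_charpoly_lmul χ ψ x).symm

end HasseDavenport

/-! ### Cubic character sums -/

section QuadraticChar

variable {k : Type*} [Field k] [Fintype k] [DecidableEq k]

theorem sum_sq {R : Type*} [CommRing R] (hk : ringChar k ≠ 2) (f : k → R) :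
    ∑ v : k, f (v ^ 2) = ∑ z : k, (1 + (quadraticChar k z : R)) * f z := by
  rw [← Finset.sum_fiberwise Finset.univ (fun v : k => v ^ 2)]
  refine Finset.sum_congr rfl fun z _ => ?_
  have hcard : (({v : k | v ^ 2 = z} : Finset k).card : ℤ) = quadraticChar k z + 1 := by
    rw [← quadraticChar_card_sqrts hk z, Set.toFinset_ofPred]
  rw [Finset.sum_congr rfl (g := fun _ => f z) fun v hv => by rw [(Finset.mem_filter.mp hv).2],
    Finset.sum_const, nsmul_eq_mul, ← Int.cast_natCast, hcard, Int.cast_add, Int.cast_one, add_comm]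

theorem sum_quadraticChar_affine (hk : ringChar k ≠ 2) (a : k) {b : k} (hb : b ≠ 0) :
    ∑ c : k, quadraticChar k (a + c * b) = 0 :=
  sum_mulChar_affine (quadraticChar_ne_one hk) a hb

theorem quadraticChar_mul_self {a : k} (ha : a ≠ 0) :
    quadraticChar k a * quadraticChar k a = 1 := by
  rw [← sq, quadraticChar_sq_one ha]

theorem quadraticChar_sq_mul {a : k} (ha : a ≠ 0) (b : k) :
    quadraticChar k (a ^ 2 * b) = quadraticChar k b := by
  rw [map_mul, quadraticChar_sq_one' ha, one_mul]

theorem sum_quadraticChar_sq (hk : ringChar k ≠ 2) :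
    ∑ v : k, quadraticChar k (v ^ 2) = (Fintype.card k : ℤ) - 1 := by
  rw [sum_sq hk fun z => quadraticChar k z]
  simp only [Int.cast_id]
  have hterm (z : k) : (1 + quadraticChar k z) * quadraticChar k z =
      quadraticChar k z + (1 - if z = 0 then 1 else 0) := by
    split_ifs with hz
    · simp [hz]
    · linear_combination quadraticChar_mul_self hz
  rw [Finset.sum_congr rfl fun z _ => hterm z, Finset.sum_add_distrib, quadraticChar_sum_zero hk]
  simp

theorem sum_quadraticChar_sq_sub (hk : ringChar k ≠ 2) {D : k} (hD : D ≠ 0) :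
    ∑ v : k, quadraticChar k (v ^ 2 - D) = -1 := by
  have hlinear : ∑ z : k, quadraticChar k (z - D) = 0 := by
    rw [← sum_quadraticChar_affine hk (-D) one_ne_zero]
    exact Finset.sum_congr rfl fun z _ => by ring_nf
  have hjacobi : ∑ z : k, quadraticChar k z * quadraticChar k (z - D) =
      quadraticChar k (-1) * jacobiSum (quadraticChar k) (quadraticChar k)⁻¹ := by
    rw [(quadraticChar_isQuadratic k).inv, jacobiSum, Finset.mul_sum]
    refine (Fintype.sum_equiv (Equiv.mulLeft₀ D hD) _ _ fun y => ?_).symm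
    change _ = quadraticChar k (D * y) * quadraticChar k (D * y - D)
    rw [← map_mul, ← map_mul, ← map_mul, ← quadraticChar_sq_mul hD]
    ring_nf
  rw [sum_sq hk fun z => quadraticChar k (z - D)]
  simp only [add_mul, one_mul, Finset.sum_add_distrib, Int.cast_id]
  rw [hlinear, hjacobi, jacobiSum_nontrivial_inv (quadraticChar_ne_one hk), zero_add, mul_neg,
    quadraticChar_mul_self (neg_ne_zero.mpr one_ne_zero)]

theorem sum_quadraticChar_quadratic (hk : ringChar k ≠ 2) {A : k} (hA : A ≠ 0) (B C : k) :
    ∑ u : k, quadraticChar k (A * u ^ 2 + B * u + C) =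
      if B ^ 2 - 4 * A * C = 0 then ((Fintype.card k : ℤ) - 1) * quadraticChar k A
      else -quadraticChar k A := by
  have h2A : 2 * A ≠ 0 := mul_ne_zero (Ring.two_ne_zero hk) hA
  have hsquare : ∑ u : k, quadraticChar k (A * u ^ 2 + B * u + C) =
      quadraticChar k A * ∑ v : k, quadraticChar k (v ^ 2 - (B ^ 2 - 4 * A * C)) := by
    rw [Finset.mul_sum]
    refine Fintype.sum_equiv ((Equiv.mulLeft₀ _ h2A).trans (Equiv.addRight B)) _ _ fun u => ?_
    change _ = _ * quadraticChar k ((2 * A * u + B) ^ 2 - _)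
    rw [← map_mul, ← quadraticChar_sq_mul h2A]
    ring_nf
  rw [hsquare]
  split_ifs with hdisc
  · simp only [hdisc, sub_zero]
    rw [sum_quadraticChar_sq hk, mul_comm]
  · rw [sum_quadraticChar_sq_sub hk hdisc, mul_neg, mul_one]

variable {K : Type*} [Field K] [Fintype K] [DecidableEq K] [Algebra k K]

theorem quadraticChar_norm (hk : ringChar k ≠ 2) (y : K) :
    quadraticChar k (Algebra.norm k y) = quadraticChar K y := by
  have hK : ringChar K ≠ 2 := by rwa [← Algebra.ringChar_eq k K]
  -- Both sides are a power of `y` in `K`: `N(y) ^ ((|k| - 1) / 2) = y ^ ((|K| - 1) / 2)`.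
  have hexp : (∑ i ∈ Finset.range (Module.finrank k K), Fintype.card k ^ i) *
      (Fintype.card k / 2) = Fintype.card K / 2 := by
    have hoddk := FiniteField.odd_card_of_char_ne_two hk
    have hoddK := FiniteField.odd_card_of_char_ne_two hK
    have hcard : Fintype.card K = Fintype.card k ^ Module.finrank k K := Module.card_eq_pow_finrank
    have htwo : Fintype.card k = 2 * (Fintype.card k / 2) + 1 := by omega
    have hgeom := geom_sum_mul_add (2 * (Fintype.card k / 2)) (Module.finrank k K)
    rw [← htwo, ← hcard, mul_left_comm] at hgeom
    omega
  have hnorm := congrArg (algebraMap k K)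
    (quadraticChar_eq_pow_of_char_ne_two' hk (Algebra.norm k y))
  rw [map_pow, FiniteField.algebraMap_norm_eq_pow_sum, ← pow_mul, map_intCast,
    Nat.card_eq_fintype_card, hexp, ← quadraticChar_eq_pow_of_char_ne_two' hK y] at hnorm
  exact (quadraticChar_isQuadratic k).eq_of_eq_coe (quadraticChar_isQuadratic K) hK hnorm

theorem quadraticChar_algebraMap (hk : ringChar k ≠ 2) (a : k) :
    quadraticChar K (algebraMap k K a) = quadraticChar k a ^ Module.finrank k K := by
  rw [← quadraticChar_norm hk, Algebra.norm_algebraMap, map_pow]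

end QuadraticChar

section CubicSum

variable {k : Type*} [Field k]

theorem natDegree_X_mul_quadratic (a b : k) :
    (X * (X ^ 2 + C a * X + C b) : k[X]).natDegree = 3 := by
  have hdeg : (X ^ 2 + C a * X + C b : k[X]).natDegree = 2 := by compute_degree!
  rw [natDegree_X_mul (ne_zero_of_natDegree_gt (hdeg ▸ Nat.two_pos)), hdeg]

theorem resultant_quadratic_X_mul_quadratic (a b u w : k) :
    resultant (X ^ 2 + C u * X + C w) (X * (X ^ 2 + C a * X + C b)) 2 3 =
      w * (b * (u - a) ^ 2 + -(a * (w - b)) * (u - a) + (w - b) ^ 2) := by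
  have hcompanion : (!![0, -w; 1, -u] : Matrix (Fin 2) (Fin 2) k).charpoly =
      X ^ 2 + C u * X + C w := by
    simp [Matrix.charpoly_fin_two, Matrix.trace_fin_two, Matrix.det_fin_two]
  have hdet := det_aeval_eq_resultant_charpoly (!![0, -w; 1, -u] : Matrix (Fin 2) (Fin 2) k)
    (X * (X ^ 2 + C a * X + C b))
  rw [hcompanion, natDegree_X_mul_quadratic, Fintype.card_fin] at hdet
  have haeval : aeval (!![0, -w; 1, -u] : Matrix (Fin 2) (Fin 2) k)
      (X * (X ^ 2 + C a * X + C b)) =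
        !![0, -w; 1, -u] * !![b - w, w * (u - a); a - u, u ^ 2 - a * u + b - w] := by
    simp only [map_mul, map_add, map_pow, aeval_X, aeval_C, Algebra.algebraMap_eq_smul_one]
    congr 1
    ext i j
    fin_cases i <;> fin_cases j <;> simp [sq] <;> ring
  rw [← hdet, haeval, Matrix.det_mul, Matrix.det_fin_two_of, Matrix.det_fin_two_of]
  ring

theorem resultant_add_C_mul_X_mul_quadratic (a b c : k) {h : k[X]} {n : ℕ} (hn : 2 ≤ n)
    (hh : (h + C c * (X ^ 2 + C a * X + C b)).natDegree ≤ n) :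
    resultant (h + C c * (X ^ 2 + C a * X + C b)) (X * (X ^ 2 + C a * X + C b)) n 3 =
      (-1) ^ n * (h.eval 0 + c * b) * resultant h (X ^ 2 + C a * X + C b) n 2 := by
  have hdeg : (X ^ 2 + C a * X + C b : k[X]).natDegree = 2 := by compute_degree!
  have hfactor := resultant_mul_right (h + C c * (X ^ 2 + C a * X + C b)) X
    (X ^ 2 + C a * X + C b) n hh
  have hX := resultant_X_sub_C_right (h + C c * (X ^ 2 + C a * X + C b)) n 0 hh
  have hshift := resultant_add_mul_left h (X ^ 2 + C a * X + C b) (C c) n 2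
    (by rwa [natDegree_C, zero_add]) hdeg.le
  rw [natDegree_X, hdeg] at hfactor
  rw [C_0, sub_zero] at hX
  rw [hfactor, hX, mul_comm (C c), hshift]
  simp [mul_comm b]

open Classical in
/-- For `k` finite of odd characteristic, the trace of Frobenius of the cubic curve
`y ^ 2 = x (x ^ 2 + a x + b)` over `k`, as the opposite of a quadratic character sum. -/
def cubicTrace [Fintype k] (a b : k) : ℤ := -∑ x : k, quadraticChar k (x * (x ^ 2 + a * x + b))

open Classical in
/-- The completely multiplicative function `∏ (X - r) ↦ λ(∏ r (r ^ 2 + a r + b))` on monic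
polynomials, `λ` being the quadratic character. -/
def cubicWeight [Fintype k] (a b : k) (h : k[X]) : ℤ :=
  quadraticChar k (resultant h (X * (X ^ 2 + C a * X + C b)))

variable [Fintype k]

theorem isMonicMultiplicative_cubicWeight (a b : k) : IsMonicMultiplicative (cubicWeight a b) where
  map_one := by simp [cubicWeight]
  map_mul {g h} hg hh := by
    rw [cubicWeight, hg.natDegree_mul hh, resultant_mul_left _ _ _ _ le_rfl, map_mul]
    rfl

theorem primePowerSum_cubicWeight (hk : ringChar k ≠ 2) (a b : k) {K : Type*} [Field K] [Fintype K]
    [Algebra k K] : primePowerSum (cubicWeight a b) (Module.finrank k K) =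
      -cubicTrace (algebraMap k K a) (algebraMap k K b) := by
  classical
  rw [primePowerSum_finrank (K := K) (isMonicMultiplicative_cubicWeight a b), cubicTrace, neg_neg]
  refine Finset.sum_congr rfl fun x _ => ?_
  have haeval : x * (x ^ 2 + algebraMap k K a * x + algebraMap k K b) =
      aeval x (X * (X ^ 2 + C a * X + C b) : k[X]) := by simp
  rw [haeval, ← quadraticChar_norm hk, norm_aeval_eq_resultant, cubicWeight,
    LinearMap.charpoly_natDegree]

theorem monicSum_cubicWeight_one (a b : k) : monicSum (cubicWeight a b) 1 = -cubicTrace a b := by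
  rw [monicSum_one, cubicTrace, neg_neg]
  refine Finset.sum_congr rfl fun c _ => ?_
  rw [cubicWeight, natDegree_X_sub_C, resultant_X_sub_C_left _ _ _ le_rfl]
  simp

theorem monicSum_cubicWeight_two (hk : ringChar k ≠ 2) {a b : k} (hb : b ≠ 0)
    (hab : a ^ 2 - 4 * b ≠ 0) : monicSum (cubicWeight a b) 2 = Fintype.card k := by
  classical
  have hweight (u w : k) : cubicWeight a b (X ^ 2 + C u * X + C w) = quadraticChar k w *
      quadraticChar k (b * (u - a) ^ 2 + -(a * (w - b)) * (u - a) + (w - b) ^ 2) := by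
    have hdeg : (X ^ 2 + C u * X + C w : k[X]).natDegree = 2 := by compute_degree!
    rw [← map_mul, ← resultant_quadratic_X_mul_quadratic, cubicWeight, hdeg,
      natDegree_X_mul_quadratic]
  have hinner (w : k) : ∑ u : k, cubicWeight a b (X ^ 2 + C u * X + C w) =
      quadraticChar k w * (-quadraticChar k b) + if w = b then (Fintype.card k : ℤ) else 0 := by
    have hdisc : (-(a * (w - b))) ^ 2 - 4 * b * (w - b) ^ 2 = (w - b) ^ 2 * (a ^ 2 - 4 * b) := by
      ring
    have hshift : ∑ u : k,
        quadraticChar k (b * (u - a) ^ 2 + -(a * (w - b)) * (u - a) + (w - b) ^ 2) =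
          ∑ u : k, quadraticChar k (b * u ^ 2 + -(a * (w - b)) * u + (w - b) ^ 2) :=
      Fintype.sum_equiv (Equiv.subRight a) _ _ fun u => rfl
    simp only [hweight]
    rw [← Finset.mul_sum, hshift, sum_quadraticChar_quadratic hk hb, hdisc]
    by_cases hw : w = b
    · subst hw
      rw [sub_self, zero_pow two_ne_zero, zero_mul, if_pos rfl, if_pos rfl]
      linear_combination (Fintype.card k : ℤ) * quadraticChar_mul_self hb
    · rw [if_neg (mul_ne_zero (pow_ne_zero _ (sub_ne_zero.mpr hw)) hab), if_neg hw, add_zero]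
  rw [monicSum_two, Finset.sum_comm, Finset.sum_congr rfl fun w _ => hinner w,
    Finset.sum_add_distrib, ← Finset.sum_mul, quadraticChar_sum_zero hk]
  simp

theorem monicSum_cubicWeight_eq_zero (hk : ringChar k ≠ 2) (a : k) {b : k} (hb : b ≠ 0) {n : ℕ}
    (hn : 3 ≤ n) : monicSum (cubicWeight a b) n = 0 := by
  classical
  have hdeg : (X ^ 2 + C a * X + C b : k[X]).degree < n := by
    have hdeg_two : (X ^ 2 + C a * X + C b : k[X]).degree = 2 := by compute_degree!
    rw [hdeg_two]
    exact_mod_cast hn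
  -- Adding a multiple of `X ^ 2 + a X + b` moves the value at `0` only.
  refine monicSum_eq_zero hdeg fun g hg => ?_
  set N := resultant g (X ^ 2 + C a * X + C b) n 2
  have hterm (c : k) : cubicWeight a b (g + C c * (X ^ 2 + C a * X + C b)) =
      quadraticChar k ((-1) ^ n * N * g.eval 0 + c * ((-1) ^ n * N * b)) := by
    have hnatDegree := (mem_monics.mp (add_C_mul_mem_monics hdeg hg c)).2
    rw [cubicWeight, hnatDegree, natDegree_X_mul_quadratic,
      resultant_add_C_mul_X_mul_quadratic a b c (by lia) hnatDegree.le]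
    ring_nf
    congr
  rw [Finset.sum_congr rfl fun c _ => hterm c]
  by_cases hN : N = 0
  · simp [hN]
  · exact sum_quadraticChar_affine hk _ (by simp [hN, hb])

theorem mk_monicSum_cubicWeight (hk : ringChar k ≠ 2) {a b : k} (hb : b ≠ 0)
    (hab : a ^ 2 - 4 * b ≠ 0) : PowerSeries.mk (monicSum (cubicWeight a b)) =
      1 - PowerSeries.C (cubicTrace a b) * PowerSeries.X +
        PowerSeries.C (Fintype.card k : ℤ) * PowerSeries.X ^ 2 := by
  ext i
  rw [PowerSeries.coeff_mk, map_add, map_sub, PowerSeries.coeff_one, PowerSeries.coeff_C_mul,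
    PowerSeries.coeff_X, PowerSeries.coeff_C_mul, PowerSeries.coeff_X_pow]
  rcases i with _ | _ | _ | i
  · simp [monicSum_zero (isMonicMultiplicative_cubicWeight a b)]
  · simp [monicSum_cubicWeight_one]
  · simp [monicSum_cubicWeight_two hk hb hab]
  · simp [monicSum_cubicWeight_eq_zero hk a hb (n := i + 1 + 1 + 1) (by lia)]

theorem cast_primePowerSum_cubicWeight {L : Type*} [CommRing L] [IsDomain L] (hk : ringChar k ≠ 2)
    {a b : k} (hb : b ≠ 0) (hab : a ^ 2 - 4 * b ≠ 0) {α β : L} (hadd : α + β = cubicTrace a b)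
    (hmul : α * β = Fintype.card k) {n : ℕ} (hn : n ≠ 0) :
    ((primePowerSum (cubicWeight a b) n : ℤ) : L) = -(α ^ n + β ^ n) := by
  have hfactor : PowerSeries.map (Int.castRingHom L) (PowerSeries.mk (monicSum (cubicWeight a b))) =
      (1 - PowerSeries.C α * PowerSeries.X ^ 1) * (1 - PowerSeries.C β * PowerSeries.X ^ 1) := by
    have hC_add := congrArg (PowerSeries.C (R := L)) hadd
    have hC_mul := congrArg (PowerSeries.C (R := L)) hmul
    rw [map_add] at hC_add
    rw [map_mul] at hC_mul
    rw [mk_monicSum_cubicWeight hk hb hab, map_add, map_sub, map_mul, map_mul, PowerSeries.map_C,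
      PowerSeries.map_C, map_pow, PowerSeries.map_X, map_one, eq_intCast, eq_intCast,
      Int.cast_natCast]
    linear_combination PowerSeries.X * hC_add - PowerSeries.X ^ 2 * hC_mul
  have hne : ((1 - PowerSeries.C α * PowerSeries.X ^ 1) *
      (1 - PowerSeries.C β * PowerSeries.X ^ 1) : PowerSeries L) ≠ 0 := fun h => by
    simpa using congrArg PowerSeries.constantCoeff h
  have hpower := (isLogDeriv_monicSum (isMonicMultiplicative_cubicWeight a b)).map
    (Int.castRingHom L)
  rw [hfactor] at hpower
  have heq := congrFun (hpower.right_unique hne ((isLogDeriv_one_sub_C_mul_X_pow α one_ne_zero).mul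
    (isLogDeriv_one_sub_C_mul_X_pow β one_ne_zero))) n
  simp only [eq_intCast, Pi.add_apply, isUnit_one, IsUnit.dvd, ne_eq, hn, not_false_eq_true,
    and_self, if_true, Nat.cast_one, one_mul, Nat.div_one] at heq
  rw [heq]
  ring

open Classical in
theorem cubicTrace_zero_right (hk : ringChar k ≠ 2) (a : k) :
    cubicTrace a 0 = quadraticChar k a := by
  have hterm (x : k) : quadraticChar k (x * (x ^ 2 + a * x + 0)) =
      quadraticChar k (a + x * 1) - if x = 0 then quadraticChar k a else 0 := by
    split_ifs with hx
    · simp [hx]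
    · rw [sub_zero, ← quadraticChar_sq_mul hx (a + x * 1)]
      ring_nf
  rw [cubicTrace, Finset.sum_congr rfl fun x _ => hterm x, Finset.sum_sub_distrib,
    sum_quadraticChar_affine hk a one_ne_zero]
  simp

open Classical in
theorem cubicTrace_two_mul_sq (hk : ringChar k ≠ 2) (c : k) :
    cubicTrace (2 * c) (c ^ 2) = quadraticChar k (-c) := by
  have hterm (x : k) : quadraticChar k (x * (x ^ 2 + 2 * c * x + c ^ 2)) =
      quadraticChar k (0 + x * 1) - if x = -c then quadraticChar k (-c) else 0 := by
    have hsquare : x * (x ^ 2 + 2 * c * x + c ^ 2) = (x + c) ^ 2 * x := by ring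
    rw [hsquare]
    split_ifs with hx
    · simp [hx]
    · rw [sub_zero, quadraticChar_sq_mul fun h => hx (eq_neg_of_add_eq_zero_left h)]
      ring_nf
  rw [cubicTrace, Finset.sum_congr rfl fun x _ => hterm x, Finset.sum_sub_distrib,
    sum_quadraticChar_affine hk 0 one_ne_zero]
  simp

theorem exists_add_eq_mul_eq {L : Type*} [Field L] [IsAlgClosed L] (s m : L) :
    ∃ α β : L, α + β = s ∧ α * β = m := by
  have hdeg : (X ^ 2 + C (-s) * X + C m : L[X]).degree = 2 := by compute_degree!
  obtain ⟨α, hα⟩ := IsAlgClosed.exists_root (X ^ 2 + C (-s) * X + C m : L[X])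
    (hdeg ▸ two_ne_zero)
  refine ⟨α, s - α, by ring, ?_⟩
  simp only [IsRoot, eval_add, eval_mul, eval_pow, eval_X, eval_C] at hα
  linear_combination -hα

open Classical in
theorem exists_cubicTrace_extension (L : Type*) [Field L] [IsAlgClosed L]
    (hk : ringChar k ≠ 2) (a b : k) :
    ∃ α β : L, α + β = cubicTrace a b ∧
      α * β = (if b * (a ^ 2 - 4 * b) = 0 then 0 else (Fintype.card k : L)) ∧
      ∀ (K : Type*) [Field K] [Fintype K] [Algebra k K],
        (cubicTrace (algebraMap k K a) (algebraMap k K b) : L) =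
          α ^ Module.finrank k K + β ^ Module.finrank k K := by
  by_cases hb : b = 0
  · subst hb
    refine ⟨quadraticChar k a, 0, by simp [cubicTrace_zero_right hk], by simp, fun K _ _ _ => ?_⟩
    rw [map_zero, cubicTrace_zero_right (Algebra.ringChar_eq k K ▸ hk), quadraticChar_algebraMap hk,
      zero_pow Module.finrank_pos.ne', add_zero, Int.cast_pow]
  by_cases hab : a ^ 2 - 4 * b = 0
  · obtain ⟨c, rfl⟩ : ∃ c, a = 2 * c := ⟨a / 2, (mul_div_cancel₀ a (Ring.two_ne_zero hk)).symm⟩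
    obtain rfl : b = c ^ 2 := by
      apply mul_left_cancel₀ (mul_ne_zero (Ring.two_ne_zero hk) (Ring.two_ne_zero hk))
      linear_combination -hab
    refine ⟨quadraticChar k (-c), 0, by simp [cubicTrace_two_mul_sq hk], by simp [hab],
      fun K _ _ _ => ?_⟩
    rw [map_pow, map_mul, map_ofNat, cubicTrace_two_mul_sq (Algebra.ringChar_eq k K ▸ hk),
      ← map_neg, quadraticChar_algebraMap hk, zero_pow Module.finrank_pos.ne', add_zero,
      Int.cast_pow]
  · obtain ⟨α, β, hadd, hmul⟩ := exists_add_eq_mul_eq (cubicTrace a b : L) (Fintype.card k : L)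
    refine ⟨α, β, hadd, by rw [if_neg (mul_ne_zero hb hab), hmul], fun K _ _ _ => ?_⟩
    have hpower := cast_primePowerSum_cubicWeight hk hb hab hadd hmul
      (Module.finrank_pos (R := k) (M := K)).ne'
    rw [primePowerSum_cubicWeight hk, Int.cast_neg] at hpower
    exact neg_injective hpower

end CubicSum

/-! ### Jacobi sums and the family of cubics `x (x ^ 2 + s x - 4 s)` -/

section JacobiProduct

variable {k : Type*} [Field k] {L : Type*} [Field L]

theorem mulChar_mul_inv_apply (χ : MulChar k L) {a : k} (ha : a ≠ 0) : χ a * χ⁻¹ a = 1 := by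
  rw [← MulChar.mul_apply, mul_inv_cancel, MulChar.one_apply ha.isUnit]

theorem four_ne_zero_of_ringChar (hk : ringChar k ≠ 2) : (4 : k) ≠ 0 := by
  have hfour : (4 : k) = 2 * 2 := by norm_num
  exact hfour ▸ mul_ne_zero (Ring.two_ne_zero hk) (Ring.two_ne_zero hk)

variable [Fintype k]

theorem quadChar_apply [DecidableEq k] (x : k) : quadChar k L x = (quadraticChar k x : L) := by
  rw [quadChar, MulChar.ringHomComp_apply, eq_intCast]
  congr!

open Classical in
theorem isQuadratic_quadChar : (quadChar k L).IsQuadratic :=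
  (quadraticChar_isQuadratic k).comp _

theorem quadChar_mul_self : quadChar k L * quadChar k L = 1 := by
  rw [← sq, isQuadratic_quadChar.sq_eq_one]

open Classical in
theorem quadChar_ne_one [CharZero L] (hk : ringChar k ≠ 2) : quadChar k L ≠ 1 :=
  (MulChar.ringHomComp_ne_one_iff (Int.castRingHom L).injective_int).mpr (quadraticChar_ne_one hk)

theorem quadChar_sq {a : k} (ha : a ≠ 0) : quadChar k L (a ^ 2) = 1 := by
  classical
  rw [quadChar_apply, quadraticChar_sq_one' ha, Int.cast_one]

theorem quadChar_four (hk : ringChar k ≠ 2) : quadChar k L 4 = 1 := by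
  have hfour : (4 : k) = 2 ^ 2 := by norm_num
  rw [hfour, quadChar_sq (Ring.two_ne_zero hk)]

theorem cast_cubicTrace (a b : k) :
    (cubicTrace a b : L) = -∑ x : k, quadChar k L (x * (x ^ 2 + a * x + b)) := by
  classical
  simp only [cubicTrace, quadChar_apply, Int.cast_neg, Int.cast_sum]

theorem jacobiSum_quadChar (hk : ringChar k ≠ 2) {χ : MulChar k L} (hχ : χ ≠ 1) :
    jacobiSum χ (quadChar k L) = χ 4 * jacobiSum χ χ := by
  classical
  have hsquare : χ 4 * jacobiSum χ χ = ∑ v : k, χ (1 - v ^ 2) := by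
    rw [jacobiSum, Finset.mul_sum]
    refine Fintype.sum_equiv ((Equiv.mulLeft₀ (2 : k) (Ring.two_ne_zero hk)).trans
      (Equiv.subRight 1)) _ _ fun x => ?_
    change _ = χ (1 - (2 * x - 1) ^ 2)
    rw [← map_mul, ← map_mul]
    ring_nf
  have haffine : ∑ z : k, χ (1 - z) = 0 := by
    rw [← sum_mulChar_affine hχ 1 (neg_ne_zero.mpr one_ne_zero)]
    exact Finset.sum_congr rfl fun z _ => by ring_nf
  rw [hsquare, sum_sq hk fun z => χ (1 - z)]
  simp only [add_mul, one_mul, Finset.sum_add_distrib]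
  rw [haffine, zero_add, jacobiSum_comm, jacobiSum]
  simp only [quadChar_apply]

theorem sum_mul_quadChar_cubic {χ : MulChar k L} (hχ : χ ≠ 1) (x : k) :
    ∑ s : k, χ s * quadChar k L (x * (x ^ 2 + s * x + -4 * s)) =
      χ x ^ 2 * χ⁻¹ (4 - x) * quadChar k L x * jacobiSum χ (quadChar k L) := by
  by_cases hx : x = 0
  · simp [hx, MulChar.map_zero]
  by_cases hx4 : x = 4
  · subst hx4
    have hconst (s : k) : (4 : k) * (4 ^ 2 + s * 4 + -4 * s) = 8 ^ 2 := by ring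
    simp only [hconst, ← Finset.sum_mul, MulChar.sum_eq_zero_of_ne_one hχ]
    simp [MulChar.map_zero]
  have h4x : 4 - x ≠ 0 := sub_ne_zero.mpr (Ne.symm hx4)
  have hscale : x ^ 2 * (4 - x)⁻¹ ≠ 0 := mul_ne_zero (pow_ne_zero _ hx) (inv_ne_zero h4x)
  rw [jacobiSum, Finset.mul_sum]
  refine (Fintype.sum_equiv (Equiv.mulLeft₀ _ hscale) _ _ fun u => ?_).symm
  change _ = χ (x ^ 2 * (4 - x)⁻¹ * u) *
    quadChar k L (x * (x ^ 2 + x ^ 2 * (4 - x)⁻¹ * u * x + -4 * (x ^ 2 * (4 - x)⁻¹ * u)))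
  have hcubic : x * (x ^ 2 + x ^ 2 * (4 - x)⁻¹ * u * x + -4 * (x ^ 2 * (4 - x)⁻¹ * u)) =
      x ^ 2 * (x * (1 - u)) := by
    field_simp
    ring
  rw [hcubic, map_mul (quadChar k L), quadChar_sq hx, map_mul, map_mul, map_mul, map_pow,
    MulChar.inv_apply']
  ring

theorem sum_sq_mul_inv_mul_quadChar (hk : ringChar k ≠ 2) (χ : MulChar k L) :
    ∑ x : k, χ x ^ 2 * χ⁻¹ (4 - x) * quadChar k L x =
      χ 4 * jacobiSum (quadChar k L * χ ^ 2) χ⁻¹ := by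
  have h4 : (4 : k) ≠ 0 := four_ne_zero_of_ringChar hk
  rw [jacobiSum, Finset.mul_sum]
  refine (Fintype.sum_equiv (Equiv.mulLeft₀ _ h4) _ _ fun z => ?_).symm
  change _ = χ (4 * z) ^ 2 * χ⁻¹ (4 - 4 * z) * quadChar k L (4 * z)
  have hfactor : (4 : k) - 4 * z = 4 * (1 - z) := by ring
  rw [hfactor, map_mul χ, map_mul χ⁻¹, map_mul (quadChar k L), quadChar_four hk, MulChar.mul_apply,
    sq χ, MulChar.mul_apply]
  linear_combination (-(χ 4 * χ z ^ 2 * χ⁻¹ (1 - z) * quadChar k L z)) * mulChar_mul_inv_apply χ h4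

theorem sum_mul_cubicTrace (hk : ringChar k ≠ 2) {χ : MulChar k L} (hχ : χ ≠ 1) :
    ∑ s : k, χ s * (cubicTrace s (-4 * s) : L) = -jacobiProduct χ := by
  simp only [cast_cubicTrace, mul_neg, Finset.sum_neg_distrib, Finset.mul_sum]
  rw [Finset.sum_comm, Finset.sum_congr rfl fun x _ => sum_mul_quadChar_cubic hχ x,
    ← Finset.sum_mul, sum_sq_mul_inv_mul_quadChar hk, jacobiSum_quadChar hk hχ, jacobiProduct, jac,
    jac, sq χ, MulChar.mul_apply]
  ring

theorem sum_cubicTrace [CharZero L] (hk : ringChar k ≠ 2) :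
    ∑ s : k, (cubicTrace s (-4 * s) : L) = -Fintype.card k := by
  classical
  have hinner (x : k) : ∑ s : k, quadChar k L (x * (x ^ 2 + s * x + -4 * s)) =
      if x = 4 then (Fintype.card k : L) else 0 := by
    split_ifs with hx4
    · subst hx4
      have hconst (s : k) : (4 : k) * (4 ^ 2 + s * 4 + -4 * s) = (4 * 2) ^ 2 := by ring
      have h8 : (4 * 2 : k) ≠ 0 := mul_ne_zero (four_ne_zero_of_ringChar hk) (Ring.two_ne_zero hk)
      simp only [hconst, quadChar_sq h8, Finset.sum_const, Finset.card_univ, nsmul_eq_mul, mul_one]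
    · by_cases hx : x = 0
      · simp [hx, MulChar.map_zero]
      rw [← sum_mulChar_affine (quadChar_ne_one (L := L) hk) (x * x ^ 2)
        (mul_ne_zero hx (sub_ne_zero.mpr hx4))]
      exact Finset.sum_congr rfl fun s _ => by ring_nf
  simp only [cast_cubicTrace, Finset.sum_neg_distrib]
  rw [Finset.sum_comm, Finset.sum_congr rfl fun x _ => hinner x]
  simp

theorem jacobiProduct_quadChar [CharZero L] (hk : ringChar k ≠ 2) :
    jacobiProduct (quadChar k L) = 1 := by
  have hinv : (quadChar k L)⁻¹ = quadChar k L := isQuadratic_quadChar.inv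
  have hjacobi : jacobiSum (quadChar k L) (quadChar k L) = -quadChar k L (-1) := by
    rw [← jacobiSum_nontrivial_inv (quadChar_ne_one (L := L) hk), hinv]
  have hneg : quadChar k L (-1) * quadChar k L (-1) = 1 := by
    rw [← map_mul, neg_one_mul, neg_neg, map_one]
  rw [jacobiProduct, jac, jac, sq, quadChar_mul_self, mul_one, hinv, hjacobi,
    MulChar.one_apply (four_ne_zero_of_ringChar hk).isUnit]
  linear_combination hneg

section SquareRoot

variable [CharZero L] (hk : ringChar k ≠ 2) {χ : MulChar k L} (hχ : χ ^ 2 = quadChar k L)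
include hk hχ

theorem ne_one_of_sq_eq_quadChar : χ ≠ 1 := by
  rintro rfl
  exact quadChar_ne_one hk (by rw [← hχ, one_pow])

theorem jacobiProduct_of_sq_eq_quadChar : jacobiProduct χ = -jacobiSum χ χ := by
  have htrivial : jacobiSum 1 χ⁻¹ = -1 :=
    jacobiSum_one_nontrivial (inv_ne_one.mpr (ne_one_of_sq_eq_quadChar hk hχ))
  rw [jacobiProduct, hχ, quadChar_mul_self, jac, jac, htrivial, quadChar_four hk]
  ring

omit [CharZero L] in
theorem sum_quadChar_cubic_zero_neg_four :
    ∑ x : k, quadChar k L (x * (x ^ 2 + 0 * x + -4)) =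
      χ 4 * (jacobiSum χ (quadChar k L) + jacobiSum χ⁻¹ (quadChar k L)) := by
  classical
  have hsq (x : k) : quadChar k L x = χ (x ^ 2) := by
    rw [← hχ, map_pow, sq, sq, MulChar.mul_apply]
  have hmul : quadChar k L * χ = χ⁻¹ := by
    rw [eq_inv_iff_mul_eq_one, mul_assoc, ← sq, hχ, quadChar_mul_self]
  have hneg : quadChar k L (-1) = 1 := by rw [hsq, neg_one_sq, map_one]
  have hterm (x : k) : quadChar k L (x * (x ^ 2 + 0 * x + -4)) =
      χ (x ^ 2) * quadChar k L (x ^ 2 - 4) := by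
    rw [map_mul, hsq x]
    ring_nf
  rw [Finset.sum_congr rfl fun x _ => hterm x, sum_sq hk fun z => χ z * quadChar k L (z - 4),
    jacobiSum, jacobiSum, ← Finset.sum_add_distrib, Finset.mul_sum]
  simp only [← quadChar_apply]
  refine (Fintype.sum_equiv (Equiv.mulLeft₀ _ (four_ne_zero_of_ringChar hk)) _ _ fun y => ?_).symm
  change _ = (1 + quadChar k L (4 * y)) * (χ (4 * y) * quadChar k L (4 * y - 4))
  have hfactor : 4 * y - 4 = 4 * (-1 * (1 - y)) := by ring
  rw [hfactor, map_mul, map_mul, map_mul, map_mul, quadChar_four hk, hneg, ← hmul,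
    MulChar.mul_apply]
  ring

theorem cubicTrace_zero_neg_four :
    (cubicTrace (0 : k) (-4) : L) = jacobiProduct χ + jacobiProduct χ⁻¹ := by
  have hinv : χ⁻¹ ^ 2 = quadChar k L := by rw [inv_pow, hχ, isQuadratic_quadChar.inv]
  have hne := ne_one_of_sq_eq_quadChar hk hχ
  have hfour : χ 4 * χ 4 = 1 := by rw [← MulChar.mul_apply, ← sq, hχ, quadChar_four hk]
  rw [jacobiProduct_of_sq_eq_quadChar hk hχ, jacobiProduct_of_sq_eq_quadChar hk hinv,
    cast_cubicTrace, sum_quadChar_cubic_zero_neg_four hk hχ, jacobiSum_quadChar hk hne,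
    jacobiSum_quadChar hk (inv_ne_one.mpr hne)]
  linear_combination (-jacobiSum χ χ) * hfour -
    jacobiSum χ⁻¹ χ⁻¹ * mulChar_mul_inv_apply χ (four_ne_zero_of_ringChar hk)

end SquareRoot

theorem cubicTrace_zero_left (hk : Fintype.card k % 4 = 3) (b : k) : cubicTrace 0 b = 0 := by
  classical
  have hneg : quadraticChar k (-1) = -1 := by
    rw [quadraticChar_neg_one_iff_not_isSquare, FiniteField.isSquare_neg_one_iff]
    simpa using hk
  have hodd : ∑ x : k, quadraticChar k (x * (x ^ 2 + 0 * x + b)) =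
      -∑ x : k, quadraticChar k (x * (x ^ 2 + 0 * x + b)) := by
    rw [← Finset.sum_neg_distrib]
    refine Fintype.sum_equiv (Equiv.neg k) _ _ fun x => ?_
    change _ = -quadraticChar k (-x * ((-x) ^ 2 + 0 * -x + b))
    have hfactor : -x * ((-x) ^ 2 + 0 * -x + b) = -1 * (x * (x ^ 2 + 0 * x + b)) := by ring
    rw [hfactor, map_mul _ (-1), hneg, neg_one_mul, neg_neg]
  have hzero := self_eq_neg.mp hodd
  rw [cubicTrace, neg_eq_zero]
  convert hzero

section Extension

variable [CharZero L] {K : Type*} [Field K] [Fintype K] [Algebra k K] {χ : MulChar k L}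
  {χ' : MulChar K L}

theorem neg_jacobiSum_extension (hχ : χ ≠ 1) (hχ' : ∀ x, χ' x = χ (Algebra.norm k x))
    {ψ : MulChar k L} {ψ' : MulChar K L} (hψ' : ∀ x, ψ' x = ψ (Algebra.norm k x)) :
    -jacobiSum χ' ψ' = (-jacobiSum χ ψ) ^ Module.finrank k K := by
  rw [← neg_inj, neg_neg, ← sum_norm_eq_neg_jacobiSum_pow (K := K) hχ ψ, jacobiSum]
  simp only [hχ', hψ']

theorem jacobiProduct_extension (hk : ringChar k ≠ 2) (hχ : χ ≠ 1)
    (hχ' : ∀ x, χ' x = χ (Algebra.norm k x)) :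
    jacobiProduct χ' = jacobiProduct χ ^ Module.finrank k K := by
  classical
  have hsq (x : K) : (χ' ^ 2) x = (χ ^ 2) (Algebra.norm k x) := by
    rw [sq, sq, MulChar.mul_apply, MulChar.mul_apply, hχ']
  have hinv (x : K) : χ'⁻¹ x = χ⁻¹ (Algebra.norm k x) := by
    rw [MulChar.inv_apply', MulChar.inv_apply', hχ', Algebra.norm_inv]
  have hquad (x : K) : (quadChar K L * χ' ^ 2) x = (quadChar k L * χ ^ 2) (Algebra.norm k x) := by
    rw [MulChar.mul_apply, MulChar.mul_apply, hsq, quadChar_apply, quadChar_apply,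
      quadraticChar_norm hk]
  have hfour : (χ' ^ 2) 4 = (χ ^ 2) 4 ^ Module.finrank k K := by
    rw [hsq, ← map_ofNat (algebraMap k K) 4, Algebra.norm_algebraMap, map_pow]
  rw [jacobiProduct, jacobiProduct, jac, jac, jac, jac, hfour, neg_jacobiSum_extension hχ hχ' hχ',
    jacobiSum_comm (quadChar K L * _), jacobiSum_comm (quadChar k L * _),
    neg_jacobiSum_extension (inv_ne_one.mpr hχ) hinv hquad, mul_pow, mul_pow]

end Extension

section Frobenius

variable {K : Type*} [Field K] [Fintype K] (e : k ≃+* K)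

theorem jacobiSum_ringEquiv {χ ψ : MulChar k L} {χ' ψ' : MulChar K L} (hχ : ∀ x, χ' (e x) = χ x)
    (hψ : ∀ x, ψ' (e x) = ψ x) : jacobiSum χ' ψ' = jacobiSum χ ψ :=
  (Fintype.sum_equiv e.toEquiv _ _ fun x => by simp [← hχ, ← hψ]).symm

theorem quadChar_ringEquiv (x : k) : quadChar K L (e x) = quadChar k L x := by
  classical
  have hsquare : IsSquare (e x) ↔ IsSquare x :=
    ⟨fun h => by simpa using h.map e.symm, fun h => h.map e⟩
  simp only [quadChar_apply, quadraticChar_apply, quadraticCharFun, map_eq_zero, hsquare]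

theorem jacobiProduct_ringEquiv {χ : MulChar k L} {χ' : MulChar K L} (h : ∀ x, χ' (e x) = χ x) :
    jacobiProduct χ' = jacobiProduct χ := by
  have hsq (x : k) : (χ' ^ 2) (e x) = (χ ^ 2) x := by
    rw [sq, sq, MulChar.mul_apply, MulChar.mul_apply, h]
  have hinv (x : k) : χ'⁻¹ (e x) = χ⁻¹ x := by
    rw [MulChar.inv_apply', MulChar.inv_apply', ← map_inv₀, h]
  have hquad (x : k) : (quadChar K L * χ' ^ 2) (e x) = (quadChar k L * χ ^ 2) x := by
    rw [MulChar.mul_apply, MulChar.mul_apply, hsq, quadChar_ringEquiv]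
  rw [jacobiProduct, jacobiProduct, jac, jac, jac, jac, jacobiSum_ringEquiv e h h,
    jacobiSum_ringEquiv e hquad hinv, ← hsq, map_ofNat e]

theorem jacobiProduct_pow_frobenius (p n : ℕ) [ExpChar k p] (χ : MulChar k L) :
    jacobiProduct (χ ^ p ^ n) = jacobiProduct χ :=
  (jacobiProduct_ringEquiv (RingEquiv.ofBijective (iterateFrobenius k p n)
    (Finite.injective_iff_bijective.mp (iterateFrobenius k p n).injective)) fun x => by
      rw [RingEquiv.ofBijective_apply, iterateFrobenius_def, map_pow,
        MulChar.pow_apply' _ (pow_ne_zero n (expChar_ne_zero k p))]).symm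

end Frobenius

end JacobiProduct

/-! ### Minimal models and their reductions -/

section PointCount

open WeierstrassCurve

variable {k : Type*} [Field k]

theorem equation_variableChange_iff (W : WeierstrassCurve k) (C : VariableChange k) (x y : k) :
    (C • W).toAffine.Equation x y ↔
      W.toAffine.Equation (C.u ^ 2 * x + C.r) (C.u ^ 3 * y + (C.u ^ 2 * C.s * x + C.t)) := by
  have hu : (C.u : k) ≠ 0 := C.u.ne_zero
  rw [Affine.equation_iff', Affine.equation_iff', ← mul_eq_zero_iff_left (pow_ne_zero 6 hu)]
  simp only [variableChange_a₁, variableChange_a₂, variableChange_a₃, variableChange_a₄,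
    variableChange_a₆, Units.val_inv_eq_inv_val]
  refine Eq.congr ?_ rfl
  field_simp
  ring

/-- The transformation `(x, y) ↦ (u ^ 2 x + r, u ^ 3 y + u ^ 2 s x + t)` of the affine plane
attached to a change of variables. -/
def planeEquiv (C : VariableChange k) : k × k ≃ k × k :=
  Equiv.prodShear ((C.u ^ 2).mulLeft.trans (Equiv.addRight C.r)) fun x =>
    (C.u ^ 3).mulLeft.trans (Equiv.addRight (C.u ^ 2 * C.s * x + C.t))

theorem cubicPointCount_variableChange (W : WeierstrassCurve k) (C : VariableChange k) :
    cubicPointCount (C • W) = cubicPointCount W :=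
  congrArg (· + 1) (Nat.card_congr ((planeEquiv C).subtypeEquiv fun P =>
    equation_variableChange_iff W C P.1 P.2))

theorem equation_cubic_iff (a b x y : k) :
    (⟨0, a, 0, b, 0⟩ : WeierstrassCurve k).toAffine.Equation x y ↔
      y ^ 2 = x * (x ^ 2 + a * x + b) := by
  rw [Affine.equation_iff]
  ring_nf

theorem cubicPointCount_cubic [Fintype k] (hk : ringChar k ≠ 2) (a b : k) :
    (cubicPointCount (⟨0, a, 0, b, 0⟩ : WeierstrassCurve k) : ℤ) =
      Fintype.card k + 1 - cubicTrace a b := by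
  classical
  have hfiber (x : k) : (Nat.card {y : k // y ^ 2 = x * (x ^ 2 + a * x + b)} : ℤ) =
      quadraticChar k (x * (x ^ 2 + a * x + b)) + 1 := by
    rw [← quadraticChar_card_sqrts hk, Nat.card_eq_fintype_card, Fintype.card_subtype]
    congr 2
    ext y
    simp
  have hpoints : (Nat.card {P : k × k // P.2 ^ 2 = P.1 * (P.1 ^ 2 + a * P.1 + b)} : ℤ) =
      ∑ x : k, (quadraticChar k (x * (x ^ 2 + a * x + b)) + 1) := by
    rw [Nat.card_congr (Equiv.subtypeProdEquivSigmaSubtype fun x y : k =>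
      y ^ 2 = x * (x ^ 2 + a * x + b)), Nat.card_sigma, Nat.cast_sum]
    exact Finset.sum_congr rfl fun x _ => hfiber x
  simp only [cubicPointCount, equation_cubic_iff]
  rw [Nat.cast_add, hpoints, Finset.sum_add_distrib, cubicTrace]
  simp
  ring

end PointCount

section Minimal

open WeierstrassCurve

section Invariants

variable {R : Type*} [CommRing R]

theorem Δ_cubic (a b : R) :
    (⟨0, a, 0, b, 0⟩ : WeierstrassCurve R).Δ = 2 ^ 4 * (b ^ 2 * (a ^ 2 - 4 * b)) := by
  simp only [WeierstrassCurve.Δ, b₂, b₄, b₆, b₈]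
  ring

theorem c₄_cubic (a b : R) :
    (⟨0, a, 0, b, 0⟩ : WeierstrassCurve R).c₄ = 2 ^ 4 * (a ^ 2 - 3 * b) := by
  simp only [WeierstrassCurve.c₄, b₂, b₄]
  ring

end Invariants

theorem ringChar_residueField_ne_two {R : Type*} [CommRing R] [IsLocalRing R]
    (h2 : IsUnit (2 : R)) : ringChar (IsLocalRing.ResidueField R) ≠ 2 := fun h => by
  have hres2 := (h2.map (IsLocalRing.residue R)).ne_zero
  rw [map_ofNat] at hres2
  exact hres2 (by exact_mod_cast h ▸ ringChar.Nat.cast_ringChar (R := IsLocalRing.ResidueField R))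

section VariableChange

variable {K : Type*} [Field K]

theorem u_pow_twelve_mul_Δ (W : WeierstrassCurve K) (D : VariableChange K) :
    (D.u : K) ^ 12 * (D • W).Δ = W.Δ := by
  rw [variableChange_Δ, Units.val_inv_eq_inv_val, ← mul_assoc, ← mul_pow,
    mul_inv_cancel₀ D.u.ne_zero, one_pow, one_mul]

theorem u_pow_four_mul_c₄ (W : WeierstrassCurve K) (D : VariableChange K) :
    (D.u : K) ^ 4 * (D • W).c₄ = W.c₄ := by
  rw [variableChange_c₄, Units.val_inv_eq_inv_val, ← mul_assoc, ← mul_pow,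
    mul_inv_cancel₀ D.u.ne_zero, one_pow, one_mul]

end VariableChange

variable {R : Type*} [CommRing R] {K : Type*} [Field K] [Algebra R K] [IsFractionRing R K]

theorem exists_variableChange_map_eq [IsIntegrallyClosed R] (h2 : IsUnit (2 : R))
    {W W' : WeierstrassCurve R} {D : VariableChange K}
    (hD : W'.map (algebraMap R K) = D • W.map (algebraMap R K)) (u : Rˣ)
    (hu : algebraMap R K u = D.u) : ∃ C : VariableChange R, C.map (algebraMap R K) = D := by
  obtain ⟨i, hi⟩ := h2.exists_right_inv
  have hiK : (2 : K) * algebraMap R K i = 1 := by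
    rw [← map_ofNat (algebraMap R K) 2, ← map_mul, hi, map_one]
  have huK : algebraMap R K u ≠ 0 := hu ▸ D.u.ne_zero
  have ha₁ := congrArg WeierstrassCurve.a₁ hD
  have ha₃ := congrArg WeierstrassCurve.a₃ hD
  have hb₆ := congrArg WeierstrassCurve.b₆ hD
  rw [variableChange_a₁, map_a₁, map_a₁, Units.val_inv_eq_inv_val, ← hu] at ha₁
  rw [variableChange_a₃, map_a₃, map_a₃, map_a₁, Units.val_inv_eq_inv_val, ← hu] at ha₃
  rw [variableChange_b₆, map_b₆, map_b₆, map_b₄, map_b₂, Units.val_inv_eq_inv_val, ← hu] at hb₆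
  have hs : D.s = algebraMap R K (i * (u * W'.a₁ - W.a₁)) := by
    rw [map_mul, map_sub, map_mul, ha₁, mul_inv_cancel_left₀ huK]
    linear_combination (-D.s) * hiK
  -- The transformation formula for `b₆` is a cubic equation for `r` with leading coefficient `4`.
  have hr_integral : IsIntegral R D.r := by
    refine ⟨X ^ 3 + C (i ^ 2 * W.b₂) * X ^ 2 + C (i * W.b₄) * X +
      C (i ^ 2 * (W.b₆ - u ^ 6 * W'.b₆)), by monicity!, ?_⟩
    have hcubic : algebraMap R K u ^ 6 * algebraMap R K W'.b₆ = algebraMap R K W.b₆ +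
        2 * D.r * algebraMap R K W.b₄ + D.r ^ 2 * algebraMap R K W.b₂ + 4 * D.r ^ 3 := by
      rw [hb₆]
      field_simp
    simp only [eval₂_add, eval₂_mul, eval₂_pow, eval₂_X, eval₂_C]
    simp only [map_mul, map_sub, map_pow]
    linear_combination (-(algebraMap R K i) ^ 2) * hcubic +
      (-(D.r * algebraMap R K i * algebraMap R K W.b₄) -
        D.r ^ 3 * (1 + 2 * algebraMap R K i)) * hiK
  obtain ⟨r, hr⟩ := IsIntegrallyClosed.isIntegral_iff.mp hr_integral
  have ht : D.t = algebraMap R K (i * (u ^ 3 * W'.a₃ - W.a₃ - r * W.a₁)) := by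
    rw [map_mul, map_sub, map_sub, map_mul, map_mul, map_pow, ha₃, hr, inv_pow,
      mul_inv_cancel_left₀ (pow_ne_zero 3 huK)]
    linear_combination (-D.t) * hiK
  refine ⟨⟨u, r, i * (u * W'.a₁ - W.a₁), i * (u ^ 3 * W'.a₃ - W.a₃ - r * W.a₁)⟩, ?_⟩
  ext
  exacts [hu, hr, hs.symm, ht.symm]

variable [IsDomain R] [IsDiscreteValuationRing R]

theorem valuation_u_le_one {W : WeierstrassCurve K} [hmin : IsMinimal R W] {D : VariableChange K}
    {W₀ : WeierstrassCurve R} (hD : W = D • W₀.map (algebraMap R K)) (hΔ : W.Δ ≠ 0) :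
    (IsDiscreteValuationRing.maximalIdeal R).valuation K D.u ≤ 1 := by
  set v := (IsDiscreteValuationRing.maximalIdeal R).valuation K
  have hW₀ : D⁻¹ • W = W₀.map (algebraMap R K) := by rw [hD, inv_smul_smul]
  have hintegral : IsIntegral R (D⁻¹ • W) := ⟨W₀, hW₀⟩
  have hle : valuation_Δ_aux R (D⁻¹ • W) ≤ valuation_Δ_aux R ((1 : VariableChange K) • W) :=
    (le_total _ _).elim id (hmin.val_Δ_maximal.2 hintegral)
  rw [one_smul, ← Subtype.coe_le_coe, valuation_Δ_aux_eq_of_isIntegral,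
    valuation_Δ_aux_eq_of_isIntegral, hW₀, ← u_pow_twelve_mul_Δ (W₀.map (algebraMap R K)) D, ← hD,
    map_mul, map_pow] at hle
  by_contra! hlt
  exact hle.not_gt (lt_mul_of_one_lt_left (zero_lt_iff.mpr ((v.ne_zero_iff).mpr hΔ))
    (one_lt_pow₀ hlt (by norm_num)))

theorem exists_integralModel_minimal_eq (h2 : IsUnit (2 : R)) (W : WeierstrassCurve K)
    (C₀ : VariableChange K) (W₀ : WeierstrassCurve R) (hW : C₀ • W = W₀.map (algebraMap R K))
    (hΔ : W₀.Δ ≠ 0) (hmin : ∀ u : R, u ^ 12 ∣ W₀.Δ → u ^ 4 ∣ W₀.c₄ → IsUnit u) :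
    ∃ C : VariableChange R, integralModel R (W.minimal R) = C • W₀ := by
  have hinj : Function.Injective (algebraMap R K) := IsFractionRing.injective R K
  set W' := integralModel R (W.minimal R)
  have hW' : W'.map (algebraMap R K) = W.minimal R := baseChange_integralModel_eq R _
  obtain ⟨D, hD⟩ : ∃ D : VariableChange K,
      W'.map (algebraMap R K) = D • W₀.map (algebraMap R K) := by
    refine ⟨(W.exists_isMinimal R).choose * C₀⁻¹, ?_⟩
    rw [hW', ← hW, mul_smul, inv_smul_smul]
    rfl
  have hΔ_eq := u_pow_twelve_mul_Δ (W₀.map (algebraMap R K)) D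
  have hc₄_eq := u_pow_four_mul_c₄ (W₀.map (algebraMap R K)) D
  rw [← hD, map_Δ, map_Δ] at hΔ_eq
  rw [← hD, map_c₄, map_c₄] at hc₄_eq
  have hΔ' : (W.minimal R).Δ ≠ 0 := by
    intro hzero
    rw [← map_Δ, hW', hzero, mul_zero] at hΔ_eq
    exact hΔ (hinj (by rw [← hΔ_eq, map_zero]))
  obtain ⟨u, hu⟩ := IsDiscreteValuationRing.exists_lift_of_le_one
    (valuation_u_le_one (hW' ▸ hD) hΔ')
  obtain ⟨u, rfl⟩ : IsUnit u :=
    hmin u ⟨W'.Δ, hinj (by rw [map_mul, map_pow, hu, hΔ_eq])⟩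
      ⟨W'.c₄, hinj (by rw [map_mul, map_pow, hu, hc₄_eq])⟩
  obtain ⟨C, rfl⟩ := exists_variableChange_map_eq h2 hD u hu
  refine ⟨C, map_injective hinj ?_⟩
  change W'.map (algebraMap R K) = (C • W₀).map (algebraMap R K)
  rw [hD, ← map_variableChange]

/-- An integral model `y ^ 2 = x (x ^ 2 + a₀ x + b₀)` of `y ^ 2 = x (x ^ 2 + a x + b)`, obtained by
scaling by `u`, which satisfies the minimality criterion in terms of the discriminant and of `c₄`;
their factor `2 ^ 4`, a unit in the applications, is left out. -/
structure IsMinimalCubicModel (a b : K) (u : Kˣ) (a₀ b₀ : R) : Prop where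
  a_eq : a = u ^ 2 * algebraMap R K a₀
  b_eq : b = u ^ 4 * algebraMap R K b₀
  disc_ne_zero : b₀ * (a₀ ^ 2 - 4 * b₀) ≠ 0
  isUnit_of_pow_dvd : ∀ w : R, w ^ 12 ∣ b₀ ^ 2 * (a₀ ^ 2 - 4 * b₀) → w ^ 4 ∣ a₀ ^ 2 - 3 * b₀ →
    IsUnit w

namespace IsMinimalCubicModel

open IsLocalRing

variable {a b : K} {u : Kˣ} {a₀ b₀ : R}

theorem exists_reduction_minimal_eq (h : IsMinimalCubicModel a b u a₀ b₀) (h2 : IsUnit (2 : R)) :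
    ∃ C : VariableChange (ResidueField R),
      ((⟨0, a, 0, b, 0⟩ : WeierstrassCurve K).minimal R).reduction R =
        C • ⟨0, residue R a₀, 0, residue R b₀, 0⟩ := by
  have h16 : IsUnit (2 ^ 4 : R) := h2.pow 4
  have hmodel : (⟨u, 0, 0, 0⟩ : VariableChange K) • (⟨0, a, 0, b, 0⟩ : WeierstrassCurve K) =
      (⟨0, a₀, 0, b₀, 0⟩ : WeierstrassCurve R).map (algebraMap R K) := by
    ext <;> simp [variableChange_a₁, variableChange_a₂, variableChange_a₃, variableChange_a₄,
      variableChange_a₆, h.a_eq, h.b_eq]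
  obtain ⟨C, hC⟩ := exists_integralModel_minimal_eq h2 _ _ _ hmodel
    (by
      rw [Δ_cubic, sq, mul_assoc]
      exact mul_ne_zero h16.ne_zero (mul_ne_zero (left_ne_zero_of_mul h.disc_ne_zero)
        h.disc_ne_zero))
    (by simpa only [Δ_cubic, c₄_cubic, h16.dvd_mul_left] using h.isUnit_of_pow_dvd)
  refine ⟨C.map (residue R), ?_⟩
  have hmap : (⟨0, a₀, 0, b₀, 0⟩ : WeierstrassCurve R).map (residue R) =
      ⟨0, residue R a₀, 0, residue R b₀, 0⟩ := by
    ext <;> simp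
  rw [← hmap, map_variableChange, ← hC]
  rfl

theorem hasGoodReduction_minimal_iff (h : IsMinimalCubicModel a b u a₀ b₀)
    (h2 : IsUnit (2 : R)) :
    ((⟨0, a, 0, b, 0⟩ : WeierstrassCurve K).minimal R).HasGoodReduction R ↔
      residue R b₀ * (residue R a₀ ^ 2 - 4 * residue R b₀) ≠ 0 := by
  obtain ⟨C, hC⟩ := h.exists_reduction_minimal_eq h2
  have hres2 : (2 : ResidueField R) ≠ 0 := map_ofNat (residue R) 2 ▸ (h2.map (residue R)).ne_zero
  rw [hasGoodReduction_iff_isElliptic_reduction, isElliptic_iff, isUnit_iff_ne_zero, hC,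
    variableChange_Δ, Δ_cubic]
  simp [hres2]

theorem cubicPointCount_reduction_minimal [Fintype (ResidueField R)]
    (h : IsMinimalCubicModel a b u a₀ b₀) (h2 : IsUnit (2 : R)) :
    (cubicPointCount (((⟨0, a, 0, b, 0⟩ : WeierstrassCurve K).minimal R).reduction R) : ℤ) =
      Fintype.card (ResidueField R) + 1 - cubicTrace (residue R a₀) (residue R b₀) := by
  obtain ⟨C, hC⟩ := h.exists_reduction_minimal_eq h2
  rw [hC, cubicPointCount_variableChange, cubicPointCount_cubic (ringChar_residueField_ne_two h2)]

end IsMinimalCubicModel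

end Minimal

/-! ### Residue fields of the places of `F(t)` -/

section Residue

variable {F : Type*} [Field F]

theorem residue_eq_zero_iff_valuation (v : Place F) (x : v.ring) :
    IsLocalRing.residue v.ring x = 0 ↔ v.valuation (x : RatFunc F) < 1 := by
  rw [IsLocalRing.residue_eq_zero_iff]
  exact Valuation.mem_maximalIdeal_iff _ _

open Classical IsLocalRing in
theorem map_eulerPolynomial_cubic (v : Place F) [Fintype (ResidueField v.ring)]
    (h2 : IsUnit (2 : v.ring)) {a b : RatFunc F} {u : (RatFunc F)ˣ} {a₀ b₀ : v.ring}
    (hmodel : IsMinimalCubicModel a b u a₀ b₀) {L : Type*} [Field L] {α β : L}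
    (hadd : α + β = cubicTrace (residue v.ring a₀) (residue v.ring b₀))
    (hmul : α * β =
      if residue v.ring b₀ * (residue v.ring a₀ ^ 2 - 4 * residue v.ring b₀) = 0 then 0
      else (Fintype.card (ResidueField v.ring) : L)) :
    (eulerPolynomial ⟨0, a, 0, b, 0⟩ v).map (Int.castRingHom L) =
      (1 - C α * X ^ v.degree) * (1 - C β * X ^ v.degree) := by
  have hcard : residueCard v = Fintype.card (ResidueField v.ring) := Nat.card_eq_fintype_card
  have htrace : traceAt ⟨0, a, 0, b, 0⟩ v =
      cubicTrace (residue v.ring a₀) (residue v.ring b₀) := by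
    rw [traceAt, reductionAt, hmodel.cubicPointCount_reduction_minimal h2, hcard]
    ring
  have hexpand : (1 - C α * X ^ v.degree) * (1 - C β * X ^ v.degree) =
      1 - C (α + β) * X ^ v.degree + C (α * β) * X ^ (2 * v.degree) := by
    rw [C_add, C_mul]
    ring
  rw [hexpand, hadd, hmul, eulerPolynomial, htrace, hcard,
    if_congr (hmodel.hasGoodReduction_minimal_iff h2) rfl rfl, ite_not]
  split_ifs <;> simp

end Residue

section FinitePlace

variable {F : Type*} [Field F] {P : F[X]} (hm : P.Monic) (hi : Irreducible P)

/-- The inclusion of `F[t]` into the valuation ring of a finite place. -/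
def polyToRing : F[X] →+* (Place.finite P hm hi).ring where
  toFun h := ⟨algebraMap F[X] (RatFunc F) h, (Place.primeOf P hi).valuation_le_one h⟩
  map_one' := Subtype.ext (map_one _)
  map_mul' _ _ := Subtype.ext (map_mul _ _ _)
  map_zero' := Subtype.ext (map_zero _)
  map_add' _ _ := Subtype.ext (map_add _ _ _)

theorem coe_polyToRing (h : F[X]) :
    ((polyToRing hm hi h : (Place.finite P hm hi).ring) : RatFunc F) =
      algebraMap F[X] (RatFunc F) h := rfl

theorem polyToRing_injective : Function.Injective (polyToRing hm hi) := fun _ _ heq =>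
  IsFractionRing.injective F[X] (RatFunc F) (congrArg Subtype.val heq)

/-- Reduction of polynomials at a finite place. -/
def polyResidue : F[X] →+* IsLocalRing.ResidueField (Place.finite P hm hi).ring :=
  (IsLocalRing.residue _).comp (polyToRing hm hi)

theorem polyResidue_eq_zero_iff (h : F[X]) : polyResidue hm hi h = 0 ↔ P ∣ h := by
  rw [polyResidue, RingHom.comp_apply, residue_eq_zero_iff_valuation, coe_polyToRing]
  change (Place.primeOf P hi).valuation (RatFunc F) (algebraMap F[X] (RatFunc F) h) < 1 ↔ _
  rw [IsDedekindDomain.HeightOneSpectrum.valuation_lt_one_iff_mem]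
  exact Ideal.mem_span_singleton

theorem polyResidue_surjective : Function.Surjective (polyResidue hm hi) := by
  intro y
  obtain ⟨x, rfl⟩ := IsLocalRing.residue_surjective y
  obtain ⟨h, hclose⟩ := (Place.primeOf P hi).exists_valuation_sub_lt_of_integer
    (K := RatFunc F) (x := x) x.2 1
  refine ⟨h, ?_⟩
  rw [polyResidue, RingHom.comp_apply, ← sub_eq_zero, ← map_sub, residue_eq_zero_iff_valuation]
  exact hclose

theorem ker_polyResidue : RingHom.ker (polyResidue hm hi) = Ideal.span {P} := by
  ext h
  rw [RingHom.mem_ker, polyResidue_eq_zero_iff, Ideal.mem_span_singleton]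

/-- The residue field of a finite place is `F[t] / P`. -/
def residueEquiv : AdjoinRoot P ≃+* IsLocalRing.ResidueField (Place.finite P hm hi).ring :=
  (Ideal.quotEquivOfEq (ker_polyResidue hm hi).symm).trans
    (RingHom.quotientKerEquivOfSurjective (polyResidue_surjective hm hi))

theorem residueEquiv_mk (h : F[X]) :
    residueEquiv hm hi (AdjoinRoot.mk P h) = polyResidue hm hi h := rfl

theorem natCard_residueField :
    Nat.card (IsLocalRing.ResidueField (Place.finite P hm hi).ring) = Nat.card F ^ P.natDegree := by
  have : Fact (Irreducible P) := ⟨hi⟩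
  have : Module.Finite F (AdjoinRoot P) := hm.finite_adjoinRoot
  rw [← Nat.card_congr (residueEquiv hm hi).toEquiv, Module.natCard_eq_pow_finrank (K := F),
    ← finrank_quotient_span_eq_natDegree]
  rfl

theorem finite_residueField [Finite F] :
    Finite (IsLocalRing.ResidueField (Place.finite P hm hi).ring) := by
  apply Nat.finite_of_card_ne_zero
  rw [natCard_residueField]
  exact pow_ne_zero _ Nat.card_pos.ne'

variable {K : Type*} [Field K] [Algebra F K] {τ : K}

/-- The embedding of the residue field of a finite place attached to a root `τ` of `P`. -/
def residueLift (hτ : aeval τ P = 0) :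
    IsLocalRing.ResidueField (Place.finite P hm hi).ring →+* K :=
  (AdjoinRoot.lift (algebraMap F K) τ (aeval_def τ P ▸ hτ)).comp (residueEquiv hm hi).symm.toRingHom

theorem residueLift_polyResidue (hτ : aeval τ P = 0) (h : F[X]) :
    residueLift hm hi hτ (polyResidue hm hi h) = aeval τ h := by
  rw [residueLift, ← residueEquiv_mk, RingHom.comp_apply, RingEquiv.toRingHom_eq_coe,
    RingEquiv.coe_toRingHom, RingEquiv.symm_apply_apply, AdjoinRoot.lift_mk, aeval_def]

theorem finrank_residueField [Finite F] [Finite K]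
    [Algebra (IsLocalRing.ResidueField (Place.finite P hm hi).ring) K] :
    Module.finrank (IsLocalRing.ResidueField (Place.finite P hm hi).ring) K =
      Module.finrank F K / P.natDegree := by
  have hcard := Module.natCard_eq_pow_finrank (K := F) (V := K)
  rw [Module.natCard_eq_pow_finrank
    (K := IsLocalRing.ResidueField (Place.finite P hm hi).ring) (V := K),
    natCard_residueField, ← pow_mul] at hcard
  rw [← Nat.pow_right_injective (Finite.one_lt_card (α := F)) hcard,
    Nat.mul_div_cancel_left _ hi.natDegree_pos]

end FinitePlace

section InfinitePlace

variable {F : Type*} [Field F]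

theorem inftyValuation_C_le_one [DecidableEq (RatFunc F)] (c : F) :
    RatFunc.inftyValuation F (RatFunc.C c) ≤ 1 := by
  by_cases hc : c = 0
  · simp [hc]
  · rw [RatFunc.inftyValuation.C F hc]

theorem inftyValuation_inv_X_lt_one [DecidableEq (RatFunc F)] :
    RatFunc.inftyValuation F (RatFunc.X⁻¹) < 1 := by
  rw [map_inv₀, RatFunc.inftyValuation.X, ← WithZero.exp_neg, ← WithZero.exp_zero,
    WithZero.exp_lt_exp]
  exact neg_one_lt_zero

theorem inftyValuation_div_lt_one [DecidableEq (RatFunc F)] {g h : F[X]}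
    (hgh : g.degree < h.degree) :
    RatFunc.inftyValuation F (algebraMap F[X] (RatFunc F) g / algebraMap F[X] (RatFunc F) h) <
      1 := by
  by_cases hg : g = 0
  · simp [hg]
  have hh : h ≠ 0 := ne_zero_of_degree_gt hgh
  rw [map_div₀, RatFunc.inftyValuation_apply, RatFunc.inftyValuation_apply,
    RatFunc.inftyValuation.polynomial F hg, RatFunc.inftyValuation.polynomial F hh,
    ← WithZero.exp_sub, ← WithZero.exp_zero, WithZero.exp_lt_exp, sub_neg, Nat.cast_lt]
  exact natDegree_lt_natDegree hg hgh

theorem exists_inftyValuation_sub_C_lt_one [DecidableEq (RatFunc F)] {x : RatFunc F}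
    (hx : RatFunc.inftyValuation F x ≤ 1) :
    ∃ c : F, RatFunc.inftyValuation F (x - RatFunc.C c) < 1 := by
  by_cases hx0 : x = 0
  · exact ⟨0, by simp [hx0]⟩
  rw [RatFunc.inftyValuation_apply, RatFunc.inftyValuation_of_nonzero F hx0,
    ← WithZero.exp_zero, WithZero.exp_le_exp, RatFunc.intDegree] at hx
  have hdeg : x.num.natDegree - x.denom.natDegree = 0 := by omega
  have hquot := eq_C_of_natDegree_eq_zero ((natDegree_divByMonic _ x.monic_denom).trans hdeg)
  set c := (x.num /ₘ x.denom).coeff 0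
  have hnum : x.num - C c * x.denom = x.num %ₘ x.denom := by
    rw [← hquot, modByMonic_eq_sub_mul_div, mul_comm]
  have hsub : x - RatFunc.C c = algebraMap F[X] (RatFunc F) (x.num - C c * x.denom) /
      algebraMap F[X] (RatFunc F) x.denom := by
    rw [map_sub, map_mul, sub_div, RatFunc.num_div_denom, RatFunc.algebraMap_C,
      mul_div_cancel_right₀ _ (RatFunc.algebraMap_ne_zero x.denom_ne_zero)]
  refine ⟨c, ?_⟩
  rw [hsub, hnum]
  exact inftyValuation_div_lt_one (degree_modByMonic_lt _ x.monic_denom)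

open Classical in
/-- The constants in the valuation ring of the infinite place. -/
def constToRing : F →+* (Place.infinite : Place F).ring where
  toFun c := ⟨RatFunc.C c, inftyValuation_C_le_one c⟩
  map_one' := Subtype.ext (map_one _)
  map_mul' _ _ := Subtype.ext (map_mul _ _ _)
  map_zero' := Subtype.ext (map_zero _)
  map_add' _ _ := Subtype.ext (map_add _ _ _)

open Classical in
/-- The uniformizer `1 / t` of the infinite place. -/
def invX : (Place.infinite : Place F).ring := ⟨RatFunc.X⁻¹, inftyValuation_inv_X_lt_one.le⟩

open Classical in
theorem residue_invX : IsLocalRing.residue _ (invX : (Place.infinite : Place F).ring) = 0 :=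
  (residue_eq_zero_iff_valuation _ _).mpr inftyValuation_inv_X_lt_one

theorem residue_constToRing_surjective : Function.Surjective
    ((IsLocalRing.residue (Place.infinite : Place F).ring).comp constToRing) := by
  classical
  intro y
  obtain ⟨x, rfl⟩ := IsLocalRing.residue_surjective y
  obtain ⟨c, hc⟩ := exists_inftyValuation_sub_C_lt_one (x := (x : RatFunc F)) x.2
  refine ⟨c, ?_⟩
  rw [RingHom.comp_apply, eq_comm, ← sub_eq_zero, ← map_sub, residue_eq_zero_iff_valuation]
  exact hc

end InfinitePlace

/-! ### The Euler factors of the curves `E_d` -/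

section FiberTrace

variable {k K : Type*} [Field k] [Field K]

open Classical in
/-- The coefficient of `x` in the reduction `y ^ 2 = x (x ^ 2 + τ ^ (2 d) x + fiberCoeff d τ)` of a
minimal model of `E_d` at `t = τ`. At `τ = 0` with `d` even, the model of `E_d` is not minimal. -/
def fiberCoeff (d : ℕ) (τ : K) : K := if τ = 0 ∧ Even d then -4 else -4 * τ ^ (2 * d)

/-- The trace of the fibre at `t = τ` of the family `E_d`. -/
def fiberTrace [Fintype K] (d : ℕ) (τ : K) : ℤ := cubicTrace (τ ^ (2 * d)) (fiberCoeff d τ)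

theorem fiberCoeff_of_ne_zero (d : ℕ) {τ : K} (hτ : τ ≠ 0) :
    fiberCoeff d τ = -4 * τ ^ (2 * d) := if_neg fun h => hτ h.1

theorem fiberCoeff_zero_of_even {d : ℕ} (hd : Even d) : fiberCoeff d (0 : K) = -4 :=
  if_pos ⟨rfl, hd⟩

theorem fiberCoeff_of_odd {d : ℕ} (hd : Odd d) (τ : K) : fiberCoeff d τ = -4 * τ ^ (2 * d) :=
  if_neg fun h => Nat.not_even_iff_odd.mpr hd h.2

theorem map_fiberCoeff (φ : k →+* K) (d : ℕ) (τ : k) : φ (fiberCoeff d τ) = fiberCoeff d (φ τ) := by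
  by_cases h : τ = 0 ∧ Even d <;> simp [fiberCoeff, h, map_ofNat φ 4]

end FiberTrace

section MinimalModels

variable {R : Type*} [CommRing R] [IsDomain R] {K : Type*} [Field K] [Algebra R K]

theorem isMinimalCubicModel_of_isUnit (h2 : IsUnit (2 : R)) {s : R} (hs : IsUnit s)
    (hs16 : s + 16 ≠ 0) :
    IsMinimalCubicModel (algebraMap R K s) (-4 * algebraMap R K s) 1 s (-4 * s) where
  a_eq := by simp
  b_eq := by simp [map_ofNat (algebraMap R K) 4]
  disc_ne_zero := by
    have hfactor : -4 * s * (s ^ 2 - 4 * (-4 * s)) = -2 ^ 2 * s ^ 2 * (s + 16) := by ring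
    rw [hfactor]
    exact mul_ne_zero ((h2.pow 2).neg.mul (hs.pow 2)).ne_zero hs16
  isUnit_of_pow_dvd w hdisc hc₄ := by
    have hdvd16 : w ∣ s + 16 := by
      rw [← ((h2.pow 4).mul (hs.pow 3)).dvd_mul_left]
      convert (dvd_pow_self w (by norm_num)).trans hdisc using 1
      ring
    have hdvd12 : w ∣ s + 12 := by
      rw [← hs.dvd_mul_left]
      convert (dvd_pow_self w (by norm_num)).trans hc₄ using 1
      ring
    refine isUnit_of_dvd_unit ?_ (h2.pow 2)
    convert dvd_sub hdvd16 hdvd12 using 1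
    ring

theorem isMinimalCubicModel_of_even (h2 : IsUnit (2 : R)) {t : R} {d e : ℕ} (hde : d = 2 * e)
    (ht16 : IsUnit (t ^ (2 * d) + 16)) {u : Kˣ} (hu : (u : K) = algebraMap R K t ^ e) :
    IsMinimalCubicModel (algebraMap R K t ^ (2 * d)) (-4 * algebraMap R K t ^ (2 * d)) u
      (t ^ d) (-4) where
  a_eq := by
    rw [hu, map_pow, hde]
    ring
  b_eq := by
    rw [hu, map_neg, map_ofNat, hde]
    ring
  disc_ne_zero := by
    have hfactor : -4 * ((t ^ d) ^ 2 - 4 * -4) = -2 ^ 2 * (t ^ (2 * d) + 16) := by ring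
    rw [hfactor]
    exact ((h2.pow 2).neg.mul ht16).ne_zero
  isUnit_of_pow_dvd w hdisc _ := by
    refine isUnit_of_dvd_unit ((dvd_pow_self w (by norm_num)).trans hdisc) ?_
    have hfactor : (-4 : R) ^ 2 * ((t ^ d) ^ 2 - 4 * -4) = 2 ^ 4 * (t ^ (2 * d) + 16) := by ring
    exact hfactor ▸ (h2.pow 4).mul ht16

theorem isMinimalCubicModel_of_odd (h2 : IsUnit (2 : R)) {t : R} (ht : Prime t) {d e : ℕ}
    (hde : d = 2 * e + 1) (ht16 : IsUnit (t ^ (2 * d) + 16)) {u : Kˣ}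
    (hu : (u : K) = algebraMap R K t ^ e) :
    IsMinimalCubicModel (algebraMap R K t ^ (2 * d)) (-4 * algebraMap R K t ^ (2 * d)) u
      (t ^ (d + 1)) (-4 * t ^ 2) where
  a_eq := by
    rw [hu, map_pow, hde]
    ring
  b_eq := by
    rw [hu, map_mul, map_neg, map_ofNat, map_pow, hde]
    ring
  disc_ne_zero := by
    have hfactor : -4 * t ^ 2 * ((t ^ (d + 1)) ^ 2 - 4 * (-4 * t ^ 2)) =
        -2 ^ 2 * t ^ 4 * (t ^ (2 * d) + 16) := by ring
    rw [hfactor]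
    exact mul_ne_zero (mul_ne_zero (h2.pow 2).neg.ne_zero (pow_ne_zero 4 ht.ne_zero))
      ht16.ne_zero
  isUnit_of_pow_dvd w hdisc _ := by
    have hdvd : w ^ 12 ∣ t ^ 6 := by
      rw [← ((h2.pow 4).mul ht16).dvd_mul_left]
      convert hdisc using 1
      ring
    obtain ⟨i, -, hassoc⟩ :=
      (dvd_prime_pow ht 6).mp ((dvd_pow_self w (by norm_num)).trans hdvd)
    have hi : i * 12 ≤ 6 := by
      rw [← pow_dvd_pow_iff ht.ne_zero ht.not_isUnit, pow_mul]
      exact (hassoc.pow_pow (n := 12)).symm.dvd.trans hdvd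
    obtain rfl : i = 0 := by omega
    exact hassoc.isUnit_iff.mpr (pow_zero t ▸ isUnit_one)

theorem isMinimalCubicModel_infinite (h2 : IsUnit (2 : R)) {s : R} (hs : s ≠ 0)
    (hs16 : 1 + 16 * s ≠ 0) (hs12 : IsUnit (1 + 12 * s)) {u : Kˣ}
    (hu : (u : K) ^ 2 * algebraMap R K s = 1) :
    IsMinimalCubicModel ((u : K) ^ 2) (-4 * (u : K) ^ 2) u (1 : R) (-4 * s) where
  a_eq := by simp
  b_eq := by
    rw [map_mul, map_neg, map_ofNat]
    linear_combination (4 * (u : K) ^ 2) * hu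
  disc_ne_zero := by
    have hfactor : -4 * s * (1 ^ 2 - 4 * (-4 * s)) = -2 ^ 2 * s * (1 + 16 * s) := by ring
    rw [hfactor]
    exact mul_ne_zero (mul_ne_zero (h2.pow 2).neg.ne_zero hs) hs16
  isUnit_of_pow_dvd w _ hc₄ := by
    refine isUnit_of_dvd_unit ((dvd_pow_self w (by norm_num)).trans hc₄) ?_
    have hfactor : 1 ^ 2 - 3 * (-4 * s) = 1 + 12 * s := by ring
    exact hfactor ▸ hs12

end MinimalModels

section FinitePlace

variable {F : Type*} [Field F] {P : F[X]} (hm : P.Monic) (hi : Irreducible P)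

theorem isUnit_polyToRing_iff (h : F[X]) : IsUnit (polyToRing hm hi h) ↔ ¬ P ∣ h := by
  rw [← polyResidue_eq_zero_iff hm hi, ← IsLocalRing.residue_ne_zero_iff_isUnit]
  rfl

theorem isUnit_two_finite (h2 : (2 : F) ≠ 0) : IsUnit (2 : (Place.finite P hm hi).ring) := by
  have hunit : IsUnit (C 2 : F[X]) := isUnit_C.mpr h2.isUnit
  simpa only [map_ofNat] using hunit.map (polyToRing hm hi)

theorem polyToRing_dvd_of_not_isUnit {w : (Place.finite P hm hi).ring} (hw : ¬ IsUnit w) :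
    polyToRing hm hi P ∣ w := by
  obtain ⟨n, ⟨e, he⟩, heq⟩ := (Place.primeOf P hi).exists_primeCompl_mul_eq_of_integer
    (K := RatFunc F) (w : RatFunc F) w.2
  have hfrac : w * polyToRing hm hi e = polyToRing hm hi n := Subtype.ext heq
  have hunit : IsUnit (polyToRing hm hi e) :=
    (isUnit_polyToRing_iff hm hi e).mpr fun h => he (Ideal.mem_span_singleton.mpr h)
  rw [← hunit.dvd_mul_right, hfrac]
  refine map_dvd _ (not_not.mp fun h => hw ?_)
  rw [← isUnit_polyToRing_iff hm hi, ← hfrac] at h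
  exact isUnit_of_mul_isUnit_left h

theorem prime_polyToRing : Prime (polyToRing hm hi P) := by
  have hne : polyToRing hm hi P ≠ 0 := fun h =>
    hi.ne_zero (polyToRing_injective hm hi (h.trans (map_zero _).symm))
  rw [← Ideal.span_singleton_prime hne]
  convert (IsLocalRing.maximalIdeal.isMaximal (Place.finite P hm hi).ring).isPrime
  ext w
  rw [Ideal.mem_span_singleton, IsLocalRing.mem_maximalIdeal, mem_nonunits_iff]
  refine ⟨fun hdvd hw => ?_, polyToRing_dvd_of_not_isUnit hm hi⟩
  exact (isUnit_polyToRing_iff hm hi P).mp (isUnit_of_dvd_unit hdvd hw) dvd_rfl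

theorem exists_isMinimalCubicModel_X (h2 : (2 : F) ≠ 0) {d : ℕ} (hd : d ≠ 0) :
    ∃ (u : (RatFunc F)ˣ) (a₀ b₀ : (Place.finite (X : F[X]) monic_X irreducible_X).ring),
      IsMinimalCubicModel (RatFunc.X ^ (2 * d)) (-4 * RatFunc.X ^ (2 * d)) u a₀ b₀ ∧
      IsLocalRing.residue _ a₀ = polyResidue monic_X irreducible_X X ^ (2 * d) ∧
      IsLocalRing.residue _ b₀ = fiberCoeff d (polyResidue monic_X irreducible_X X) := by
  set t := polyToRing (F := F) monic_X irreducible_X X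
  have hres : IsLocalRing.residue _ t = 0 := (polyResidue_eq_zero_iff _ _ X).mpr dvd_rfl
  have hresX : polyResidue (F := F) monic_X irreducible_X X = 0 := hres
  have h2R := isUnit_two_finite (F := F) monic_X irreducible_X h2
  have ht16 : IsUnit (t ^ (2 * d) + 16) := by
    rw [← IsLocalRing.residue_ne_zero_iff_isUnit, map_add, map_pow, hres, zero_pow (by omega),
      zero_add, IsLocalRing.residue_ne_zero_iff_isUnit]
    convert h2R.pow 4
    norm_num
  have ht : algebraMap _ (RatFunc F) t = RatFunc.X := RatFunc.algebraMap_X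
  have hX (n : ℕ) : (RatFunc.X : RatFunc F) ^ n ≠ 0 := pow_ne_zero n RatFunc.X_ne_zero
  rw [hresX, zero_pow (by omega : 2 * d ≠ 0)]
  rcases Nat.even_or_odd' d with ⟨e, hde | hde⟩
  · have hmodel := isMinimalCubicModel_of_even h2R hde ht16
      (u := Units.mk0 _ (hX e)) (by rw [ht, Units.val_mk0])
    rw [ht] at hmodel
    refine ⟨_, _, _, hmodel, by rw [map_pow, hres, zero_pow hd], ?_⟩
    rw [fiberCoeff_zero_of_even ⟨e, by omega⟩, map_neg, map_ofNat]
  · have hmodel := isMinimalCubicModel_of_odd h2R (prime_polyToRing _ _) hde ht16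
      (u := Units.mk0 _ (hX e)) (by rw [ht, Units.val_mk0])
    rw [ht] at hmodel
    refine ⟨_, _, _, hmodel, by rw [map_pow, hres, zero_pow (by omega)], ?_⟩
    rw [fiberCoeff_of_odd ⟨e, hde⟩, map_mul, map_pow, hres, zero_pow two_ne_zero,
      zero_pow (by omega), mul_zero, mul_zero]

theorem exists_isMinimalCubicModel_finite (h2 : (2 : F) ≠ 0) {d : ℕ} (hd : d ≠ 0) :
    ∃ (u : (RatFunc F)ˣ) (a₀ b₀ : (Place.finite P hm hi).ring),
      IsMinimalCubicModel (RatFunc.X ^ (2 * d)) (-4 * RatFunc.X ^ (2 * d)) u a₀ b₀ ∧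
      IsLocalRing.residue _ a₀ = polyResidue hm hi X ^ (2 * d) ∧
      IsLocalRing.residue _ b₀ = fiberCoeff d (polyResidue hm hi X) := by
  by_cases hPX : P ∣ X
  · obtain rfl : P = X := eq_of_monic_of_associated hm monic_X
      ((hi.dvd_irreducible_iff_associated irreducible_X).mp hPX)
    exact exists_isMinimalCubicModel_X h2 hd
  set t := polyToRing hm hi X
  have hres : IsLocalRing.residue _ t = polyResidue hm hi X := rfl
  have ht : algebraMap _ (RatFunc F) t = RatFunc.X := RatFunc.algebraMap_X
  have ht16 : t ^ (2 * d) + 16 ≠ 0 := by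
    intro hzero
    have hpoly : polyToRing hm hi (X ^ (2 * d) + C 16) = 0 := by
      simpa only [map_add, map_pow, map_ofNat] using hzero
    exact (monic_X_pow_add_C 16 (by omega : 2 * d ≠ 0)).ne_zero
      (polyToRing_injective hm hi (hpoly.trans (map_zero _).symm))
  have hmodel := isMinimalCubicModel_of_isUnit (K := RatFunc F) (isUnit_two_finite hm hi h2)
    (((isUnit_polyToRing_iff hm hi X).mpr hPX).pow (2 * d)) ht16
  rw [map_pow, ht] at hmodel
  refine ⟨1, _, _, hmodel, by rw [map_pow, hres], ?_⟩
  rw [fiberCoeff_of_ne_zero d (mt (polyResidue_eq_zero_iff hm hi X).mp hPX), map_mul, map_pow,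
    hres, map_neg, map_ofNat]

theorem exists_eulerPolynomial_finite [Finite F] (h2 : (2 : F) ≠ 0) {d : ℕ} (hd : d ≠ 0)
    (L : Type*) [Field L] [IsAlgClosed L] :
    ∃ α β : L, (eulerPolynomial (curve F d) (Place.finite P hm hi)).map (Int.castRingHom L) =
      (1 - C α * X ^ P.natDegree) * (1 - C β * X ^ P.natDegree) ∧
      ∀ (K : Type*) [Field K] [Fintype K] [Algebra F K] (τ : K), aeval τ P = 0 →
        (fiberTrace d τ : L) =
          α ^ (Module.finrank F K / P.natDegree) + β ^ (Module.finrank F K / P.natDegree) := by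
  have := finite_residueField hm hi
  let _ : Fintype (IsLocalRing.ResidueField (Place.finite P hm hi).ring) := Fintype.ofFinite _
  obtain ⟨u, a₀, b₀, hmodel, ha₀, hb₀⟩ := exists_isMinimalCubicModel_finite hm hi h2 hd
  have h2R := isUnit_two_finite hm hi h2
  obtain ⟨α, β, hadd, hmul, hext⟩ := exists_cubicTrace_extension L
    (ringChar_residueField_ne_two h2R) (IsLocalRing.residue _ a₀) (IsLocalRing.residue _ b₀)
  refine ⟨α, β, map_eulerPolynomial_cubic _ h2R hmodel hadd hmul, fun K _ _ _ τ hτ => ?_⟩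
  let _ : Algebra (IsLocalRing.ResidueField (Place.finite P hm hi).ring) K :=
    (residueLift hm hi hτ).toAlgebra
  have htrace := hext K
  rwa [RingHom.algebraMap_toAlgebra, ha₀, hb₀, map_pow, map_fiberCoeff, residueLift_polyResidue,
    aeval_X, finrank_residueField] at htrace

end FinitePlace

section InfinitePlace

variable {F : Type*} [Field F]

theorem eulerPolynomial_infinite [Finite F] (h2 : (2 : F) ≠ 0) {d : ℕ} (hd : d ≠ 0)
    (L : Type*) [Field L] : (eulerPolynomial (curve F d) Place.infinite).map (Int.castRingHom L) =
      (1 - C 1 * X) * (1 - C 0 * X) := by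
  set R := (Place.infinite : Place F).ring
  have : Finite (IsLocalRing.ResidueField R) :=
    Finite.of_surjective _ residue_constToRing_surjective
  let _ : Fintype (IsLocalRing.ResidueField R) := Fintype.ofFinite _
  have h2R : IsUnit (2 : R) := map_ofNat (constToRing (F := F)) 2 ▸ h2.isUnit.map constToRing
  have hres : IsLocalRing.residue R (invX ^ (2 * d)) = 0 := by
    rw [map_pow, residue_invX, zero_pow (by omega)]
  have hunit (n : R) : IsUnit (1 + n * invX ^ (2 * d)) := by
    rw [← IsLocalRing.residue_ne_zero_iff_isUnit, map_add, map_mul, hres, mul_zero, add_zero,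
      map_one]
    exact one_ne_zero
  have hX : (RatFunc.X : RatFunc F) ^ d ≠ 0 := pow_ne_zero d RatFunc.X_ne_zero
  have hinvX : algebraMap R (RatFunc F) invX = RatFunc.X⁻¹ := rfl
  have hmodel : IsMinimalCubicModel (RatFunc.X ^ (2 * d)) (-4 * RatFunc.X ^ (2 * d))
      (Units.mk0 _ hX) (1 : R) (-4 * invX ^ (2 * d)) := by
    have hsq : (RatFunc.X : RatFunc F) ^ (2 * d) = (Units.mk0 _ hX : RatFunc F) ^ 2 := by
      rw [Units.val_mk0, mul_comm, pow_mul]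
    rw [hsq]
    refine isMinimalCubicModel_infinite h2R (pow_ne_zero _ fun h => ?_) (hunit 16).ne_zero
      (hunit 12) ?_
    · exact inv_ne_zero RatFunc.X_ne_zero (congrArg Subtype.val h)
    · rw [← hsq, map_pow, hinvX, ← mul_pow, mul_inv_cancel₀ RatFunc.X_ne_zero, one_pow]
  have hb₀ : IsLocalRing.residue R (-4 * invX ^ (2 * d)) = 0 := by rw [map_mul, hres, mul_zero]
  have hfactor := map_eulerPolynomial_cubic Place.infinite h2R hmodel (L := L) (α := 1) (β := 0)
    (by rw [hb₀, cubicTrace_zero_right (ringChar_residueField_ne_two h2R), map_one]; simp)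
    (by rw [hb₀]; simp)
  rwa [Place.degree, pow_one] at hfactor

end InfinitePlace

/-! ### Characters of a finite field indexed by `ℤ / D` -/

section IndexedChar

variable {K : Type*} [Field K] {L : Type*} [Field L]

/-- The character `x ↦ ω(x) ^ (N n / D)`, where `N` is meant to be the order of `Kˣ`. The natural
number division is exact only when `N n = 0` in `ℤ / D`. -/
def indexedChar (ω : Kˣ →* Lˣ) (N D : ℕ) (n : ZMod D) : MulChar K L :=
  MulChar.ofUnitHom (ω ^ (N * n.val / D))

variable {ω : Kˣ →* Lˣ} {N D : ℕ}

theorem unitHom_pow_eq_one (hN : Nat.card Kˣ = N) (x : Kˣ) : ω x ^ N = 1 := by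
  rw [← map_pow, ← hN, pow_card_eq_one', map_one]

theorem indexedChar_apply (n : ZMod D) (x : Kˣ) :
    indexedChar ω N D n x = ((ω x ^ (N * n.val / D) : Lˣ) : L) := by
  rw [indexedChar, MulChar.ofUnitHom_coe]
  rfl

theorem dvd_mul_iff_cast (a : ℕ) : D ∣ N * a ↔ (N : ZMod D) * (a : ZMod D) = 0 := by
  rw [← Nat.cast_mul, ZMod.natCast_eq_zero_iff]

theorem indexedChar_zero : indexedChar ω N D 0 = 1 := by
  ext x
  rw [indexedChar_apply, ZMod.val_zero, mul_zero, Nat.zero_div, pow_zero, MulChar.one_apply_coe,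
    Units.val_one]

variable [NeZero D]

theorem dvd_mul_val_iff (n : ZMod D) : D ∣ N * n.val ↔ (N : ZMod D) * n = 0 := by
  rw [dvd_mul_iff_cast, ZMod.natCast_zmod_val]

theorem indexedChar_natCast_apply (hN : Nat.card Kˣ = N) (a : ℕ) (x : Kˣ) :
    indexedChar ω N D (a : ZMod D) x = ((ω x ^ (N * a / D) : Lˣ) : L) := by
  have hdivMod : N * a = N * (a % D) + D * (N * (a / D)) := by
    conv_lhs => rw [← Nat.mod_add_div a D]
    ring
  rw [indexedChar_apply, ZMod.val_natCast, hdivMod,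
    Nat.add_mul_div_left _ _ (NeZero.pos D), pow_add, pow_mul,
    unitHom_pow_eq_one hN, one_pow, mul_one]

theorem indexedChar_add (hN : Nat.card Kˣ = N) {m : ZMod D} (hm : (N : ZMod D) * m = 0)
    (n : ZMod D) :
    indexedChar ω N D (m + n) = indexedChar ω N D m * indexedChar ω N D n := by
  rw [← dvd_mul_val_iff] at hm
  ext x
  have hval : m + n = ((m.val + n.val : ℕ) : ZMod D) := by simp
  rw [hval, indexedChar_natCast_apply hN, MulChar.mul_apply,
    indexedChar_apply, indexedChar_apply, mul_add, Nat.add_div_of_dvd_right hm, pow_add,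
    Units.val_mul]

theorem indexedChar_neg (hN : Nat.card Kˣ = N) {n : ZMod D} (hn : (N : ZMod D) * n = 0) :
    indexedChar ω N D (-n) = (indexedChar ω N D n)⁻¹ := by
  rw [eq_inv_iff_mul_eq_one, ← indexedChar_add hN (by rw [mul_neg, hn, neg_zero]),
    neg_add_cancel, indexedChar_zero]

theorem indexedChar_natCast_mul (hN : Nat.card Kˣ = N) (a : ℕ) {n : ZMod D}
    (hn : (N : ZMod D) * n = 0) :
    indexedChar ω N D (a * n) = indexedChar ω N D n ^ a := by
  induction a with
  | zero => rw [Nat.cast_zero, zero_mul, indexedChar_zero, pow_zero]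
  | succ a ih => rw [Nat.cast_succ, add_one_mul, add_comm, indexedChar_add hN hn, ih, pow_succ']

theorem indexedChar_apply_norm {k : Type*} [Field k] [Algebra k K] [Finite K] {ψ : kˣ →* Lˣ}
    {M : ℕ} (hN : Nat.card Kˣ = N) (hM : Nat.card kˣ = M)
    (hωψ : ∀ u : kˣ, ω (Units.map (algebraMap k K : k →* K) u) = ψ u) {n : ZMod D}
    (hn : (M : ZMod D) * n = 0) (x : K) :
    indexedChar ω N D n x = indexedChar ψ M D n (Algebra.norm k x) := by
  have : Finite k := Finite.of_injective _ (algebraMap k K).injective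
  obtain rfl | hx := eq_or_ne x 0
  · rw [Algebra.norm_zero, MulChar.map_zero, MulChar.map_zero]
  lift x to Kˣ using hx.isUnit
  obtain ⟨y, hy⟩ : ∃ y : kˣ, (y : k) = Algebra.norm k (x : K) :=
    ⟨Units.mk0 _ (Algebra.norm_ne_zero_iff.mpr hx), rfl⟩
  obtain ⟨r, hr⟩ : M ∣ N := by
    rw [← hN, ← hM]
    exact Subgroup.card_dvd_of_injective (Units.map (algebraMap k K : k →* K))
      (Units.map_injective (algebraMap k K).injective)
  have hNr : (Nat.card K - 1) / (Nat.card k - 1) = r := by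
    rw [← Nat.card_units, ← Nat.card_units, hN, hM, hr,
      Nat.mul_div_cancel_left _ (hM ▸ Nat.card_pos)]
  have hnorm : ψ y = ω x ^ r := by
    rw [← hωψ, ← map_pow]
    congr 1
    ext
    rw [Units.coe_map, MonoidHom.coe_coe, hy, FiniteField.algebraMap_norm_eq_pow,
      hNr, Units.val_pow_eq_pow_val]
  have hexp : N * n.val / D = r * (M * n.val / D) := by
    rw [hr, mul_comm M, mul_assoc, Nat.mul_div_assoc _ ((dvd_mul_val_iff n).mpr hn)]
  rw [← hy, indexedChar_apply, indexedChar_apply, hnorm, hexp, pow_mul]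

variable [Finite K]

theorem indexedChar_ne_one (hω : Function.Injective ω) (hN : Nat.card Kˣ = N) {n : ZMod D}
    (hn : (N : ZMod D) * n = 0) (hn0 : n ≠ 0) : indexedChar ω N D n ≠ 1 := by
  intro hone
  obtain ⟨g, hg⟩ := IsCyclic.exists_ofOrder_eq_natCard (α := Kˣ)
  obtain ⟨c, hc⟩ := dvd_mul_val_iff n |>.mpr hn
  have hNpos : 0 < N := hN ▸ Nat.card_pos
  have hNc : N ∣ c := by
    have hval := congrArg (fun χ : MulChar K L => χ g) hone
    simp only [indexedChar_apply, MulChar.one_apply_coe, Units.val_eq_one, ← map_pow] at hval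
    rwa [map_eq_one_iff ω hω, ← orderOf_dvd_iff_pow_eq_one, hg, hN, hc,
      Nat.mul_div_cancel_left _ (NeZero.pos D)] at hval
  have hDn : D ∣ n.val := by
    obtain ⟨b, rfl⟩ := hNc
    exact ⟨b, Nat.eq_of_mul_eq_mul_left hNpos (by rw [hc]; ring)⟩
  exact hn0 ((ZMod.val_eq_zero n).mp (Nat.eq_zero_of_dvd_of_lt hDn (ZMod.val_lt n)))

theorem card_pow_eq_one (hN : Nat.card Kˣ = N) :
    Nat.card {x : Kˣ // x ^ D = 1} = Nat.card {n : ZMod D // (N : ZMod D) * n = 0} := by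
  have hroots : Nat.card {x : Kˣ // x ^ D = 1} = N.gcd D := by
    rw [← hN, ← IsCyclic.card_powMonoidHom_ker Kˣ D]
    exact Nat.card_congr (Equiv.subtypeEquivRight fun n => by
      rw [MonoidHom.mem_ker, powMonoidHom_apply])
  have hindices : Nat.card {n : ZMod D // (N : ZMod D) * n = 0} = D.gcd N := by
    conv_rhs => rw [← Nat.card_zmod D]
    rw [← IsAddCyclic.card_nsmulAddMonoidHom_ker (ZMod D) N]
    exact Nat.card_congr (Equiv.subtypeEquivRight fun n => by
      rw [AddMonoidHom.mem_ker, nsmulAddMonoidHom_apply, nsmul_eq_mul])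
  rw [hroots, hindices, Nat.gcd_comm]

theorem exists_pow_eq_of_pow_eq_one {G : Type*} [CommGroup G] [IsCyclic G] [Finite G] (m : ℕ)
    {s : G} (hs : s ^ (Nat.card G / (Nat.card G).gcd m) = 1) : ∃ x : G, x ^ m = s := by
  set r := Nat.card G / (Nat.card G).gcd m with hr
  have hle : (powMonoidHom m : G →* G).range ≤ (powMonoidHom r).ker := by
    rintro _ ⟨x, rfl⟩
    obtain ⟨c, hc⟩ := Nat.gcd_dvd_right (Nat.card G) m
    have hmr : m * r = Nat.card G * c := by
      calc m * r = (Nat.card G).gcd m * c * r := by rw [← hc]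
        _ = (Nat.card G).gcd m * r * c := mul_right_comm _ _ _
        _ = Nat.card G * c := by rw [hr, Nat.mul_div_cancel' (Nat.gcd_dvd_left _ _)]
    rw [MonoidHom.mem_ker, powMonoidHom_apply, powMonoidHom_apply, ← pow_mul, hmr, pow_mul,
      pow_card_eq_one', one_pow]
  have hcard : Nat.card (powMonoidHom r : G →* G).ker ≤
      Nat.card (powMonoidHom m : G →* G).range := by
    rw [IsCyclic.card_powMonoidHom_ker, IsCyclic.card_powMonoidHom_range, ← hr]
    exact Nat.gcd_le_right _ (Nat.div_pos (Nat.gcd_le_left _ Nat.card_pos)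
      (Nat.gcd_pos_of_pos_left _ Nat.card_pos))
  exact (Subgroup.eq_of_le_of_card_ge hle hcard).ge (MonoidHom.mem_ker.mpr hs)

theorem exists_indexedChar_ne_one (hω : Function.Injective ω) (hN : Nat.card Kˣ = N) {s : Kˣ}
    (hs : ∀ x : Kˣ, x ^ D ≠ s) :
    ∃ n : ZMod D, (N : ZMod D) * n = 0 ∧ indexedChar ω N D n s ≠ 1 := by
  have hcross : N * (D / N.gcd D) = D * (N / N.gcd D) := by
    rw [← Nat.mul_div_assoc _ (Nat.gcd_dvd_right N D), mul_comm N D,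
      Nat.mul_div_assoc _ (Nat.gcd_dvd_left N D)]
  refine ⟨((D / N.gcd D : ℕ) : ZMod D), (dvd_mul_iff_cast _).mp (hcross ▸ dvd_mul_right _ _), ?_⟩
  rw [indexedChar_natCast_apply hN, hcross, Nat.mul_div_cancel_left _ (NeZero.pos D), Ne,
    Units.val_eq_one, ← map_pow, map_eq_one_iff ω hω]
  intro hpow
  obtain ⟨x, hx⟩ := exists_pow_eq_of_pow_eq_one D (hN.symm ▸ hpow)
  exact hs x hx

variable [Fintype K]

open Classical in
theorem sum_indexedChar_pow (hN : Nat.card Kˣ = N) (y : Kˣ) :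
    ∑ n : ZMod D with (N : ZMod D) * n = 0, indexedChar ω N D n ((y ^ D : Kˣ) : K) =
      (Finset.univ.filter fun x : Kˣ => x ^ D = y ^ D).card := by
  have hone : ∀ n ∈ Finset.univ.filter (fun n : ZMod D => (N : ZMod D) * n = 0),
      indexedChar ω N D n ((y ^ D : Kˣ) : K) = 1 := by
    intro n hn
    have hdvd : D ∣ N * n.val := (dvd_mul_val_iff n).mpr (Finset.mem_filter.mp hn).2
    rw [indexedChar_apply, map_pow, ← pow_mul, Nat.mul_div_cancel' hdvd, pow_mul,
      unitHom_pow_eq_one hN, one_pow, Units.val_one]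
  have hcard : (Finset.univ.filter fun n : ZMod D => (N : ZMod D) * n = 0).card =
      (Finset.univ.filter fun x : Kˣ => x ^ D = 1).card := by
    simpa only [Nat.card_eq_fintype_card, Fintype.card_subtype] using
      (card_pow_eq_one (K := K) (D := D) hN).symm
  rw [Finset.sum_congr rfl hone, Finset.sum_const, nsmul_eq_mul, mul_one, hcard]
  congr 1
  exact Finset.card_equiv (Equiv.mulLeft y) fun x => by simp [mul_pow]

open Classical in
theorem sum_indexedChar (hω : Function.Injective ω) (hN : Nat.card Kˣ = N) (s : Kˣ) :
    ∑ n : ZMod D with (N : ZMod D) * n = 0, indexedChar ω N D n s =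
      (Finset.univ.filter fun x : Kˣ => x ^ D = s).card := by
  by_cases hs : ∃ y : Kˣ, y ^ D = s
  · obtain ⟨y, rfl⟩ := hs
    exact sum_indexedChar_pow hN y
  · push Not at hs
    obtain ⟨m, hm, hms⟩ := exists_indexedChar_ne_one hω hN hs
    rw [Finset.filter_false_of_mem fun x _ => hs x, Finset.card_empty, Nat.cast_zero]
    have hshift : indexedChar ω N D m s *
        ∑ n : ZMod D with (N : ZMod D) * n = 0, indexedChar ω N D n s =
          ∑ n : ZMod D with (N : ZMod D) * n = 0, indexedChar ω N D n s := by
      rw [Finset.mul_sum]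
      refine Finset.sum_equiv (Equiv.addLeft m) (fun n => ?_) fun n _ => ?_
      · simp [mul_add, hm]
      · rw [Equiv.coe_addLeft, indexedChar_add hN hm, MulChar.mul_apply]
    exact (mul_left_eq_self₀.mp hshift).resolve_left hms

end IndexedChar

/-! ### The sum of the traces of the fibres -/

section IndexSetSum

variable {N : ℕ} {M : Type*} [AddCommMonoid M]

theorem natCast_ne_of_lt {D a b : ℕ} (ha : a < b) (hb : b < D) : (a : ZMod D) ≠ b := by
  rw [Ne, ZMod.natCast_eq_natCast_iff', Nat.mod_eq_of_lt (ha.trans hb), Nat.mod_eq_of_lt hb]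
  exact ha.ne

theorem natCast_ne_zero_of_lt {D a : ℕ} (ha : 0 < a) (haD : a < D) : (a : ZMod D) ≠ 0 := by
  simpa only [Nat.cast_zero] using (natCast_ne_of_lt ha haD).symm

theorem mul_natCast_half_eq_zero (hN : 2 ∣ N) (d : ℕ) :
    (N : ZMod (2 * d)) * (d : ZMod (2 * d)) = 0 :=
  (dvd_mul_iff_cast d).mp (mul_dvd_mul_right hN d)

theorem mem_indexSet_of_odd {d : ℕ} (hd : Odd d) {n : ZMod (2 * d)} :
    n ∈ indexSet d ↔ n ≠ 0 ∧ n ≠ d := by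
  rw [indexSet, if_neg (Nat.not_even_iff_odd.mpr hd)]
  simp

theorem mem_indexSet_two_mul {e : ℕ} {n : ZMod (2 * (2 * e))} :
    n ∈ indexSet (2 * e) ↔
      n ≠ 0 ∧ n ≠ e ∧ n ≠ ((2 * e : ℕ) : ZMod (2 * (2 * e))) ∧
        n ≠ ((3 * e : ℕ) : ZMod (2 * (2 * e))) := by
  rw [indexSet, if_pos (even_two_mul e), Nat.mul_div_cancel_left e two_pos]
  simp only [Set.mem_compl_iff, Set.mem_insert_iff, Set.mem_singleton_iff, not_or]

theorem mul_natCast_odd_mul_eq_zero_iff {e : ℕ} [NeZero e] {c : ℕ} (hc : Odd c) :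
    (N : ZMod (2 * (2 * e))) * ((c * e : ℕ) : ZMod (2 * (2 * e))) = 0 ↔ 4 ∣ N := by
  have hcop : Nat.Coprime 4 c := Nat.Coprime.pow_left 2 (Nat.coprime_two_left.mpr hc)
  rw [← dvd_mul_iff_cast, ← mul_assoc 2, ← mul_assoc N, Nat.mul_dvd_mul_iff_right (NeZero.pos e)]
  exact ⟨hcop.dvd_of_dvd_mul_right, fun h => h.mul_right c⟩

open Classical in
theorem sum_indexSet_of_odd (hN : 2 ∣ N) {d : ℕ} (hd : Odd d) [NeZero d]
    (f : ZMod (2 * d) → M) :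
    ∑ n with (N : ZMod (2 * d)) * n = 0 ∧ n ≠ 0, f n =
      f d + ∑ n with (N : ZMod (2 * d)) * n = 0 ∧ n ∈ indexSet d, f n := by
  have hdpos := NeZero.pos d
  have hd0 : (d : ZMod (2 * d)) ≠ 0 := natCast_ne_zero_of_lt hdpos (by omega)
  have hdN := mul_natCast_half_eq_zero hN d
  rw [← Finset.add_sum_erase _ _ (a := (d : ZMod (2 * d))) (by simp [hd0, hdN])]
  congr 2
  ext n
  simp only [Finset.mem_erase, Finset.mem_filter, Finset.mem_univ, true_and,
    mem_indexSet_of_odd hd]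
  tauto

open Classical in
theorem sum_indexSet_of_not_four_dvd (hN : 2 ∣ N) (hN4 : ¬4 ∣ N) {e : ℕ} [NeZero e]
    (f : ZMod (2 * (2 * e)) → M) :
    ∑ n with (N : ZMod (2 * (2 * e))) * n = 0 ∧ n ≠ 0, f n =
      f ((2 * e : ℕ) : ZMod (2 * (2 * e))) +
        ∑ n with (N : ZMod (2 * (2 * e))) * n = 0 ∧ n ∈ indexSet (2 * e), f n := by
  have hepos := NeZero.pos e
  have hd0 : ((2 * e : ℕ) : ZMod (2 * (2 * e))) ≠ 0 :=
    natCast_ne_zero_of_lt (by omega) (by omega)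
  have hdN := mul_natCast_half_eq_zero hN (2 * e)
  have hquarter {c : ℕ} (hc : Odd c) {n : ZMod (2 * (2 * e))}
      (hn : (N : ZMod (2 * (2 * e))) * n = 0) : n ≠ ((c * e : ℕ) : ZMod (2 * (2 * e))) := by
    rintro rfl
    exact hN4 ((mul_natCast_odd_mul_eq_zero_iff hc).mp hn)
  rw [← Finset.add_sum_erase _ _ (a := ((2 * e : ℕ) : ZMod (2 * (2 * e))))
    (Finset.mem_filter.mpr ⟨Finset.mem_univ _, hdN, hd0⟩)]
  congr 2
  ext n
  simp only [Finset.mem_erase, Finset.mem_filter, Finset.mem_univ, true_and, mem_indexSet_two_mul]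
  refine ⟨fun ⟨hnd, hnN, hn0⟩ => ⟨hnN, hn0, ?_, hnd, hquarter (by decide) hnN⟩,
    fun ⟨hnN, hn0, _, hnd, _⟩ => ⟨hnd, hnN, hn0⟩⟩
  simpa only [one_mul] using hquarter odd_one hnN

open Classical in
theorem sum_indexSet_of_four_dvd (hN4 : 4 ∣ N) {e : ℕ} [NeZero e]
    (f : ZMod (2 * (2 * e)) → M) :
    ∑ n with (N : ZMod (2 * (2 * e))) * n = 0 ∧ n ≠ 0, f n =
      f ((2 * e : ℕ) : ZMod (2 * (2 * e))) +
        (f e + (f ((3 * e : ℕ) : ZMod (2 * (2 * e))) +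
          ∑ n with (N : ZMod (2 * (2 * e))) * n = 0 ∧ n ∈ indexSet (2 * e), f n)) := by
  have hepos := NeZero.pos e
  have hdN := mul_natCast_half_eq_zero (dvd_trans (by decide) hN4) (2 * e)
  have heN := (mul_natCast_odd_mul_eq_zero_iff (e := e) odd_one).mpr hN4
  have h3eN := (mul_natCast_odd_mul_eq_zero_iff (e := e) (c := 3) (by decide)).mpr hN4
  rw [one_mul] at heN
  have hd0 : ((2 * e : ℕ) : ZMod (2 * (2 * e))) ≠ 0 :=
    natCast_ne_zero_of_lt (by omega) (by omega)
  have he0 : (e : ZMod (2 * (2 * e))) ≠ 0 := natCast_ne_zero_of_lt hepos (by omega)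
  have h3e0 : ((3 * e : ℕ) : ZMod (2 * (2 * e))) ≠ 0 :=
    natCast_ne_zero_of_lt (by omega) (by omega)
  have hed : (e : ZMod (2 * (2 * e))) ≠ ((2 * e : ℕ) : ZMod (2 * (2 * e))) :=
    natCast_ne_of_lt (by omega) (by omega)
  have hd3e : ((2 * e : ℕ) : ZMod (2 * (2 * e))) ≠ ((3 * e : ℕ) : ZMod (2 * (2 * e))) :=
    natCast_ne_of_lt (by omega) (by omega)
  have he3e : (e : ZMod (2 * (2 * e))) ≠ ((3 * e : ℕ) : ZMod (2 * (2 * e))) :=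
    natCast_ne_of_lt (by omega) (by omega)
  have hfilter : (Finset.univ.filter fun n : ZMod (2 * (2 * e)) =>
      (N : ZMod (2 * (2 * e))) * n = 0 ∧ n ≠ 0) =
      insert ((2 * e : ℕ) : ZMod (2 * (2 * e))) (insert (e : ZMod (2 * (2 * e)))
        (insert ((3 * e : ℕ) : ZMod (2 * (2 * e)))
          (Finset.univ.filter fun n =>
            (N : ZMod (2 * (2 * e))) * n = 0 ∧ n ∈ indexSet (2 * e)))) := by
    ext n
    simp only [Finset.mem_insert, Finset.mem_filter, Finset.mem_univ, true_and,
      mem_indexSet_two_mul]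
    refine ⟨fun hn => by tauto, ?_⟩
    rintro (rfl | rfl | rfl | hn)
    exacts [⟨hdN, hd0⟩, ⟨heN, he0⟩, ⟨h3eN, h3e0⟩, ⟨hn.1, hn.2.1⟩]
  rw [hfilter, Finset.sum_insert, Finset.sum_insert, Finset.sum_insert] <;>
    simp only [Finset.mem_insert, Finset.mem_filter, mem_indexSet_two_mul] <;> tauto

end IndexSetSum

section FiberSum

variable {K : Type*} [Field K] {L : Type*} [Field L] {ω : Kˣ →* Lˣ} {N : ℕ}

theorem sum_eq_add_sum_units [Fintype K] {M : Type*} [AddCommMonoid M] [Fintype Kˣ] (f : K → M) :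
    ∑ x, f x = f 0 + ∑ x : Kˣ, f x := by
  classical
  rw [← Finset.add_sum_erase _ _ (Finset.mem_univ (0 : K))]
  congr 1
  symm
  exact Finset.sum_bij (fun x _ => (x : K)) (fun x _ => by simp) (fun _ _ _ _ h => Units.ext h)
    (fun x hx => ⟨Units.mk0 x (Finset.ne_of_mem_erase hx), Finset.mem_univ _, rfl⟩)
    fun _ _ => rfl

theorem card_eq_succ [Fintype K] (hN : Nat.card Kˣ = N) : Fintype.card K = N + 1 := by
  have hunits := Nat.card_units K
  have hone := Finite.one_lt_card (α := K)
  rw [← Nat.card_eq_fintype_card]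
  omega

theorem two_dvd_card_units [Finite K] (hK : ringChar K ≠ 2) (hN : Nat.card Kˣ = N) : 2 ∣ N := by
  have := Fintype.ofFinite K
  have hodd := FiniteField.odd_card_of_char_ne_two hK
  rw [card_eq_succ hN] at hodd
  omega

variable [Fintype K]

theorem unitHom_pow_half (hK : ringChar K ≠ 2) (hω : Function.Injective ω) {M : ℕ}
    (hM : Nat.card Kˣ = 2 * M) (x : Kˣ) : ((ω x ^ M : Lˣ) : L) = quadChar K L x := by
  classical
  have hhalf : Fintype.card K / 2 = M := by
    rw [card_eq_succ hM]
    omega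
  have hsquare : IsSquare (x : K) ↔ x ^ M = 1 := by
    rw [FiniteField.isSquare_iff hK x.ne_zero, hhalf, ← Units.val_pow_eq_pow_val, Units.val_eq_one]
  rw [quadChar_apply]
  by_cases hx : x ^ M = 1
  · rw [(quadraticChar_one_iff_isSquare x.ne_zero).mpr (hsquare.mpr hx), ← map_pow, hx, map_one,
      Units.val_one, Int.cast_one]
  · have hsq : ((ω x ^ M : Lˣ) : L) * ((ω x ^ M : Lˣ) : L) = 1 := by
      rw [← Units.val_mul, ← sq, ← pow_mul, mul_comm M, unitHom_pow_eq_one hM, Units.val_one]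
    have hne : ((ω x ^ M : Lˣ) : L) ≠ 1 := by
      rwa [Ne, Units.val_eq_one, ← map_pow, map_eq_one_iff ω hω]
    rw [quadraticChar_neg_one_iff_not_isSquare.mpr (mt hsquare.mp hx),
      (mul_self_eq_one_iff.mp hsq).resolve_left hne, Int.cast_neg, Int.cast_one]

theorem indexedChar_half (hK : ringChar K ≠ 2) (hω : Function.Injective ω)
    (hN : Nat.card Kˣ = N) {d : ℕ} [NeZero d] :
    indexedChar ω N (2 * d) (d : ZMod (2 * d)) = quadChar K L := by
  obtain ⟨M, rfl⟩ := two_dvd_card_units hK hN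
  ext x
  rw [indexedChar_natCast_apply hN, mul_right_comm, Nat.mul_div_cancel_left _ (NeZero.pos _),
    unitHom_pow_half hK hω hN]

variable [CharZero L]

/-- Both exceptional indices `d / 2` and `3 d / 2` contribute a character of order `4` to the fibre
at `t = 0`, where the reduction is `y ^ 2 = x (x ^ 2 - 4)`. -/
theorem cubicTrace_zero_neg_four_eq_indexedChar (hK : ringChar K ≠ 2) (hω : Function.Injective ω)
    (hN : Nat.card Kˣ = N) (hN4 : 4 ∣ N) {e : ℕ} [NeZero e] :
    (cubicTrace (0 : K) (-4) : L) =
      jacobiProduct (indexedChar ω N (2 * (2 * e)) e) +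
        jacobiProduct (indexedChar ω N (2 * (2 * e)) ((3 * e : ℕ) : ZMod (2 * (2 * e)))) := by
  have heN := (mul_natCast_odd_mul_eq_zero_iff (e := e) odd_one).mpr hN4
  rw [one_mul] at heN
  have hsq : indexedChar ω N (2 * (2 * e)) e ^ 2 = quadChar K L := by
    rw [sq, ← indexedChar_add hN heN, ← indexedChar_half hK hω hN (d := 2 * e), ← Nat.cast_add,
      two_mul e]
  have hneg : -(e : ZMod (2 * (2 * e))) = ((3 * e : ℕ) : ZMod (2 * (2 * e))) := by
    rw [neg_eq_iff_add_eq_zero, ← Nat.cast_add, ZMod.natCast_eq_zero_iff]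
    exact ⟨1, by ring⟩
  rw [cubicTrace_zero_neg_four hK hsq, ← indexedChar_neg hN heN, hneg]

open Classical in
theorem sum_units_mul_cubicTrace (hK : ringChar K ≠ 2) (χ : MulChar K L) :
    ∑ s : Kˣ, χ s * (cubicTrace (s : K) (-4 * s) : L) =
      if χ = 1 then -(Fintype.card K : L) else -jacobiProduct χ := by
  split_ifs with hχ
  · rw [← sum_cubicTrace hK, sum_eq_add_sum_units (K := K), mul_zero, cubicTrace_zero_right hK,
      quadraticChar_zero, Int.cast_zero, zero_add]
    simp only [hχ, MulChar.one_apply_coe, one_mul]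
  · rw [← sum_mul_cubicTrace hK hχ, sum_eq_add_sum_units (K := K), MulChar.map_zero,
      zero_mul, zero_add]

open Classical in
theorem sum_units_fiberTrace (hK : ringChar K ≠ 2) (hω : Function.Injective ω)
    (hN : Nat.card Kˣ = N) {d : ℕ} [NeZero d] :
    ∑ τ : Kˣ, (fiberTrace d (τ : K) : L) =
      -(Fintype.card K : L) - ∑ n : ZMod (2 * d) with (N : ZMod (2 * d)) * n = 0 ∧ n ≠ 0,
        jacobiProduct (indexedChar ω N (2 * d) n) := by
  have hfiber (s : Kˣ) : ∑ τ : Kˣ with τ ^ (2 * d) = s, (fiberTrace d (τ : K) : L) =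
      ∑ n : ZMod (2 * d) with (N : ZMod (2 * d)) * n = 0,
        indexedChar ω N (2 * d) n s * (cubicTrace (s : K) (-4 * s) : L) := by
    rw [← Finset.sum_mul, sum_indexedChar hω hN, ← nsmul_eq_mul, ← Finset.sum_const]
    refine Finset.sum_congr rfl fun τ hτ => ?_
    rw [← (Finset.mem_filter.mp hτ).2, fiberTrace, fiberCoeff_of_ne_zero d τ.ne_zero,
      Units.val_pow_eq_pow_val]
  calc ∑ τ : Kˣ, (fiberTrace d (τ : K) : L)
    _ = ∑ n : ZMod (2 * d) with (N : ZMod (2 * d)) * n = 0,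
          ∑ s : Kˣ, indexedChar ω N (2 * d) n s * (cubicTrace (s : K) (-4 * s) : L) := by
        rw [← Finset.sum_fiberwise Finset.univ fun τ : Kˣ => τ ^ (2 * d),
          Finset.sum_congr rfl fun s _ => hfiber s, Finset.sum_comm]
    _ = -(Fintype.card K : L) + ∑ n : ZMod (2 * d) with (N : ZMod (2 * d)) * n = 0 ∧ n ≠ 0,
          -jacobiProduct (indexedChar ω N (2 * d) n) := by
        rw [← Finset.add_sum_erase _ _ (a := 0) (by simp), indexedChar_zero,
          sum_units_mul_cubicTrace hK, if_pos rfl]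
        congr 1
        refine Finset.sum_congr (by ext; simp [and_comm]) fun n hn => ?_
        obtain ⟨-, hnN, hn0⟩ := Finset.mem_filter.mp hn
        rw [sum_units_mul_cubicTrace hK, if_neg (indexedChar_ne_one hω hN hnN hn0)]
    _ = _ := by rw [Finset.sum_neg_distrib, sub_eq_add_neg]

open Classical in
theorem sum_fiberTrace (hK : ringChar K ≠ 2) (hω : Function.Injective ω)
    (hN : Nat.card Kˣ = N) {d : ℕ} [NeZero d] :
    ∑ τ : K, (fiberTrace d τ : L) =
      -(Fintype.card K : L) - 1 -
        ∑ n : ZMod (2 * d) with (N : ZMod (2 * d)) * n = 0 ∧ n ∈ indexSet d,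
          jacobiProduct (indexedChar ω N (2 * d) n) := by
  have h2N := two_dvd_card_units hK hN
  have hzero : fiberTrace d (0 : K) = cubicTrace 0 (fiberCoeff d (0 : K)) := by
    rw [fiberTrace, zero_pow (NeZero.ne _)]
  rw [sum_eq_add_sum_units, sum_units_fiberTrace hK hω hN, hzero]
  rcases d.even_or_odd with heven | hodd
  · rw [fiberCoeff_zero_of_even heven]
    obtain ⟨e, rfl⟩ := heven.two_dvd
    have : NeZero e := ⟨right_ne_zero_of_mul (NeZero.ne (2 * e))⟩
    by_cases hN4 : 4 ∣ N
    · rw [sum_indexSet_of_four_dvd hN4, indexedChar_half hK hω hN, jacobiProduct_quadChar hK,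
        cubicTrace_zero_neg_four_eq_indexedChar hK hω hN hN4 (e := e)]
      ring
    · have hcard : Fintype.card K % 4 = 3 := by
        rw [card_eq_succ hN]
        omega
      rw [sum_indexSet_of_not_four_dvd h2N hN4, indexedChar_half hK hω hN,
        jacobiProduct_quadChar hK, cubicTrace_zero_left hcard, Int.cast_zero]
      ring
  · rw [sum_indexSet_of_odd h2N hodd, indexedChar_half hK hω hN, jacobiProduct_quadChar hK,
      fiberCoeff_of_odd hodd, zero_pow (NeZero.ne _), mul_zero, cubicTrace_zero_right hK,
      quadraticChar_zero, Int.cast_zero]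
    ring

end FiberSum

/-! ### Orbits of multiplication by `q` -/

section OrbitLength

variable {q D : ℕ}

theorem iterate_mul_apply (n : ZMod D) (j : ℕ) :
    (fun x : ZMod D => (q : ZMod D) * x)^[j] n = (q : ZMod D) ^ j * n := by
  rw [mul_left_iterate]

theorem isPeriodicPt_iff (n : ZMod D) (m : ℕ) :
    Function.IsPeriodicPt (fun x : ZMod D => (q : ZMod D) * x) m n ↔ (q : ZMod D) ^ m * n = n := by
  rw [Function.IsPeriodicPt, Function.IsFixedPt, iterate_mul_apply]

theorem exists_pow_mul_eq_self [NeZero D] (hq : q.Coprime D) :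
    ∃ m : ℕ, 0 < m ∧ ∀ n : ZMod D, (q : ZMod D) ^ m * n = n := by
  refine ⟨D.totient, Nat.totient_pos.mpr (NeZero.pos D), fun n => ?_⟩
  have hpow := congrArg Units.val (ZMod.pow_totient (ZMod.unitOfCoprime q hq))
  rw [Units.val_pow_eq_pow_val, ZMod.coe_unitOfCoprime, Units.val_one] at hpow
  rw [hpow, one_mul]

theorem qOrbit_eq_image_iterate (n : ZMod D) {r : ℕ} (hr : 0 < r)
    (hper : (q : ZMod D) ^ r * n = n) :
    qOrbit q n = (fun j => (fun x : ZMod D => (q : ZMod D) * x)^[j] n) '' Set.Iio r := by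
  ext x
  constructor
  · rintro ⟨j, rfl⟩
    refine ⟨j % r, Nat.mod_lt _ hr, ?_⟩
    change (fun x : ZMod D => (q : ZMod D) * x)^[j % r] n = _
    rw [((isPeriodicPt_iff n r).mpr hper).iterate_mod_apply, iterate_mul_apply]
  · rintro ⟨j, -, rfl⟩
    exact ⟨j, (iterate_mul_apply n j).symm⟩

theorem ncard_qOrbit [NeZero D] (hq : q.Coprime D) (n : ZMod D) : (qOrbit q n).ncard =
    Function.minimalPeriod (fun x : ZMod D => (q : ZMod D) * x) n := by
  obtain ⟨m, hm, hfix⟩ := exists_pow_mul_eq_self hq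
  have hpos : 0 < Function.minimalPeriod (fun x : ZMod D => (q : ZMod D) * x) n :=
    Function.minimalPeriod_pos_of_mem_periodicPts ⟨m, hm, (isPeriodicPt_iff n m).mpr (hfix n)⟩
  have hper := (isPeriodicPt_iff (q := q) n _).mp (Function.isPeriodicPt_minimalPeriod _ n)
  rw [qOrbit_eq_image_iterate n hpos hper, Function.iterate_injOn_Iio_minimalPeriod.ncard_image,
    ← Finset.coe_Iio, Set.ncard_coe_finset, Nat.card_Iio]

theorem pow_mul_eq_self_iff [NeZero D] (hq : q.Coprime D) (n : ZMod D) (m : ℕ) :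
    (q : ZMod D) ^ m * n = n ↔ (qOrbit q n).ncard ∣ m := by
  rw [ncard_qOrbit hq, ← isPeriodicPt_iff, Function.isPeriodicPt_iff_minimalPeriod_dvd]

theorem qOrbit_mul [NeZero D] (hq : q.Coprime D) (n : ZMod D) :
    qOrbit q ((q : ZMod D) * n) = qOrbit q n := by
  obtain ⟨m, hm, hfix⟩ := exists_pow_mul_eq_self hq
  apply Set.Subset.antisymm
  · rintro _ ⟨j, rfl⟩
    exact ⟨j + 1, by simp only [pow_succ, mul_assoc]⟩
  · rintro _ ⟨j, rfl⟩
    refine ⟨j + (m - 1), ?_⟩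
    change (q : ZMod D) ^ (j + (m - 1)) * ((q : ZMod D) * n) = (q : ZMod D) ^ j * n
    rw [← mul_assoc, ← pow_succ, add_assoc, Nat.sub_add_cancel hm, pow_add, mul_assoc, hfix]

theorem mem_qOrbit_self (n : ZMod D) : n ∈ qOrbit q n :=
  ⟨0, by simp only [pow_zero, one_mul]⟩

theorem qOrbit_eq_of_mem [NeZero D] (hq : q.Coprime D) {n n' : ZMod D} (h : n' ∈ qOrbit q n) :
    qOrbit q n' = qOrbit q n := by
  obtain ⟨j, rfl⟩ := h
  change qOrbit q ((q : ZMod D) ^ j * n) = _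
  induction j with
  | zero => rw [pow_zero, one_mul]
  | succ j ih => rw [pow_succ', mul_assoc, qOrbit_mul hq, ih]

theorem sub_one_mul_eq_zero_iff (hq : q ≠ 0) (n : ZMod D) (m : ℕ) :
    ((q ^ m - 1 : ℕ) : ZMod D) * n = 0 ↔ (q : ZMod D) ^ m * n = n := by
  rw [Nat.cast_sub (Nat.one_le_iff_ne_zero.mpr (pow_ne_zero m hq)), sub_mul, sub_eq_zero,
    Nat.cast_pow, Nat.cast_one, one_mul]

end OrbitLength

/-! ### The finite subfields of an algebraically closed field -/

section FiniteSubfield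

variable {κ : Type*} [Field κ] {p : ℕ} [Fact p.Prime] [CharP κ p]

theorem mem_finiteSubfield {e : ℕ} {x : κ} : x ∈ finiteSubfield κ p e ↔ x ^ p ^ e = x := by
  rw [← iterateFrobenius_def p e x]
  rfl

theorem natCard_finiteSubfield [IsAlgClosed κ] {e : ℕ} (he : e ≠ 0) :
    Nat.card (finiteSubfield κ p e) = p ^ e := by
  classical
  have hone : 1 < p ^ e := Nat.one_lt_pow he (Fact.out : p.Prime).one_lt
  have hcard := card_rootSet_eq_natDegree (F := κ) (K := κ)
    (galois_poly_separable (K := κ) p (p ^ e) (dvd_pow_self p he)) (IsAlgClosed.splits _)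
  rw [FiniteField.X_pow_card_sub_X_natDegree_eq κ hone] at hcard
  rw [← hcard, ← Nat.card_eq_fintype_card]
  refine Nat.card_congr (Equiv.subtypeEquivRight fun x => ?_)
  rw [mem_finiteSubfield, mem_rootSet_of_ne (FiniteField.X_pow_card_sub_X_ne_zero κ hone), map_sub,
    map_pow, aeval_X, sub_eq_zero]

theorem finiteSubfield_le {e e' : ℕ} (h : e ∣ e') :
    finiteSubfield κ p e ≤ finiteSubfield κ p e' := by
  obtain ⟨c, rfl⟩ := h
  intro x hx
  rw [mem_finiteSubfield] at hx ⊢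
  induction c with
  | zero => rw [mul_zero, pow_zero, pow_one]
  | succ c ih => rw [mul_add, mul_one, pow_add, pow_mul, ih, hx]

theorem charP_finiteSubfield (e : ℕ) : CharP (finiteSubfield κ p e) p :=
  (finiteSubfield κ p e).subtype.charP (finiteSubfield κ p e).subtype_injective p

theorem ringChar_finiteSubfield (e : ℕ) : ringChar (finiteSubfield κ p e) = p :=
  have := charP_finiteSubfield (κ := κ) (p := p) e
  ringChar.eq (finiteSubfield κ p e) p

end FiniteSubfield

/-! ### Jacobi sums over the finite subfields -/

theorem finrank_eq_of_natCard {k K : Type*} [Field k] [Finite k] [AddCommGroup K] [Module k K]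
    [Finite K] {c : ℕ} (h : Nat.card K = Nat.card k ^ c) : Module.finrank k K = c :=
  Nat.pow_right_injective (Finite.one_lt_card (α := k))
    (Module.natCard_eq_pow_finrank.symm.trans h)

section BetaAt

variable {κ : Type*} [Field κ] {p : ℕ} [Fact p.Prime] [CharP κ p] {L : Type*} [Field L]

/-- The restriction of a character of `κˣ` to a subfield. -/
def subfieldHom (t : κˣ →* Lˣ) (K : Subfield κ) : Kˣ →* Lˣ :=
  t.comp (Units.map (K.subtype : K →* κ))

theorem subfieldHom_injective {t : κˣ →* Lˣ} (ht : Function.Injective t) (K : Subfield κ) :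
    Function.Injective (subfieldHom t K) :=
  ht.comp (Units.map_injective K.subtype_injective)

/-- The analogue of `β(n)` over the field with `q ^ m` elements, where `q = p ^ f`, for an arbitrary
`m` in place of the length of the orbit of `n`. It is meaningful when `(q ^ m - 1) n = 0`. -/
def betaAt (p f d : ℕ) [Fact p.Prime] [CharP κ p] (t : κˣ →* Lˣ) (n : ZMod (2 * d)) (m : ℕ)
    [NeZero (f * m)] : L :=
  letI : Fintype (finiteSubfield κ p (f * m)) := Fintype.ofFinite _
  jacobiProduct
    (indexedChar (subfieldHom t (finiteSubfield κ p (f * m))) ((p ^ f) ^ m - 1) (2 * d) n)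

variable [IsAlgClosed κ] {f d : ℕ} [NeZero d] {t : κˣ →* Lˣ}

theorem natCard_units_finiteSubfield (m : ℕ) [NeZero (f * m)] :
    Nat.card (finiteSubfield κ p (f * m))ˣ = (p ^ f) ^ m - 1 := by
  rw [Nat.card_units, natCard_finiteSubfield (NeZero.ne (f * m)), pow_mul]

theorem betaAt_mul [CharZero L] (hp : p ≠ 2) (ht : Function.Injective t) {n : ZMod (2 * d)}
    (hn0 : n ≠ 0) {m c : ℕ} [NeZero (f * m)] [NeZero (f * (m * c))]
    (hn : (((p ^ f) ^ m - 1 : ℕ) : ZMod (2 * d)) * n = 0) :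
    betaAt p f d t n (m * c) = betaAt p f d t n m ^ c := by
  let _ : Fintype (finiteSubfield κ p (f * m)) := Fintype.ofFinite _
  let _ : Fintype (finiteSubfield κ p (f * (m * c))) := Fintype.ofFinite _
  let _ : Algebra (finiteSubfield κ p (f * m)) (finiteSubfield κ p (f * (m * c))) :=
    (Subfield.inclusion (finiteSubfield_le (mul_dvd_mul_left f (dvd_mul_right m c)))).toAlgebra
  have hrank : Module.finrank (finiteSubfield κ p (f * m)) (finiteSubfield κ p (f * (m * c))) =
      c := by
    refine finrank_eq_of_natCard ?_
    rw [natCard_finiteSubfield (NeZero.ne _), natCard_finiteSubfield (NeZero.ne _), ← pow_mul,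
      mul_assoc]
  have hchar : ringChar (finiteSubfield κ p (f * m)) ≠ 2 := by rwa [ringChar_finiteSubfield]
  have hcard := natCard_units_finiteSubfield (κ := κ) (p := p) (f := f) m
  have hcard' := natCard_units_finiteSubfield (κ := κ) (p := p) (f := f) (m * c)
  have hχ := indexedChar_ne_one (subfieldHom_injective ht _) hcard hn hn0
  have hnorm := indexedChar_apply_norm (ψ := subfieldHom t (finiteSubfield κ p (f * m)))
    (ω := subfieldHom t (finiteSubfield κ p (f * (m * c)))) hcard' hcard (fun _ => rfl) hn
  have hpow := jacobiProduct_extension hchar hχ hnorm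
  rwa [hrank] at hpow

theorem betaAt_frobenius {n : ZMod (2 * d)} {m : ℕ} [NeZero (f * m)]
    (hn : (((p ^ f) ^ m - 1 : ℕ) : ZMod (2 * d)) * n = 0) :
    betaAt p f d t (((p ^ f : ℕ) : ZMod (2 * d)) * n) m = betaAt p f d t n m := by
  let _ : Fintype (finiteSubfield κ p (f * m)) := Fintype.ofFinite _
  have := charP_finiteSubfield (κ := κ) (p := p) (f * m)
  have : ExpChar (finiteSubfield κ p (f * m)) p := .prime Fact.out
  rw [betaAt, indexedChar_natCast_mul (natCard_units_finiteSubfield m) _ hn]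
  exact jacobiProduct_pow_frobenius p f _

end BetaAt

/-! ### The numbers `β(n)` -/

section IndexSet

theorem natCast_mul_eq_zero_iff {D c e : ℕ} [NeZero D] (hD : D = c * e) (n : ZMod D) :
    (c : ZMod D) * n = 0 ↔ ∃ i < c, n = ((i * e : ℕ) : ZMod D) := by
  have hc : 0 < c := Nat.pos_of_mul_pos_right (hD ▸ NeZero.pos D)
  rw [← dvd_mul_val_iff]
  constructor
  · intro h
    obtain ⟨i, hi⟩ := (Nat.mul_dvd_mul_iff_left hc).mp (hD.symm.dvd.trans h)
    refine ⟨i, ?_, by rw [mul_comm i e, ← hi, ZMod.natCast_zmod_val]⟩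
    have hlt := (ZMod.val_lt n).trans_eq hD
    rw [hi, mul_comm c] at hlt
    exact lt_of_mul_lt_mul_left hlt (Nat.zero_le e)
  · rintro ⟨i, -, rfl⟩
    rw [dvd_mul_val_iff, ← Nat.cast_mul, ZMod.natCast_eq_zero_iff]
    exact ⟨i, by rw [hD]; ring⟩

theorem mem_indexSet_iff_two_mul_ne_zero {d : ℕ} [NeZero d] (hd : Odd d) (n : ZMod (2 * d)) :
    n ∈ indexSet d ↔ ((2 : ℕ) : ZMod (2 * d)) * n ≠ 0 := by
  rw [Ne, natCast_mul_eq_zero_iff rfl, mem_indexSet_of_odd hd, ← not_or, not_iff_not,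
    Nat.exists_lt_succ_right, Nat.exists_lt_succ_right]
  simp

theorem mem_indexSet_iff_four_mul_ne_zero {e : ℕ} [NeZero e] (n : ZMod (2 * (2 * e))) :
    n ∈ indexSet (2 * e) ↔ ((4 : ℕ) : ZMod (2 * (2 * e))) * n ≠ 0 := by
  rw [Ne, natCast_mul_eq_zero_iff (e := e) (by ring), mem_indexSet_two_mul]
  simp only [Nat.exists_lt_succ_right, Nat.not_lt_zero, false_and, exists_false, false_or,
    zero_mul, one_mul, Nat.cast_zero, not_or, and_assoc]

theorem ne_zero_of_mem_indexSet {d : ℕ} {n : ZMod (2 * d)} (hn : n ∈ indexSet d) : n ≠ 0 := by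
  rintro rfl
  rw [indexSet] at hn
  split_ifs at hn <;> exact hn (Set.mem_insert _ _)

theorem mul_mem_indexSet {d : ℕ} [NeZero d] {u n : ZMod (2 * d)} (hu : IsUnit u)
    (hn : n ∈ indexSet d) : u * n ∈ indexSet d := by
  obtain hd | hd := d.even_or_odd
  · obtain ⟨e, rfl⟩ := hd.two_dvd
    have : NeZero e := ⟨right_ne_zero_of_mul (NeZero.ne (2 * e))⟩
    rw [mem_indexSet_iff_four_mul_ne_zero] at hn ⊢
    exact fun h => hn (hu.mul_right_eq_zero.mp ((mul_left_comm _ _ _).trans h))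
  · rw [mem_indexSet_iff_two_mul_ne_zero hd] at hn ⊢
    exact fun h => hn (hu.mul_right_eq_zero.mp ((mul_left_comm _ _ _).trans h))

theorem qOrbit_subset_indexSet {q d : ℕ} [NeZero d] (hq : q.Coprime (2 * d)) {n : ZMod (2 * d)}
    (hn : n ∈ indexSet d) : qOrbit q n ⊆ indexSet d := by
  rintro _ ⟨j, rfl⟩
  exact mul_mem_indexSet (((ZMod.isUnit_iff_coprime _ _).mpr hq).pow j) hn

end IndexSet

section BetaOrbit

theorem coprime_two_mul {p f d : ℕ} [Fact p.Prime] (hp : p ≠ 2) (hdq : d.Coprime (p ^ f)) :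
    (p ^ f).Coprime (2 * d) :=
  .mul_right (.pow_left f ((Nat.coprime_primes Fact.out Nat.prime_two).mpr hp)) hdq.symm

theorem betaAt_congr {L : Type*} [Field L] {p f d : ℕ} [Fact p.Prime] {κ : Type*} [Field κ]
    [CharP κ p] (t : κˣ →* Lˣ) (n : ZMod (2 * d)) {m m' : ℕ} [NeZero (f * m)] [NeZero (f * m')]
    (h : m = m') : betaAt p f d t n m = betaAt p f d t n m' := by
  subst h
  rfl

variable {L : Type*} [Field L] [IsAlgClosed L]

attribute [local instance] Ideal.Quotient.field

theorem isAlgClosed_residueField (𝔓 : Ideal (integralClosure ℤ L)) [𝔓.IsMaximal] :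
    IsAlgClosed (integralClosure ℤ L ⧸ 𝔓) := by
  refine IsAlgClosed.of_exists_root _ fun P hP hi => ?_
  obtain ⟨G, hG, hdeg, hmon⟩ := lifts_and_natDegree_eq_and_monic
    ((mem_lifts P).mpr (map_surjective (Ideal.Quotient.mk 𝔓) Ideal.Quotient.mk_surjective P)) hP
  have hdeg0 : (G.map (algebraMap (integralClosure ℤ L) L)).degree ≠ 0 := by
    rw [hmon.degree_map, degree_eq_natDegree hmon.ne_zero, hdeg]
    exact_mod_cast hi.natDegree_pos.ne'
  obtain ⟨z, hz⟩ := IsAlgClosed.exists_root _ hdeg0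
  rw [IsRoot.def, eval_map] at hz
  have hint : IsIntegral ℤ z := isIntegral_trans (A := integralClosure ℤ L) z ⟨G, hmon, hz⟩
  have hroot : G.eval ⟨z, hint⟩ = 0 := by
    apply Subtype.val_injective
    change algebraMap (integralClosure ℤ L) L _ = _
    rw [← eval₂_at_apply]
    exact hz
  exact ⟨Ideal.Quotient.mk 𝔓 ⟨z, hint⟩, by rw [← hG, eval_map, eval₂_at_apply, hroot, map_zero]⟩

variable [CharZero L] {p f d : ℕ} [Fact p.Prime] (𝔓 : Ideal (integralClosure ℤ L)) [𝔓.IsMaximal]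
  [CharP (integralClosure ℤ L ⧸ 𝔓) p]

theorem teichmuller_injective : Function.Injective (teichmuller p 𝔓) := by
  have hval := Units.map_injective
    (f := ((integralClosure ℤ L).val : integralClosure ℤ L →* L)) Subtype.val_injective
  exact (hval.comp Subtype.val_injective).comp (MulEquiv.injective _)

theorem beta_eq_betaAt [NeZero f] [NeZero d] (n : ZMod (2 * d))
    [NeZero (f * (qOrbit (p ^ f) n).ncard)] :
    beta p f d 𝔓 n = betaAt p f d (teichmuller p 𝔓) n (qOrbit (p ^ f) n).ncard :=
  rfl

variable [NeZero d]

theorem sub_one_mul_eq_zero_iff_dvd (hp : p ≠ 2) (hdq : d.Coprime (p ^ f))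
    (n : ZMod (2 * d)) (m : ℕ) :
    (((p ^ f) ^ m - 1 : ℕ) : ZMod (2 * d)) * n = 0 ↔ (qOrbit (p ^ f) n).ncard ∣ m := by
  rw [sub_one_mul_eq_zero_iff (pow_ne_zero f (Fact.out : p.Prime).ne_zero),
    pow_mul_eq_self_iff (coprime_two_mul hp hdq)]

variable [NeZero f]

theorem betaAt_eq_beta_pow (hp : p ≠ 2) (hdq : d.Coprime (p ^ f))
    {n : ZMod (2 * d)} (hn0 : n ≠ 0) {m : ℕ} [NeZero (f * m)]
    (hm : (qOrbit (p ^ f) n).ncard ∣ m) :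
    betaAt p f d (teichmuller p 𝔓) n m = beta p f d 𝔓 n ^ (m / (qOrbit (p ^ f) n).ncard) := by
  have := isAlgClosed_residueField 𝔓
  have hcard := qOrbit_ncard_ne_zero (p ^ f) n
  have : NeZero (f * (qOrbit (p ^ f) n).ncard) := ⟨mul_ne_zero (NeZero.ne f) hcard⟩
  obtain ⟨c, rfl⟩ := hm
  rw [beta_eq_betaAt, Nat.mul_div_cancel_left c (Nat.pos_of_ne_zero hcard)]
  exact betaAt_mul hp (teichmuller_injective 𝔓) hn0
    ((sub_one_mul_eq_zero_iff_dvd hp hdq n _).mpr dvd_rfl)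

theorem beta_mul (hp : p ≠ 2) (hdq : d.Coprime (p ^ f)) (n : ZMod (2 * d)) :
    beta p f d 𝔓 (((p ^ f : ℕ) : ZMod (2 * d)) * n) = beta p f d 𝔓 n := by
  have := isAlgClosed_residueField 𝔓
  have (n : ZMod (2 * d)) : NeZero (f * (qOrbit (p ^ f) n).ncard) :=
    ⟨mul_ne_zero (NeZero.ne f) (qOrbit_ncard_ne_zero (p ^ f) n)⟩
  rw [beta_eq_betaAt, beta_eq_betaAt,
    betaAt_congr _ _ (congrArg Set.ncard (qOrbit_mul (coprime_two_mul hp hdq) n))]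
  exact betaAt_frobenius ((sub_one_mul_eq_zero_iff_dvd hp hdq n _).mpr dvd_rfl)

theorem beta_eq_of_mem_qOrbit (hp : p ≠ 2) (hdq : d.Coprime (p ^ f))
    {n n' : ZMod (2 * d)} (h : n' ∈ qOrbit (p ^ f) n) : beta p f d 𝔓 n' = beta p f d 𝔓 n := by
  obtain ⟨j, rfl⟩ := h
  change beta p f d 𝔓 (((p ^ f : ℕ) : ZMod (2 * d)) ^ j * n) = _
  induction j with
  | zero => rw [pow_zero, one_mul]
  | succ j ih => rw [pow_succ', mul_assoc, beta_mul 𝔓 hp hdq, ih]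

open Classical in
theorem one_add_sum_fiberTrace (hp : p ≠ 2) (hdq : d.Coprime (p ^ f)) (m : ℕ) [NeZero (f * m)] :
    letI : Fintype (residueSubfield p f 𝔓 m) := Fintype.ofFinite _
    1 + ∑ τ : residueSubfield p f 𝔓 m, (fiberTrace d τ : L) =
      -((p : L) ^ f) ^ m - ∑ n : ZMod (2 * d) with
        n ∈ indexSet d ∧ (qOrbit (p ^ f) n).ncard ∣ m,
          beta p f d 𝔓 n ^ (m / (qOrbit (p ^ f) n).ncard) := by
  have := isAlgClosed_residueField 𝔓
  let _ : Fintype (residueSubfield p f 𝔓 m) := Fintype.ofFinite _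
  have hK : ringChar (residueSubfield p f 𝔓 m) ≠ 2 := by rwa [ringChar_finiteSubfield]
  have hN := natCard_units_finiteSubfield (κ := integralClosure ℤ L ⧸ 𝔓) (p := p) (f := f) m
  have hcard : (Fintype.card (residueSubfield p f 𝔓 m) : L) = ((p : L) ^ f) ^ m := by
    rw [← Nat.card_eq_fintype_card, natCard_finiteSubfield (NeZero.ne (f * m)), pow_mul,
      Nat.cast_pow, Nat.cast_pow]
  have hω := subfieldHom_injective (teichmuller_injective (p := p) 𝔓) (residueSubfield p f 𝔓 m)
  refine (congrArg (1 + ·) (sum_fiberTrace hK hω hN)).trans ?_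
  rw [hcard, add_sub, add_sub_cancel]
  congr 1
  refine Finset.sum_congr ?_ fun n hn => ?_
  · ext n
    simp only [Finset.mem_filter, Finset.mem_univ, true_and,
      sub_one_mul_eq_zero_iff_dvd hp hdq, and_comm]
  · obtain ⟨-, hmem, hdvd⟩ := Finset.mem_filter.mp hn
    exact betaAt_eq_beta_pow 𝔓 hp hdq (ne_zero_of_mem_indexSet hmem) hdvd

end BetaOrbit

/-! ### The Euler product -/

section EulerProduct

variable {F : Type*} [Field F]

theorem Place.degree_pos (v : Place F) : 0 < v.degree := by
  cases v with
  | finite P hm hi => exact hi.natDegree_pos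
  | infinite => exact one_pos

theorem X_pow_degree_dvd_eulerPolynomial_sub_one (W : WeierstrassCurve (RatFunc F))
    (v : Place F) : X ^ v.degree ∣ eulerPolynomial W v - 1 := by
  rw [eulerPolynomial]
  split_ifs
  · exact ⟨-C (traceAt W v) + C (residueCard v : ℤ) * X ^ v.degree, by ring⟩
  · exact ⟨-C (traceAt W v), by ring⟩

theorem eulerPolynomial_mul_eulerFactor (W : WeierstrassCurve (RatFunc F)) (v : Place F) :
    (eulerPolynomial W v : PowerSeries ℤ) * eulerFactor W v = 1 := by
  refine PowerSeries.mul_invOfUnit _ 1 ?_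
  obtain ⟨c, hc⟩ := X_pow_degree_dvd_eulerPolynomial_sub_one W v
  rw [sub_eq_iff_eq_add.mp hc, ← PowerSeries.coeff_zero_eq_constantCoeff_apply,
    Polynomial.coeff_coe, coeff_add, coeff_X_pow_mul', if_neg v.degree_pos.not_ge, zero_add,
    coeff_one_zero, Units.val_one]

theorem X_pow_degree_dvd_eulerFactor_sub_one (W : WeierstrassCurve (RatFunc F)) (v : Place F) :
    (PowerSeries.X : PowerSeries ℤ) ^ v.degree ∣ eulerFactor W v - 1 := by
  obtain ⟨c, hc⟩ := X_pow_degree_dvd_eulerPolynomial_sub_one W v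
  have hinv := eulerPolynomial_mul_eulerFactor W v
  rw [sub_eq_iff_eq_add.mp hc] at hinv
  push_cast at hinv
  exact ⟨-(c : PowerSeries ℤ) * eulerFactor W v, by linear_combination hinv⟩

variable {L : Type*} [Field L] {W : WeierstrassCurve (RatFunc F)}

theorem isLogDeriv_eulerFactor {v : Place F} {α β : L}
    (h : (eulerPolynomial W v).map (Int.castRingHom L) =
      (1 - C α * X ^ v.degree) * (1 - C β * X ^ v.degree)) :
    IsLogDeriv (PowerSeries.map (Int.castRingHom L) (eulerFactor W v))
      (fun n => if v.degree ∣ n ∧ n ≠ 0 then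
        (v.degree : L) * (α ^ (n / v.degree) + β ^ (n / v.degree)) else 0) := by
  have hinv := congrArg (PowerSeries.map (Int.castRingHom L)) (eulerPolynomial_mul_eulerFactor W v)
  rw [map_mul, map_one, ← Polynomial.polynomial_map_coe, h] at hinv
  push_cast at hinv
  have hdeg := v.degree_pos.ne'
  refine (((isLogDeriv_one_sub_C_mul_X_pow α hdeg).mul
    (isLogDeriv_one_sub_C_mul_X_pow β hdeg)).of_mul_eq_one hinv).congr fun n => ?_
  simp only [Pi.neg_apply, Pi.add_apply]
  split_ifs <;> ring

variable [Finite F]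

theorem finite_setOf_degree_le (N : ℕ) : {v : Place F | v.degree ≤ N}.Finite := by
  refine Set.Finite.subset (((irreds F N).attach.finite_toSet.image fun P =>
    Place.finite P.1 (mem_irreds.mp P.2).1 (mem_irreds.mp P.2).2.1).insert Place.infinite)
    fun v hv => ?_
  cases v with
  | finite P hm hi =>
    exact Or.inr ⟨⟨P, mem_irreds.mpr ⟨hm, hi, hv⟩⟩, Finset.mem_coe.mpr (Finset.mem_attach _ _), rfl⟩
  | infinite => exact Or.inl rfl

open scoped PowerSeries.WithPiTopology in
theorem eulerProductConverges (W : WeierstrassCurve (RatFunc F)) : EulerProductConverges W :=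
  (hasProd_of_X_pow_dvd_sub_one (X_pow_degree_dvd_eulerFactor_sub_one W)
    finite_setOf_degree_le).multipliable

theorem constantCoeff_lFunction (W : WeierstrassCurve (RatFunc F)) :
    PowerSeries.constantCoeff (lFunction W) = 1 := by
  rw [← PowerSeries.coeff_zero_eq_constantCoeff_apply, lFunction,
    coeff_tprod_eq_coeff_prod (X_pow_degree_dvd_eulerFactor_sub_one W) finite_setOf_degree_le
      le_rfl, Finset.prod_eq_one, PowerSeries.coeff_zero_one]
  intro v hv
  exact absurd v.degree_pos ((Set.Finite.mem_toFinset _).mp hv).not_gt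

theorem sum_places {M : Type*} [AddCommMonoid M] {r : Place F → M} {G : F[X] → M}
    (hG : ∀ P hm hi, G P = r (Place.finite P hm hi)) {n : ℕ} (hn : n ≠ 0) :
    ∑ v ∈ (finite_setOf_degree_le (F := F) n).toFinset, r v =
      r Place.infinite + ∑ P ∈ irreds F n, G P := by
  classical
  have hinf : Place.infinite ∈ (finite_setOf_degree_le (F := F) n).toFinset :=
    (Set.Finite.mem_toFinset _).mpr (Nat.one_le_iff_ne_zero.mpr hn)
  rw [← Finset.add_sum_erase _ _ hinf]
  congr 1
  symm
  refine Finset.sum_bij (fun P hP => Place.finite P (mem_irreds.mp hP).1 (mem_irreds.mp hP).2.1)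
    (fun P hP => ?_) (fun P hP P' hP' h => ?_) (fun v hv => ?_) fun P hP => hG _ _ _
  · rw [Finset.mem_erase, Set.Finite.mem_toFinset]
    exact ⟨nofun, (mem_irreds.mp hP).2.2⟩
  · injection h
  · rw [Finset.mem_erase, Set.Finite.mem_toFinset] at hv
    cases v with
    | finite P hm hi => exact ⟨P, mem_irreds.mpr ⟨hm, hi, hv.2⟩, rfl⟩
    | infinite => exact absurd rfl hv.1

theorem isLogDeriv_lFunction {α β : Place F → L}
    (h : ∀ v, (eulerPolynomial W v).map (Int.castRingHom L) =
      (1 - C (α v) * X ^ v.degree) * (1 - C (β v) * X ^ v.degree)) :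
    IsLogDeriv (PowerSeries.map (Int.castRingHom L) (lFunction W))
      (fun n => ∑ v ∈ (finite_setOf_degree_le (F := F) n).toFinset,
        if v.degree ∣ n ∧ n ≠ 0 then
          (v.degree : L) * (α v ^ (n / v.degree) + β v ^ (n / v.degree)) else 0) := by
  refine IsLogDeriv.of_approx fun N => ⟨_, _, IsLogDeriv.prod
    (finite_setOf_degree_le (F := F) N).toFinset fun v _ => isLogDeriv_eulerFactor (h v),
    fun i hi => ⟨?_, ?_⟩⟩
  · rw [PowerSeries.coeff_map, ← map_prod, PowerSeries.coeff_map, lFunction,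
      coeff_tprod_eq_coeff_prod (X_pow_degree_dvd_eulerFactor_sub_one W) finite_setOf_degree_le hi]
  · refine Finset.sum_subset (fun v hv => ?_) fun v _ hv => if_neg fun hvi => hv ?_
    · rw [Set.Finite.mem_toFinset] at hv ⊢
      exact le_trans hv hi
    · rw [Set.Finite.mem_toFinset]
      exact Nat.le_of_dvd (Nat.pos_of_ne_zero hvi.2) hvi.1

theorem isLogDeriv_lFunction_of_finite_of_infinite {α β : F[X] → L} {a b : L}
    (hfin : ∀ P hm hi, (eulerPolynomial W (Place.finite P hm hi)).map (Int.castRingHom L) =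
      (1 - C (α P) * X ^ P.natDegree) * (1 - C (β P) * X ^ P.natDegree))
    (hinf : (eulerPolynomial W Place.infinite).map (Int.castRingHom L) =
      (1 - C a * X) * (1 - C b * X)) :
    IsLogDeriv (PowerSeries.map (Int.castRingHom L) (lFunction W)) fun n => if n = 0 then 0 else
      a ^ n + b ^ n + ∑ P ∈ irreds F n with P.natDegree ∣ n,
        (P.natDegree : L) * (α P ^ (n / P.natDegree) + β P ^ (n / P.natDegree)) := by
  let extend (γ : F[X] → L) (c : L) : Place F → L
    | .finite P _ _ => γ P
    | .infinite => c
  have heuler (v : Place F) : (eulerPolynomial W v).map (Int.castRingHom L) =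
      (1 - C (extend α a v) * X ^ v.degree) * (1 - C (extend β b v) * X ^ v.degree) := by
    cases v with
    | finite P hm hi => exact hfin P hm hi
    | infinite => simpa only [Place.degree, pow_one] using hinf
  refine (isLogDeriv_lFunction heuler).congr fun n => ?_
  obtain rfl | hn := eq_or_ne n 0
  · exact Finset.sum_eq_zero fun v _ => if_neg fun h => h.2 rfl
  simp only [hn, ne_eq, not_false_eq_true, and_true, if_false]
  rw [Finset.sum_filter, sum_places (G := fun P => if P.natDegree ∣ n then (P.natDegree : L) *
    (α P ^ (n / P.natDegree) + β P ^ (n / P.natDegree)) else 0) (fun _ _ _ => rfl) hn]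
  simp [extend, Place.degree]

theorem exists_isLogDeriv_lFunction_curve (h2 : (2 : F) ≠ 0) {d : ℕ} (hd : d ≠ 0) (L : Type*)
    [Field L] [IsAlgClosed L] :
    ∃ s : ℕ → L, IsLogDeriv (PowerSeries.map (Int.castRingHom L) (lFunction (curve F d))) s ∧
      s 0 = 0 ∧ ∀ (K : Type*) [Field K] [Fintype K] [Algebra F K],
        s (Module.finrank F K) = 1 + ∑ τ : K, (fiberTrace d τ : L) := by
  have hfactors (P : F[X]) : ∃ α β : L, ∀ hm hi,
      (eulerPolynomial (curve F d) (Place.finite P hm hi)).map (Int.castRingHom L) =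
        (1 - C α * X ^ P.natDegree) * (1 - C β * X ^ P.natDegree) ∧
      ∀ (K : Type _) [Field K] [Fintype K] [Algebra F K] (τ : K), aeval τ P = 0 →
        (fiberTrace d τ : L) =
          α ^ (Module.finrank F K / P.natDegree) + β ^ (Module.finrank F K / P.natDegree) := by
    by_cases hP : P.Monic ∧ Irreducible P
    · obtain ⟨α, β, h⟩ := exists_eulerPolynomial_finite hP.1 hP.2 h2 hd L
      exact ⟨α, β, fun _ _ => h⟩
    · exact ⟨0, 0, fun hm hi => absurd ⟨hm, hi⟩ hP⟩
  choose α β hαβ using hfactors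
  refine ⟨_, isLogDeriv_lFunction_of_finite_of_infinite (fun P hm hi => (hαβ P hm hi).1)
    (eulerPolynomial_infinite h2 hd L), if_pos rfl, fun K _ _ _ => ?_⟩
  have hrank : Module.finrank F K ≠ 0 := Module.finrank_pos.ne'
  rw [if_neg hrank, one_pow, zero_pow hrank, add_zero, ← sum_minpoly (k := F) (K := K) fun P =>
    α P ^ (Module.finrank F K / P.natDegree) + β P ^ (Module.finrank F K / P.natDegree)]
  refine congrArg (1 + ·) (Finset.sum_congr rfl fun τ _ => ?_)
  have hint : IsIntegral F τ := Algebra.IsIntegral.isIntegral τ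
  exact ((hαβ _ (minpoly.monic hint) (minpoly.irreducible hint)).2 K τ (minpoly.aeval F τ)).symm

end EulerProduct

/-! ### The `L`-function of `E_d` -/

section RootMultiplicity

variable {L : Type*} [Field L]

theorem one_sub_C_mul_X_pow_ne_zero (b : L) {k : ℕ} (hk : k ≠ 0) :
    (1 - C b * X ^ k : L[X]) ≠ 0 := by
  intro h
  simpa [hk] using congrArg (eval 0) h

open Classical in
theorem rootMultiplicity_one_sub_C_mul_X_pow [CharZero L] (b : L) {k : ℕ} (hk : k ≠ 0) {a : L}
    (ha : a ≠ 0) :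
    (1 - C b * X ^ k : L[X]).rootMultiplicity a⁻¹ = if b = a ^ k then 1 else 0 := by
  have hne := one_sub_C_mul_X_pow_ne_zero b hk
  have hroot : (1 - C b * X ^ k : L[X]).IsRoot a⁻¹ ↔ b = a ^ k := by
    rw [IsRoot.def, eval_sub, eval_one, eval_mul, eval_C, eval_pow, eval_X, inv_pow, sub_eq_zero,
      eq_comm, mul_inv_eq_one₀ (pow_ne_zero k ha)]
  split_ifs with h
  · refine le_antisymm (not_lt.mp fun hlt => ?_) ((rootMultiplicity_pos hne).mpr (hroot.mpr h))
    have hder := ((one_lt_rootMultiplicity_iff_isRoot hne).mp hlt).2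
    rw [IsRoot.def, derivative_sub, derivative_one, derivative_C_mul_X_pow, eval_sub, eval_zero,
      eval_mul, eval_C, eval_pow, eval_X, zero_sub, neg_eq_zero, h] at hder
    simp [hk, ha] at hder
  · exact rootMultiplicity_eq_zero fun h' => h (hroot.mp h')

theorem rootMultiplicity_prod {ι : Type*} {s : Finset ι} {g : ι → L[X]}
    (hg : ∏ i ∈ s, g i ≠ 0) (a : L) :
    (∏ i ∈ s, g i).rootMultiplicity a = ∑ i ∈ s, (g i).rootMultiplicity a := by
  classical
  simp only [← count_roots, roots_prod g s hg, Multiset.count_bind, Finset.sum_map_val]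

theorem exists_polynomial_of_map_eq {R S : Type*} [CommRing R] [CommRing S] {φ : R →+* S}
    (hφ : Function.Injective φ) {G : PowerSeries R} {H : S[X]} (h : PowerSeries.map φ G = H) :
    ∃ P : R[X], (P : PowerSeries R) = G ∧ P.map φ = H := by
  have hP : (PowerSeries.trunc (H.natDegree + 1) G).map φ = H := by
    rw [← PowerSeries.trunc_map, h, PowerSeries.trunc_coe_eq_self (Nat.lt_succ_self _)]
  refine ⟨_, PowerSeries.map_injective φ hφ ?_, hP⟩
  rw [← polynomial_map_coe, hP, h]

end RootMultiplicity

section OrbitSum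

variable {D : ℕ} [NeZero D] {q : ℕ} {Z : Set (ZMod D)}

/-- The finite set underlying `orbits q Z`, indexing finite sums and products over orbits. -/
def orbitFinset (q : ℕ) (Z : Set (ZMod D)) : Finset (Set (ZMod D)) :=
  (Set.toFinite (orbits q Z)).toFinset

theorem mem_orbitFinset {o : Set (ZMod D)} : o ∈ orbitFinset q Z ↔ ∃ n ∈ Z, qOrbit q n = o := by
  rw [orbitFinset, Set.Finite.mem_toFinset]
  rfl

theorem ncard_ne_zero_of_mem_orbitFinset {o : Set (ZMod D)} (ho : o ∈ orbitFinset q Z) :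
    o.ncard ≠ 0 := by
  obtain ⟨n, -, rfl⟩ := mem_orbitFinset.mp ho
  exact qOrbit_ncard_ne_zero q n

open Classical in
theorem sum_qOrbit_eq_sum_orbitFinset {M : Type*} [AddCommMonoid M] (hq : q.Coprime D)
    (hZ : ∀ n ∈ Z, qOrbit q n ⊆ Z) (g : Set (ZMod D) → M) :
    ∑ n with n ∈ Z, g (qOrbit q n) = ∑ o ∈ orbitFinset q Z, o.ncard • g o := by
  have himage : (Finset.univ.filter (· ∈ Z)).image (qOrbit q) = orbitFinset q Z := by
    ext o
    simp only [Finset.mem_image, Finset.mem_filter, Finset.mem_univ, true_and, mem_orbitFinset]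
  rw [Finset.sum_comp g (qOrbit q), himage]
  refine Finset.sum_congr rfl fun o ho => ?_
  obtain ⟨n, hn, rfl⟩ := mem_orbitFinset.mp ho
  rw [← Set.ncard_coe_finset]
  congr 2
  ext n'
  simp only [Finset.coe_filter, Finset.mem_filter, Finset.mem_univ, true_and, Set.mem_ofPred_eq]
  exact ⟨fun h => h.2 ▸ mem_qOrbit_self n', fun h => ⟨hZ n hn h, qOrbit_eq_of_mem hq h⟩⟩

end OrbitSum

section LFunctionCurve

attribute [local instance] Ideal.Quotient.field

variable {F : Type*} [Field F] [Fintype F] {p f : ℕ} [Fact p.Prime]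
  {L : Type*} [Field L] [IsAlgClosed L]
  (𝔓 : Ideal (integralClosure ℤ L)) [𝔓.IsMaximal] [CharP (integralClosure ℤ L ⧸ 𝔓) p]

theorem two_ne_zero_of_card_eq (hp : p ≠ 2) (hF : Fintype.card F = p ^ f) : (2 : F) ≠ 0 :=
  have := charP_of_card_eq_prime_pow hF
  Ring.two_ne_zero (ringChar.eq F p ▸ hp)

theorem finrank_residueSubfield (hF : Fintype.card F = p ^ f) (m : ℕ) [NeZero (f * m)]
    [Algebra F (residueSubfield p f 𝔓 m)] :
    Module.finrank F (residueSubfield p f 𝔓 m) = m := by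
  have := isAlgClosed_residueField 𝔓
  refine finrank_eq_of_natCard ?_
  rw [natCard_finiteSubfield (NeZero.ne (f * m)), Nat.card_eq_fintype_card, hF, pow_mul]

variable [NeZero f]

theorem nonempty_ringHom_residueSubfield (hF : Fintype.card F = p ^ f) (m : ℕ) :
    Nonempty (F →+* residueSubfield p f 𝔓 m) := by
  have := isAlgClosed_residueField 𝔓
  have : NeZero (f * 1) := ⟨mul_ne_zero (NeZero.ne f) one_ne_zero⟩
  let _ : Fintype (residueSubfield p f 𝔓 1) := Fintype.ofFinite _
  have hcard : Fintype.card F = Fintype.card (residueSubfield p f 𝔓 1) := by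
    rw [hF, ← Nat.card_eq_fintype_card, natCard_finiteSubfield (NeZero.ne (f * 1)), mul_one]
  exact ⟨(Subfield.inclusion (finiteSubfield_le (mul_dvd_mul_left f (one_dvd m)))).comp
    (FiniteField.ringEquivOfCardEq hcard).toRingHom⟩

variable [CharZero L] {d : ℕ} [NeZero d]

variable (p f) in
open Classical in
/-- The number `β(𝐧)` attached to an orbit `𝐧`, i.e. `β(n)` for some `n ∈ 𝐧` (and `0` for the empty
set, which is not an orbit). -/
def orbitBeta (o : Set (ZMod (2 * d))) : L :=
  if h : o.Nonempty then beta p f d 𝔓 h.some else 0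

theorem orbitBeta_qOrbit (hp : p ≠ 2) (hdq : d.Coprime (p ^ f)) (n : ZMod (2 * d)) :
    orbitBeta p f 𝔓 (qOrbit (p ^ f) n) = beta p f d 𝔓 n := by
  have hne : (qOrbit (p ^ f) n).Nonempty := ⟨n, mem_qOrbit_self n⟩
  rw [orbitBeta, dif_pos hne]
  exact beta_eq_of_mem_qOrbit 𝔓 hp hdq hne.some_mem

open Classical in
theorem sum_beta_pow (hp : p ≠ 2) (hdq : d.Coprime (p ^ f)) (m : ℕ) :
    ∑ n : ZMod (2 * d) with n ∈ indexSet d ∧ (qOrbit (p ^ f) n).ncard ∣ m,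
        beta p f d 𝔓 n ^ (m / (qOrbit (p ^ f) n).ncard) =
      ∑ o ∈ orbitFinset (p ^ f) (indexSet d), if o.ncard ∣ m then
        (o.ncard : L) * orbitBeta p f 𝔓 o ^ (m / o.ncard) else 0 := by
  have hcop := coprime_two_mul hp hdq
  have hsum := sum_qOrbit_eq_sum_orbitFinset hcop (fun _ => qOrbit_subset_indexSet hcop)
    fun o => if o.ncard ∣ m then orbitBeta p f 𝔓 o ^ (m / o.ncard) else 0
  rw [← Finset.filter_filter, Finset.sum_filter]
  simpa only [orbitBeta_qOrbit 𝔓 hp hdq, nsmul_eq_mul, mul_ite, mul_zero] using hsum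

variable (p f d) in
/-- The polynomial `(1 - q T) ∏ (1 - β(𝐧) T ^ |𝐧|)`, where `q = p ^ f` and `𝐧` runs over the orbits
of `Z_{2d}`. It is the `L`-function of `E_d`, with coefficients in `L`. -/
def lPolynomial : L[X] :=
  (1 - C ((p : L) ^ f) * X ^ 1) * ∏ o ∈ orbitFinset (p ^ f) (indexSet d),
    (1 - C (orbitBeta p f 𝔓 o) * X ^ o.ncard)

theorem coe_lPolynomial : (lPolynomial p f 𝔓 d : PowerSeries L) =
    (1 - PowerSeries.C ((p : L) ^ f) * PowerSeries.X ^ 1) *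
      ∏ o ∈ orbitFinset (p ^ f) (indexSet d),
        (1 - PowerSeries.C (orbitBeta p f 𝔓 o) * PowerSeries.X ^ o.ncard) := by
  rw [lPolynomial, ← coeToPowerSeries.ringHom_apply, map_mul, map_prod]
  simp only [coeToPowerSeries.ringHom_apply, coe_sub, coe_one, coe_mul, coe_C, coe_pow, coe_X]

theorem constantCoeff_lPolynomial :
    PowerSeries.constantCoeff (lPolynomial p f 𝔓 d : PowerSeries L) = 1 := by
  rw [coe_lPolynomial, map_mul, map_prod, Finset.prod_eq_one]
  · simp
  · intro o ho
    simp [ncard_ne_zero_of_mem_orbitFinset ho]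

open Classical in
theorem isLogDeriv_lPolynomial (hp : p ≠ 2) (hdq : d.Coprime (p ^ f)) :
    IsLogDeriv (lPolynomial p f 𝔓 d : PowerSeries L) fun m => if m = 0 then 0 else
      -((p : L) ^ f) ^ m - ∑ n : ZMod (2 * d) with
        n ∈ indexSet d ∧ (qOrbit (p ^ f) n).ncard ∣ m,
          beta p f d 𝔓 n ^ (m / (qOrbit (p ^ f) n).ncard) := by
  have hprod := (isLogDeriv_one_sub_C_mul_X_pow ((p : L) ^ f) one_ne_zero).mul
    (IsLogDeriv.prod _ fun o ho => isLogDeriv_one_sub_C_mul_X_pow (orbitBeta p f 𝔓 o)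
      (ncard_ne_zero_of_mem_orbitFinset (q := p ^ f) (Z := indexSet d) ho))
  rw [coe_lPolynomial]
  refine hprod.congr fun m => ?_
  obtain rfl | hm := eq_or_ne m 0
  · simp
  · simp only [Pi.add_apply, sum_beta_pow 𝔓 hp hdq, one_dvd, ne_eq, hm, not_false_eq_true, and_true,
      if_true, if_false, Nat.cast_one, one_mul, Nat.div_one, sub_eq_add_neg,
      ← Finset.sum_neg_distrib, neg_ite, neg_zero]

theorem map_lFunction_curve (hp : p ≠ 2) (hF : Fintype.card F = p ^ f) (hdq : d.Coprime (p ^ f)) :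
    PowerSeries.map (Int.castRingHom L) (lFunction (curve F d)) = lPolynomial p f 𝔓 d := by
  obtain ⟨s, hs, hs0, hsum⟩ := exists_isLogDeriv_lFunction_curve
    (two_ne_zero_of_card_eq hp hF) (NeZero.ne d) L
  refine IsLogDeriv.left_unique ?_ hs0 hs ((isLogDeriv_lPolynomial 𝔓 hp hdq).congr fun m => ?_)
  · rw [constantCoeff_lPolynomial, ← PowerSeries.coeff_zero_eq_constantCoeff_apply,
      PowerSeries.coeff_map, PowerSeries.coeff_zero_eq_constantCoeff_apply,
      constantCoeff_lFunction, map_one]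
  · split_ifs with hm
    · rw [hm, hs0]
    have : NeZero (f * m) := ⟨mul_ne_zero (NeZero.ne f) hm⟩
    let _ : Fintype (residueSubfield p f 𝔓 m) := Fintype.ofFinite _
    let _ : Algebra F (residueSubfield p f 𝔓 m) :=
      (nonempty_ringHom_residueSubfield 𝔓 hF m).some.toAlgebra
    have hsm := hsum (residueSubfield p f 𝔓 m)
    rw [finrank_residueSubfield 𝔓 hF m] at hsm
    exact ((one_add_sum_fiberTrace 𝔓 hp hdq m).symm.trans hsm.symm)

theorem rootMultiplicity_lPolynomial (hp : p ≠ 2) (hdq : d.Coprime (p ^ f)) :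
    (lPolynomial p f 𝔓 d).rootMultiplicity ((p : L) ^ f)⁻¹ =
      1 + {o ∈ orbits (p ^ f) (indexSet d) |
        ∀ n ∈ o, beta p f d 𝔓 n = ((p : L) ^ f) ^ o.ncard}.ncard := by
  classical
  have hq : (p : L) ^ f ≠ 0 := pow_ne_zero f (Nat.cast_ne_zero.mpr (Fact.out : p.Prime).ne_zero)
  have hprod : ∏ o ∈ orbitFinset (p ^ f) (indexSet d),
      (1 - C (orbitBeta p f 𝔓 o) * X ^ o.ncard : L[X]) ≠ 0 := Finset.prod_ne_zero_iff.mpr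
    fun o ho => one_sub_C_mul_X_pow_ne_zero _ (ncard_ne_zero_of_mem_orbitFinset ho)
  rw [lPolynomial, rootMultiplicity_mul
    (mul_ne_zero (one_sub_C_mul_X_pow_ne_zero _ one_ne_zero) hprod),
    rootMultiplicity_prod hprod, rootMultiplicity_one_sub_C_mul_X_pow _ one_ne_zero hq,
    if_pos (pow_one _).symm, Finset.sum_congr rfl fun o ho =>
      rootMultiplicity_one_sub_C_mul_X_pow _ (ncard_ne_zero_of_mem_orbitFinset ho) hq,
    Finset.sum_boole, Nat.cast_id, ← Set.ncard_coe_finset]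
  congr 2
  ext o
  rw [Finset.mem_coe, Finset.mem_filter, mem_orbitFinset]
  refine and_congr_right ?_
  rintro ⟨n, -, rfl⟩
  rw [orbitBeta_qOrbit 𝔓 hp hdq]
  exact ⟨fun h n' hn' => (beta_eq_of_mem_qOrbit 𝔓 hp hdq hn').trans h,
    fun h => h n (mem_qOrbit_self n)⟩

end LFunctionCurve

end GriffonRank

end

theorem corollary3p3 {F : Type*} [Field F] [Fintype F]
    (p f : ℕ) [Fact p.Prime] [NeZero f] (hp : p ≠ 2) (hF : Fintype.card F = p ^ f)
    {L : Type*} [Field L] [IsAlgClosed L] [CharZero L]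
    (𝔓 : Ideal (integralClosure ℤ L)) [𝔓.IsMaximal] [CharP (integralClosure ℤ L ⧸ 𝔓) p]
    (d : ℕ) [NeZero d] (hd : 2 ≤ d) (hdq : d.Coprime (p ^ f)) :
    GriffonRank.EulerProductConverges (GriffonRank.curve F d) ∧
    ∃ P : Polynomial ℤ,
      (P : PowerSeries ℤ) = GriffonRank.lFunction (GriffonRank.curve F d) ∧
      (P.map (Int.castRingHom ℚ)).rootMultiplicity (((p : ℚ) ^ f)⁻¹) =
        1 + {o ∈ GriffonRank.orbits (p ^ f) (GriffonRank.indexSet d) |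
          ∀ n ∈ o, GriffonRank.beta p f d 𝔓 n = ((p : L) ^ f) ^ o.ncard}.ncard := by
  obtain ⟨P, hP, hPL⟩ := GriffonRank.exists_polynomial_of_map_eq
    (RingHom.injective_int (Int.castRingHom L)) (GriffonRank.map_lFunction_curve 𝔓 hp hF hdq)
  refine ⟨GriffonRank.eulerProductConverges _, P, hP, ?_⟩
  have hmap : (P.map (Int.castRingHom ℚ)).map (algebraMap ℚ L) =
      GriffonRank.lPolynomial p f 𝔓 d := by
    rw [Polynomial.map_map, ← hPL]
    exact congrArg (Polynomial.map · P) (RingHom.ext_int _ _)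
  rw [Polynomial.eq_rootMultiplicity_map (algebraMap ℚ L).injective, hmap, map_inv₀, map_pow,
    map_natCast, GriffonRank.rootMultiplicity_lPolynomial 𝔓 hp hdq]
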